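/- Write $\lambda$ for the security parameter and $[N]=\{1,\dots,N\}$. Let $\ell=\ell(\lambda)$ and $t=t(\lambda)$ be integers with $1\le t\le \ell$ that are computable (in unary) in time polynomial in $\lambda$; in particular $\ell=\mathrm{poly}(\lambda)$. Put $m=2\ell$, $T=2t$, $k=n=\lambda$ and $q=\lfloor\sqrt{\lambda(2\ell+3)}\rfloor$. Let $\mathcal R$ be an efficiently samplable and efficiently computable family of $T$-wise independent functions $[m]\to[2T]$. *Set encoding.* A key is $f=(r_1,\dots,r_k,A)$ with independent $r_i\gets\mathcal R$ and uniform $A\in\mathbb Z_q^{n\times m}$. $\mathsf{Encode}(f,X)$ for $X\subseteq[m]$ is the $k\times 2T$ matrix over $\mathbb Z_q^n$ with entries $H[i,j]=\sum_{x\in X,\ r_i(x)=j}Ae_x$. $\mathsf{Decode}(f,H_0,H_1)$ starts with $H=H_0-H_1$, $X'=\emptyset$ and repeats the following: let $Z$ be the set of all pairs $(x,w)$ such that $w\in\{Ae_x,-Ae_x\}$ and $w$ is an entry of $H$; add to $X'$ all $x$ that occur in $Z$; for each $(x,w)\in Z$ and each $i$ subtract $w$ from $H[i,r_i(x)]$;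 stop after the first round with $Z=\emptyset$. It returns $X'$ if then $H=0$, and $\bot$ if $H\ne0$ or if the loop has not stopped after $m+1$ rounds. *Hash family.* $\mathsf{Sample}(1^\lambda)$ outputs a key $h=f$; for $x\in\{0,1\}^\ell$, $\mathsf{Hash}(h,x)=\mathsf{Encode}(h,\{2i-x_i\mid i\in[\ell]\})$; $\mathsf{Eval}(h,y_0,y_1)$ is $1$ if $X'=\mathsf{Decode}(h,y_0,y_1)$ is $\bot$ or has at least $2t$ elements, and $0$ otherwise. Assume that the $(n,m,q,\beta_2=\sqrt{m+3},\beta_\infty=2)$-SIS problem is hard: every probabilistic polynomial-time (PPT) algorithm that is given a uniformly random $A\in\mathbb Z_q^{n\times m}$ finds with at most negligible probability in $\lambda$ a vector $s\in\mathbb Z^m\setminus\{0\}$ with $As=0$ in $\mathbb Z_q^n$, $\|s\|_2\le\beta_2$ and $\|s\|_\infty\le\beta_\infty$. Then the hash family is a direct-access robust property-preserving hash family on $\{0,1\}^\ell$ for the exact Hamming predicate $\mathsf{HAM}^t(x_0,x_1)=1\iff d(x_0,x_1)\ge t$. That is: 1. $\mathsf{Hash}$ and $\mathsf{Eval}$ are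 deterministic polynomial-time, keys have length polynomial in $\lambda$, and the key distribution is sampled by a PPT algorithm with fair coins (up to negligible statistical distance; the assumption on $\mathcal R$ is understood in the same way). 2. For every PPT adversary $\mathcal A$, the probability that $(x_0,x_1)\gets\mathcal A(h)$, for $h\gets\mathsf{Sample}(1^\lambda)$, satisfies $\mathsf{Eval}(h,\mathsf{Hash}(h,x_0),\mathsf{Hash}(h,x_1))\neq\mathsf{HAM}^t(x_0,x_1)$ is negligible in $\lambda$. 3. With $X=\{0,1\}^\ell$ and $Y=(\mathbb Z_q^n)^{k\times 4t}$ the set of hash values, for every $\lambda\ge1$ we have $\log_2|Y|\le\eta\,\log_2|X|$ for $$\eta=\frac{4tkn\log_2 q}{\ell}>0,\qquad\text{hence also for}\qquad \eta=\frac{2t\lambda^2\log_2(\lambda(2\ell+3))}{\ell},$$ and, if $\lambda\le 2\ell+3$, also for $\eta=4\cdot\frac{t\lambda^2\log_2(2\ell+3)}{\ell}$. (So the family is $\eta$-compressing whenever the parameters make $\eta<1$.) -/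

import Mathlib

noncomputable section

namespace RobustPPH

/-! ### Serialisation

Every algorithm maps finite lists of natural numbers to finite lists of natural numbers.  On a
machine tape the entries are written in unary and terminated by `false`.  (Security parameters are
given in unary as usual, and all other numbers that occur are polynomially bounded.) -/

/-- The tape contents for a list of natural numbers. -/
def tape (l : List ℕ) : List Bool :=
  l.flatMap fun a => List.replicate a true ++ [false]

/-- The length of the input on the tape. -/
def size (l : List ℕ) : ℕ := (tape l).length

/-- A list of lists as one list; each block is preceded by its length. -/
def pack (L : List (List ℕ)) : List ℕ := L.flatMap fun l => l.length :: l

theorem tape_injective : Function.Injective tape := by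
  have key : ∀ (a b : ℕ) (u v : List Bool),
      List.replicate a true ++ false :: u = List.replicate b true ++ false :: v →
        a = b ∧ u = v := by
    intro a
    induction a with
    | zero => intro b u v h; cases b <;> simp_all [List.replicate_succ]
    | succ a ih =>
      intro b u v h
      cases b with
      | zero => simp [List.replicate_succ] at h
      | succ b =>
        simp only [List.replicate_succ, List.cons_append, List.cons.injEq, true_and] at h
        obtain ⟨h1, h2⟩ := ih b u v h
        exact ⟨by rw [h1], h2⟩
  intro l
  induction l with
  | nil => intro l' h; cases l' <;> simp_all [tape]
  | cons a l ih =>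
    intro l' h
    cases l' with
    | nil => simp [tape] at h
    | cons b l' =>
      simp only [tape, List.flatMap_cons, List.append_assoc, List.singleton_append] at h
      obtain ⟨h1, h2⟩ := key a b _ _ h
      rw [h1, ih h2]

theorem pack_injective : Function.Injective pack := by
  intro L
  induction L with
  | nil => intro L' h; cases L' <;> simp_all [pack]
  | cons a L ih =>
    intro L' h
    cases L' with
    | nil => simp [pack] at h
    | cons b L' =>
      simp only [pack, List.flatMap_cons, List.cons_append, List.cons.injEq] at h
      obtain ⟨h1, h2⟩ := List.append_inj h.2 h.1
      rw [h1, ih h2]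

/-- An injective serialisation of the elements of a type. -/
structure Code (α : Type) where
  enc : α → List ℕ
  inj : Function.Injective enc

namespace Code

def nat : Code ℕ := ⟨fun a => [a], fun a b h => by simpa using h⟩

def list : Code (List ℕ) := ⟨id, Function.injective_id⟩

def bool : Code Bool := ⟨fun b => [b.toNat], fun a b h => by cases a <;> cases b <;> simp_all⟩

def int : Code ℤ := ⟨fun a => [Equiv.intEquivNat a], fun a b h => by simpa using h⟩

/-- Residues are written by their representative in `{0, …, q - 1}`. -/
def zmod (q : ℕ) [NeZero q] : Code (ZMod q) :=
  ⟨fun a => [a.val], fun a b h => ZMod.val_injective q (by simpa using h)⟩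

def fin (m : ℕ) : Code (Fin m) := ⟨fun a => [a.val], fun a b h => Fin.ext (by simpa using h)⟩

def prod {α β : Type} (c : Code α) (d : Code β) : Code (α × β) :=
  ⟨fun p => pack [c.enc p.1, d.enc p.2], fun p p' h => by
    have h' := pack_injective h
    simp only [List.cons.injEq, and_true] at h'
    exact Prod.ext (c.inj h'.1) (d.inj h'.2)⟩

/-- Vectors of length `m`. -/
def vec {α : Type} (c : Code α) (m : ℕ) : Code (Fin m → α) :=
  ⟨fun v => pack (List.ofFn fun i => c.enc (v i)), fun v w h => by
    have h' := List.ofFn_injective (pack_injective h)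
    funext i
    exact c.inj (congrFun h' i)⟩

def mat {α : Type} (c : Code α) (n m : ℕ) : Code (Matrix (Fin n) (Fin m) α) :=
  (c.vec m).vec n

end Code

/-! ### Polynomial time, probabilistic polynomial time, negligible functions -/

/-- Functions computed by a (multi-tape) Turing machine in time polynomial in the input length. -/
def PolyTime (F : List ℕ → List ℕ) : Prop :=
  Nonempty (Turing.TM2ComputableInPolyTime tape tape F)

/-- A probabilistic polynomial-time algorithm: a polynomial-time Turing machine that reads, besides
its input, a random tape with polynomially many independent fair coins. -/
structure PPT where
  machine : List ℕ → List ℕ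
  polyTime : PolyTime machine
  coins : Polynomial ℕ

/-- The distribution of the output on input `x`. -/
def PPT.run (S : PPT) (x : List ℕ) : PMF (List ℕ) :=
  (PMF.uniformOfFintype (Fin (S.coins.eval (size x)) → Bool)).map fun r =>
    S.machine (pack [x, List.ofFn fun i => (r i).toNat])

/-- The probability of an event. -/
def prob {α : Type} (p : PMF α) (E : Set α) : ℝ := (p.toOuterMeasure E).toReal

def Negligible (f : ℕ → ℝ) : Prop :=
  ∀ c : ℕ, ∃ N : ℕ, ∀ κ : ℕ, N < κ → f κ < 1 / (κ : ℝ) ^ c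

/-- A parameter that can be computed (in unary) in time polynomial in the security parameter.  In
particular it is bounded by a polynomial in the security parameter. -/
def EfficientParam (a : ℕ → ℕ) : Prop :=
  ∃ F, PolyTime F ∧ ∀ κ, F (Code.nat.enc κ) = Code.nat.enc (a κ)

/-- The distributions `D κ` are efficiently samplable: samples have polynomial length, and a PPT
algorithm given the security parameter samples `D κ` up to negligible statistical distance.  (With
fair coins and strict polynomial time, exact sampling is impossible already for the uniform
distribution on three elements.) -/
def Samplable {α : ℕ → Type} (code : ∀ κ, Code (α κ)) (D : ∀ κ, PMF (α κ)) : Prop :=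
  (∃ p : Polynomial ℕ, ∀ κ, ∀ a ∈ (D κ).support, size ((code κ).enc a) ≤ p.eval κ) ∧
  ∃ (S : PPT) (ε : ℕ → ℝ), Negligible ε ∧ ∀ κ, ∀ E : Set (List ℕ),
    |prob (S.run (Code.nat.enc κ)) E - prob ((D κ).map (code κ).enc) E| ≤ ε κ

/-- `k` independent samples. -/
def iid {α : Type} (p : PMF α) : (k : ℕ) → PMF (Fin k → α)
  | 0 => PMF.pure Fin.elim0
  | k + 1 => p.bind fun a => (iid p k).map fun v => Fin.cons a v

/-! ### Property-preserving hash functions -/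

/-- The syntax of a hash family with an evaluation algorithm, for every security parameter. -/
structure HashScheme where
  Key : ℕ → Type
  Dom : ℕ → Type
  Img : ℕ → Type
  keyCode : ∀ κ, Code (Key κ)
  domCode : ∀ κ, Code (Dom κ)
  imgCode : ∀ κ, Code (Img κ)
  sample : ∀ κ, PMF (Key κ)
  hash : ∀ κ, Key κ → Dom κ → Img κ
  eval : ∀ κ, Key κ → Img κ → Img κ → Bool

namespace HashScheme

variable (H : HashScheme)

/-- Sampling, hashing and evaluation are efficient; the latter two are deterministic. -/
structure IsEfficient : Prop where
  sample : Samplable H.keyCode H.sample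
  hash : ∃ F, PolyTime F ∧ ∀ κ h x,
    F ((Code.nat.prod ((H.keyCode κ).prod (H.domCode κ))).enc (κ, h, x)) =
      (H.imgCode κ).enc (H.hash κ h x)
  eval : ∃ F, PolyTime F ∧ ∀ κ h y₀ y₁,
    F ((Code.nat.prod ((H.keyCode κ).prod ((H.imgCode κ).prod (H.imgCode κ)))).enc
      (κ, h, y₀, y₁)) = Code.bool.enc (H.eval κ h y₀ y₁)

/-- `log |Y| ≤ η log |X|` at security parameter `κ`. -/
def CompressingAt (κ : ℕ) (η : ℝ) : Prop :=
  Finite (H.Dom κ) ∧ Finite (H.Img κ) ∧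
    Real.logb 2 (Nat.card (H.Img κ)) ≤ η * Real.logb 2 (Nat.card (H.Dom κ))

/-- No PPT adversary that is given the sampled hash function finds, with more than negligible
probability, inputs on which the evaluation of the hash values differs from the predicate. -/
def DirectAccessRobust (P : ∀ κ, H.Dom κ → H.Dom κ → Bool) : Prop :=
  ∀ 𝒜 : PPT, Negligible fun κ =>
    prob ((H.sample κ).bind fun h =>
        (𝒜.run ((Code.nat.prod (H.keyCode κ)).enc (κ, h))).map fun out => (h, out))
      {w | ∃ x₀ x₁, w.2 = ((H.domCode κ).prod (H.domCode κ)).enc (x₀, x₁) ∧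
        H.eval κ w.1 (H.hash κ w.1 x₀) (H.hash κ w.1 x₁) ≠ P κ x₀ x₁}

end HashScheme

/-- The exact Hamming distance predicate: `1` iff the distance is at least `t`. -/
def HAM {l : ℕ} (t : ℕ) (x y : Fin l → Bool) : Bool := decide (t ≤ hammingDist x y)

/-! ### The short integer solution problem -/

/-- No PPT algorithm, given a uniformly random `A ∈ ℤ_q^{n × m}`, finds with more than negligible
probability a nonzero integer vector `s` with `A s = 0`, `‖s‖₂ ≤ β₂` and `‖s‖_∞ ≤ β∞`. -/
def SISHard (n m q : ℕ → ℕ) [∀ κ, NeZero (q κ)] (β₂ βinf : ℕ → ℝ) : Prop :=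
  ∀ ℬ : PPT, Negligible fun κ =>
    prob ((PMF.uniformOfFintype (Matrix (Fin (n κ)) (Fin (m κ)) (ZMod (q κ)))).bind fun A =>
        (ℬ.run ((Code.nat.prod (Code.nat.prod ((Code.zmod (q κ)).mat (n κ) (m κ)))).enc
          (κ, q κ, A))).map fun out => (A, out))
      {w | ∃ s : Fin (m κ) → ℤ, w.2 = (Code.int.vec (m κ)).enc s ∧ s ≠ 0 ∧
        w.1.mulVec (fun i => (s i : ZMod (q κ))) = 0 ∧
        Real.sqrt (∑ i, (s i : ℝ) ^ 2) ≤ β₂ κ ∧ ∀ i, |(s i : ℝ)| ≤ βinf κ}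

/-! ### Families of `T`-wise independent functions -/

/-- A keyed family of functions `[m] → [c]` with a distribution on the keys. -/
structure FunctionFamily (m c : ℕ → ℕ) where
  keyDist : ℕ → PMF (List ℕ)
  eval : ∀ κ, List ℕ → Fin (m κ) → Fin (c κ)

namespace FunctionFamily

variable {m c : ℕ → ℕ} (R : FunctionFamily m c)

structure IsEfficient : Prop where
  sample : Samplable (fun _ => Code.list) R.keyDist
  eval : ∃ F, PolyTime F ∧ ∀ κ r x,
    F ((Code.nat.prod (Code.list.prod (Code.fin (m κ)))).enc (κ, r, x)) =
      (Code.fin (c κ)).enc (R.eval κ r x)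

/-- The values at any at most `T` distinct points are independent and uniform. -/
def IsWiseIndependent (T : ℕ → ℕ) : Prop :=
  ∀ κ, ∀ X : Finset (Fin (m κ)), X.card ≤ T κ → ∀ y : Fin (m κ) → Fin (c κ),
    prob (R.keyDist κ) {r | ∀ x ∈ X, R.eval κ r x = y x} = (1 / (c κ : ℝ)) ^ X.card

end FunctionFamily

/-! ### Set encodings -/

/-- The syntax of a set encoding for the universe `[m]`, here represented by `Fin m`
(with `x : Fin m` standing for `x + 1 ∈ [m]`). The value `none` stands for `⊥`. -/
structure SetEncoding (m : ℕ → ℕ) where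
  Key : ℕ → Type
  Enc : ℕ → Type
  keyCode : ∀ κ, Code (Key κ)
  encCode : ∀ κ, Code (Enc κ)
  sample : ∀ κ, PMF (Key κ)
  encode : ∀ κ, Key κ → Finset (Fin (m κ)) → Enc κ
  decode : ∀ κ, Key κ → Enc κ → Enc κ → Option (Finset (Fin (m κ)))

section Sketch

variable {k n m q c : ℕ}

/-- A `k × c` matrix with entries in `ℤ_q^n`. -/
abbrev Sketch (k n q c : ℕ) : Type := Fin k → Fin c → Fin n → ZMod q

/-- Insert the column `A eₓ` in cell `(i, rᵢ(x))` for every `x ∈ X` and every row `i`. -/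
def sketchEncode (r : Fin k → Fin m → Fin c) (A : Matrix (Fin n) (Fin m) (ZMod q))
    (X : Finset (Fin m)) : Sketch k n q c :=
  fun i j => ∑ x ∈ X with r i x = j, A.col x

/-- The set `Z` of all `(x, w)` such that `w = ± A eₓ` and some cell contains `w`. -/
def peelable [NeZero q] (A : Matrix (Fin n) (Fin m) (ZMod q)) (H : Sketch k n q c) :
    Finset (Fin m × (Fin n → ZMod q)) :=
  {p | (∃ i j, H i j = p.2) ∧ (p.2 = A.col p.1 ∨ p.2 = -A.col p.1)}

/-- Subtract `w` from cell `(i, rᵢ(x))` for every `(x, w) ∈ Z` and every row `i`. -/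
def peel (r : Fin k → Fin m → Fin c) (H : Sketch k n q c)
    (Z : Finset (Fin m × (Fin n → ZMod q))) : Sketch k n q c :=
  fun i j => H i j - ∑ p ∈ Z with r i p.1 = j, p.2

/-- The peeling loop, for at most `fuel` rounds; `⊥` if it has not stopped by then. -/
def peelLoop [NeZero q] (r : Fin k → Fin m → Fin c) (A : Matrix (Fin n) (Fin m) (ZMod q)) :
    ℕ → Sketch k n q c → Finset (Fin m) → Option (Finset (Fin m))
  | 0, _, _ => none
  | fuel + 1, H, X =>
    let Z := peelable A H
    let X' := X ∪ Z.image Prod.fst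
    let H' := peel r H Z
    if Z = ∅ then (if H' = 0 then some X' else none) else peelLoop r A fuel H' X'

/-- Decoding of the difference of two sketches.  The loop gets `m + 1` rounds, which is enough for
one new element of `[m]` in every round but the last; on malformed sketches it need not stop. -/
def sketchDecode [NeZero q] (r : Fin k → Fin m → Fin c) (A : Matrix (Fin n) (Fin m) (ZMod q))
    (H₀ H₁ : Sketch k n q c) : Option (Finset (Fin m)) :=
  peelLoop r A (m + 1) (H₀ - H₁) ∅

end Sketch

/-- The SIS-based set encoding for universe `[m]` and threshold `T`, with functions
`r₁, …, r_k : [m] → [2T]` from the family `R` and a uniform matrix `A ∈ ℤ_q^{n × m}`. -/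
def sisSetEncoding (m T k n q : ℕ → ℕ) [∀ κ, NeZero (q κ)]
    (R : FunctionFamily m fun κ => 2 * T κ) : SetEncoding m where
  Key κ := (Fin (k κ) → List ℕ) × Matrix (Fin (n κ)) (Fin (m κ)) (ZMod (q κ))
  Enc κ := Sketch (k κ) (n κ) (q κ) (2 * T κ)
  keyCode κ := (Code.list.vec (k κ)).prod ((Code.zmod (q κ)).mat (n κ) (m κ))
  encCode κ := (((Code.zmod (q κ)).vec (n κ)).vec (2 * T κ)).vec (k κ)
  sample κ := (iid (R.keyDist κ) (k κ)).bind fun r =>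
    (PMF.uniformOfFintype (Matrix (Fin (n κ)) (Fin (m κ)) (ZMod (q κ)))).map fun A => (r, A)
  encode κ f X := sketchEncode (fun i => R.eval κ (f.1 i)) f.2 X
  decode κ f H₀ H₁ := sketchDecode (fun i => R.eval κ (f.1 i)) f.2 H₀ H₁

/-! ### The hash family for the exact Hamming distance -/

/-- The set `{2i - xᵢ | i ∈ [l]} ⊆ [2l]`, in zero-based indexing. -/
def bitsToSet {l : ℕ} (x : Fin l → Bool) : Finset (Fin (2 * l)) :=
  Finset.univ.image fun i : Fin l => ⟨2 * i.val + 1 - (x i).toNat, by omega⟩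

/-- The hash family for `HAM^t` on `{0,1}^ℓ` from a set encoding (with threshold `2t`). -/
def hammingPPH (ℓ t : ℕ → ℕ) (E : SetEncoding fun κ => 2 * ℓ κ) : HashScheme where
  Key := E.Key
  Dom κ := Fin (ℓ κ) → Bool
  Img := E.Enc
  keyCode := E.keyCode
  domCode κ := Code.bool.vec (ℓ κ)
  imgCode := E.encCode
  sample := E.sample
  hash κ h x := E.encode κ h (bitsToSet x)
  eval κ h y₀ y₁ :=
    match E.decode κ h y₀ y₁ with
    | none => true
    | some X' => decide (2 * t κ ≤ X'.card)

/-- The modulus `q = ⌊√(κ (2ℓ + 3))⌋`. (The maximum matters only for `κ = 0`.) -/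
def modulus (ℓ : ℕ → ℕ) (κ : ℕ) : ℕ := max 1 (Nat.sqrt (κ * (2 * ℓ κ + 3)))

instance (ℓ : ℕ → ℕ) (κ : ℕ) : NeZero (modulus ℓ κ) :=
  ⟨by unfold modulus; omega⟩

/-- The hash family for the exact Hamming distance from the SIS-based set encoding with threshold
`2t`, `k = n = κ` and the above modulus. -/
def sisHammingPPH (ℓ t : ℕ → ℕ)
    (R : FunctionFamily (fun κ => 2 * ℓ κ) fun κ => 2 * (2 * t κ)) : HashScheme :=
  hammingPPH ℓ t (sisSetEncoding (fun κ => 2 * ℓ κ) (fun κ => 2 * t κ) (fun κ => κ) (fun κ => κ)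
    (modulus ℓ) R)

end RobustPPH

end

/-! Correctness. Let `D` be the signed indicator of the difference of the two encoded sets. Its
values are 0, 1 and -1, and its support has twice as many elements as there are positions where the
inputs differ, because each such position contributes two set elements. Sketches are linear, so cell
`(i, j)` of the difference of two sketches holds `A` times the restriction of `D` to the fibre of
`rᵢ` over `j`. Call it a collision if a cell equals `d • A eₓ` with `d` one of 0, 1, -1 although the
underlying integer vector is not `d eₓ`. The difference of these integer vectors is then a nonzero
kernel vector of `A` with entries at most 1 in absolute value, except for at most 2 at `x`. Its
squared norm is at most `(m - 1) + 4 = m + 3`, so it is a SIS solution.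

As long as no collision occurs, every peeled pair is `(x, D x • A eₓ)` with `D x = ±1`, and the
remaining sketch is always that of `D` outside the peeled set (`NoCollision.peel_eq`,
`peelStep_iterate`). A run that ends with `H = 0` has therefore found exactly the support of `D`.
For distance at least `t` both possible results, `⊥` and the support, give the answer 1. For smaller
distance the decoder must succeed. This holds if the functions are isolating: every nonempty set of
at most `T` elements has an element that is alone in its cell in some row, so each round peels
something new (`peel_of_isolating`).

Isolation must hold for all sets at once, since the adversary sees the key before choosing its
inputs. A set of `s` elements fails in one row only if its image has at most `s / 2` of the `2T`
cells. By `T`-wise independence and a union bound over the possible images, the square of this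
probability is at most `(3/4)^s`. With `k` independent rows the bound becomes `ρ^s` for `ρ =
(3/4)^⌊k/2⌋`, and summing over all sets gives `(1 + ρ)^m - 1 ≤ 2mρ` when `mρ ≤ 1`, which is
negligible (`prob_not_isolating_le`).

Reduction. Given `A`, sample the function keys, run the adversary, replay the decoder on its output
and test the candidate vectors for all rounds, cells, elements and signs. If the functions are
isolating, a wrong evaluation implies a collision, so the search succeeds (`extractList_spec`,
`mem_sisWin_of_mem_hashWin`). Sampling the function keys only approximately costs `κ` times the
error of the sampler.

Efficiency. Polynomial time refers to actual Turing machines, so a small structured language is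
compiled to stack machines (`Runs.compile`, `polyTime_of_prog`). From it come closure properties of
a predicate `Poly` on functions between coded types: composition, branching, bounded iteration, list
operations and unary arithmetic. Sketches, matrices and sets are modelled by nested lists of
numbers, and the list algorithms are proved equal to the abstract ones (`stepList_eq`,
`encodeList_eq`, `evalList_eq`). Uniform residues come from reducing `κ` fair bits modulo `q`, with
error at most `q / 2^κ` each. Compression is a count of the hash values. -/

open Turing

noncomputable section

namespace RobustPPH

/-! ### Structured stack programs -/

section Programs

variable {K : Type} [DecidableEq K] {Γ : K → Type} {σ : Type}

/-- Replace `halt` in a jump-free statement by the statement `e`. -/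
def stmtThen {Λ : Type} : TM2.Stmt Γ Empty σ → TM2.Stmt Γ Λ σ → TM2.Stmt Γ Λ σ
  | .push k f q, e => .push k f (stmtThen q e)
  | .peek k f q, e => .peek k f (stmtThen q e)
  | .pop k f q, e => .pop k f (stmtThen q e)
  | .load f q, e => .load f (stmtThen q e)
  | .branch f q₁ q₂, e => .branch f (stmtThen q₁ e) (stmtThen q₂ e)
  | .goto f, _ => .goto fun v => (f v).elim
  | .halt, e => e

/-- The effect of a jump-free statement on internal state and stacks. -/
def effect (q : TM2.Stmt Γ Empty σ) (s : σ × (∀ k, List (Γ k))) : σ × (∀ k, List (Γ k)) :=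
  ((TM2.stepAux q s.1 s.2).var, (TM2.stepAux q s.1 s.2).stk)

theorem stepAux_stmtThen {Λ : Type} (q : TM2.Stmt Γ Empty σ) (e : TM2.Stmt Γ Λ σ)
    (v : σ) (S : ∀ k, List (Γ k)) :
    TM2.stepAux (stmtThen q e) v S =
      TM2.stepAux e (TM2.stepAux q v S).var (TM2.stepAux q v S).stk := by
  induction q generalizing v S with
  | push k f q ih => exact ih _ _
  | peek k f q ih => exact ih _ _
  | pop k f q ih => exact ih _ _
  | load f q ih => exact ih _ _
  | branch f q₁ q₂ ih₁ ih₂ =>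
    simp only [stmtThen, TM2.stepAux]
    cases f v
    · exact ih₂ _ _
    · exact ih₁ _ _
  | goto f => exact (f v).elim
  | halt => rfl

variable (Γ σ) in
/-- Structured programs. -/
inductive Cmd : Type
  | prim (q : TM2.Stmt Γ Empty σ)
  | seq (c d : Cmd)
  | ite (b : σ → Bool) (c d : Cmd)
  | loop (b : σ → Bool) (c : Cmd)

namespace Cmd

/-- `Runs c s s' n`: started in `s`, the program `c` ends in `s'` after `n` steps. -/
inductive Runs : Cmd Γ σ → σ × (∀ k, List (Γ k)) → σ × (∀ k, List (Γ k)) → ℕ → Prop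
  | prim (q s) : Runs (.prim q) s (effect q s) 1
  | seq {c d s s' s'' n m} : Runs c s s' n → Runs d s' s'' m → Runs (.seq c d) s s'' (n + m)
  | ite_true {b c d s s' n} : b s.1 = true → Runs c s s' n → Runs (.ite b c d) s s' (n + 1)
  | ite_false {b c d s s' n} : b s.1 = false → Runs d s s' n → Runs (.ite b c d) s s' (n + 1)
  | loop_done {b c s} : b s.1 = false → Runs (.loop b c) s s 1
  | loop_step {b c s s' s'' n m} : b s.1 = true → Runs c s s' n → Runs (.loop b c) s' s'' m →
      Runs (.loop b c) s s'' (m + n + 1)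

/-- The labels of the compiled program. -/
def Lab : Cmd Γ σ → Type
  | .prim _ => Unit
  | .seq c d => Lab c ⊕ Lab d
  | .ite _ c d => Option (Lab c ⊕ Lab d)
  | .loop _ c => Option (Lab c)

instance instFintypeLab : (c : Cmd Γ σ) → Fintype (Lab c)
  | .prim _ => inferInstanceAs (Fintype Unit)
  | .seq c d =>
    letI := instFintypeLab c
    letI := instFintypeLab d
    inferInstanceAs (Fintype (Lab c ⊕ Lab d))
  | .ite _ c d =>
    letI := instFintypeLab c
    letI := instFintypeLab d
    inferInstanceAs (Fintype (Option (Lab c ⊕ Lab d)))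
  | .loop _ c =>
    letI := instFintypeLab c
    inferInstanceAs (Fintype (Option (Lab c)))

/-- The entry label. -/
def entry : (c : Cmd Γ σ) → Lab c
  | .prim _ => ()
  | .seq c _ => .inl (entry c)
  | .ite _ _ _ => none
  | .loop _ _ => none

/-- The compiled program, with labels embedded into `Λ`, that ends with the statement `e`. -/
def code {Λ : Type} : (c : Cmd Γ σ) → (Lab c → Λ) → TM2.Stmt Γ Λ σ → Lab c → TM2.Stmt Γ Λ σ
  | .prim q, _, e, _ => stmtThen q e
  | .seq c d, i, e, l =>
    match l with
    | .inl l => code c (fun l => i (.inl l)) (.goto fun _ => i (.inr (entry d))) l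
    | .inr l => code d (fun l => i (.inr l)) e l
  | .ite b c d, i, e, l =>
    match l with
    | none => .branch b (.goto fun _ => i (some (.inl (entry c))))
        (.goto fun _ => i (some (.inr (entry d))))
    | some (.inl l) => code c (fun l => i (some (.inl l))) e l
    | some (.inr l) => code d (fun l => i (some (.inr l))) e l
  | .loop b c, i, e, l =>
    match l with
    | none => .branch b (.goto fun _ => i (some (entry c))) e
    | some l => code c (fun l => i (some l)) (.goto fun _ => i none) l

/-- Step counts agree exactly: a jump at the end of a statement is carried out in the same machine
step, so sequencing is free and each guard costs one step. The embedding `i` and the continuation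
`e` are arbitrary, so that the induction applies to subprograms inside a larger machine. -/
theorem Runs.compile {Λ : Type} {M : Λ → TM2.Stmt Γ Λ σ} {c : Cmd Γ σ} {s s' n}
    (h : Runs c s s' n) : ∀ (i : Lab c → Λ) (e : TM2.Stmt Γ Λ σ),
    (∀ l, M (i l) = code c i e l) →
    (flip bind (TM2.step M))^[n] (some ⟨some (i (entry c)), s.1, s.2⟩) =
      some (TM2.stepAux e s'.1 s'.2) := by
  induction h with
  | prim q s =>
    intro i e hM
    have h : M (i (entry (.prim q))) = stmtThen q e := hM _
    change some (TM2.stepAux (M (i (entry (.prim q)))) s.1 s.2) = _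
    rw [h, stepAux_stmtThen]
    rfl
  | @seq c d s s' s'' n m _ _ ih₁ ih₂ =>
    intro i e hM
    rw [Nat.add_comm, Function.iterate_add_apply]
    have := ih₁ (fun l => i (.inl l)) (.goto fun _ => i (.inr (entry d))) fun l => hM (.inl l)
    rw [entry, this]
    exact ih₂ (fun l => i (.inr l)) e fun l => hM (.inr l)
  | @ite_true b c d s s' n hb _ ih =>
    intro i e hM
    rw [Function.iterate_succ_apply]
    have h0 : flip bind (TM2.step M) (some ⟨some (i (entry (.ite b c d))), s.1, s.2⟩) =
        some ⟨some (i (some (.inl (entry c)))), s.1, s.2⟩ := by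
      have h : M (i (entry (.ite b c d))) = .branch b (.goto fun _ => i (some (.inl (entry c))))
        (.goto fun _ => i (some (.inr (entry d)))) := hM _
      change some (TM2.stepAux (M (i (entry (.ite b c d)))) s.1 s.2) = _
      rw [h]
      simp only [TM2.stepAux, hb, cond]
    rw [h0]
    exact ih (fun l => i (some (.inl l))) e fun l => hM (some (.inl l))
  | @ite_false b c d s s' n hb _ ih =>
    intro i e hM
    rw [Function.iterate_succ_apply]
    have h0 : flip bind (TM2.step M) (some ⟨some (i (entry (.ite b c d))), s.1, s.2⟩) =
        some ⟨some (i (some (.inr (entry d)))), s.1, s.2⟩ := by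
      have h : M (i (entry (.ite b c d))) = .branch b (.goto fun _ => i (some (.inl (entry c))))
        (.goto fun _ => i (some (.inr (entry d)))) := hM _
      change some (TM2.stepAux (M (i (entry (.ite b c d)))) s.1 s.2) = _
      rw [h]
      simp only [TM2.stepAux, hb, cond]
    rw [h0]
    exact ih (fun l => i (some (.inr l))) e fun l => hM (some (.inr l))
  | @loop_done b c s hb =>
    intro i e hM
    have h : M (i (entry (.loop b c))) = .branch b (.goto fun _ => i (some (entry c))) e := hM _
    change some (TM2.stepAux (M (i (entry (.loop b c)))) s.1 s.2) = _
    rw [h]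
    simp only [TM2.stepAux, hb, cond_false]
  | @loop_step b c s s' s'' n m hb _ _ ih₁ ih₂ =>
    intro i e hM
    rw [Function.iterate_succ_apply]
    have h0 : flip bind (TM2.step M) (some ⟨some (i (entry (.loop b c))), s.1, s.2⟩) =
        some ⟨some (i (some (entry c))), s.1, s.2⟩ := by
      have h : M (i (entry (.loop b c))) = .branch b (.goto fun _ => i (some (entry c))) e :=
        hM _
      change some (TM2.stepAux (M (i (entry (.loop b c)))) s.1 s.2) = _
      rw [h]
      simp only [TM2.stepAux, hb, cond_true]
    rw [h0, Function.iterate_add_apply]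
    have := ih₁ (fun l => i (some l)) (.goto fun _ => i none) fun l => hM (some l)
    rw [this]
    exact ih₂ i e hM

/-- Running in at most `n` steps. -/
def RunsIn (c : Cmd Γ σ) (s s' : σ × (∀ k, List (Γ k))) (n : ℕ) : Prop :=
  ∃ m ≤ n, Runs c s s' m

theorem RunsIn.mono {c : Cmd Γ σ} {s s' n m} (h : RunsIn c s s' n) (hm : n ≤ m) :
    RunsIn c s s' m :=
  h.imp fun _ h => ⟨h.1.trans hm, h.2⟩

theorem RunsIn.prim {q : TM2.Stmt Γ Empty σ} {s s'} (h : effect q s = s') :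
    RunsIn (.prim q) s s' 1 :=
  ⟨1, le_rfl, h ▸ .prim q s⟩

theorem RunsIn.seq {c d : Cmd Γ σ} {s s' s'' n m} (h₁ : RunsIn c s s' n)
    (h₂ : RunsIn d s' s'' m) : RunsIn (.seq c d) s s'' (n + m) := by
  obtain ⟨n', hn, h₁⟩ := h₁
  obtain ⟨m', hm, h₂⟩ := h₂
  exact ⟨_, add_le_add hn hm, h₁.seq h₂⟩

theorem RunsIn.ite_true {b} {c d : Cmd Γ σ} {s s' n} (hb : b s.1 = true)
    (h : RunsIn c s s' n) : RunsIn (.ite b c d) s s' (n + 1) := by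
  obtain ⟨n', hn, h⟩ := h
  exact ⟨_, Nat.add_le_add_right hn 1, .ite_true hb h⟩

theorem RunsIn.ite_false {b} {c d : Cmd Γ σ} {s s' n} (hb : b s.1 = false)
    (h : RunsIn d s s' n) : RunsIn (.ite b c d) s s' (n + 1) := by
  obtain ⟨n', hn, h⟩ := h
  exact ⟨_, Nat.add_le_add_right hn 1, .ite_false hb h⟩

theorem RunsIn.loop_done {b} {c : Cmd Γ σ} {s} (hb : b s.1 = false) :
    RunsIn (.loop b c) s s 1 :=
  ⟨1, le_rfl, .loop_done hb⟩

theorem RunsIn.loop_step {b} {c : Cmd Γ σ} {s s' s'' n m} (hb : b s.1 = true)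
    (h₁ : RunsIn c s s' n) (h₂ : RunsIn (.loop b c) s' s'' m) :
    RunsIn (.loop b c) s s'' (n + 1 + m) := by
  obtain ⟨n', hn, h₁⟩ := h₁
  obtain ⟨m', hm, h₂⟩ := h₂
  exact ⟨_, by omega, .loop_step hb h₁ h₂⟩

end Cmd

end Programs

/-! ### Programs with three bit stacks that call given machines -/

section Calls

variable {ι : Type} [DecidableEq ι] (B : ι → TM2ComputableAux Bool Bool)

/-- The stacks: three stacks of bits and the stacks of the given machines. -/
abbrev Stk : Type := Fin 3 ⊕ Σ i, (B i).tm.K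

abbrev Alph : Stk B → Type
  | .inl _ => Bool
  | .inr k => (B k.1).tm.Γ k.2

/-- The internal state: the last bit read, and labels and internal states of the machines. -/
abbrev St : Type := Option Bool × (∀ i, Option (B i).tm.Λ × (B i).tm.σ)

abbrev Prog : Type := Cmd (Alph B) (St B)

variable {B}

def joinStk (R : Fin 3 → List Bool) (S : ∀ i, ∀ k, List ((B i).tm.Γ k)) :
    ∀ k, List (Alph B k)
  | .inl r => R r
  | .inr k => S k.1 k.2

def conf (o : Option Bool) (V : ∀ i, Option (B i).tm.Λ × (B i).tm.σ) (R : Fin 3 → List Bool)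
    (S : ∀ i, ∀ k, List ((B i).tm.Γ k)) : St B × (∀ k, List (Alph B k)) :=
  ((o, V), joinStk R S)

theorem update_joinStk_inl (R : Fin 3 → List Bool) (S : ∀ i, ∀ k, List ((B i).tm.Γ k)) (r)
    (x : List Bool) :
    Function.update (joinStk R S) (Sum.inl r) x = joinStk (Function.update R r x) S := by
  funext k
  rcases k with k | k
  · by_cases h : k = r
    · subst h; simp [joinStk]
    · simp [joinStk, h]
  · simp [joinStk]

theorem update_joinStk_inr (R : Fin 3 → List Bool) (S : ∀ i, ∀ k, List ((B i).tm.Γ k)) (i k)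
    (x : List ((B i).tm.Γ k)) :
    Function.update (joinStk R S) (Sum.inr ⟨i, k⟩) x =
      joinStk R (Function.update S i (Function.update (S i) k x)) := by
  funext j
  rcases j with j | ⟨j, l⟩
  · simp [joinStk]
  · by_cases h : j = i
    · subst h
      by_cases h' : l = k
      · subst h'; simp [joinStk]
      · have : (Sum.inr ⟨j, l⟩ : Stk B) ≠ Sum.inr ⟨j, k⟩ := by simpa using h'
        simp [joinStk, this, h']
    · have : (Sum.inr ⟨j, l⟩ : Stk B) ≠ Sum.inr ⟨i, k⟩ := by simp [h]
      simp [joinStk, this, h]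

/-- The statement of machine `i`, with jumps replaced by assignments to the stored label. -/
def translate (i : ι) : TM2.Stmt (B i).tm.Γ (B i).tm.Λ (B i).tm.σ → TM2.Stmt (Alph B) Empty (St B)
  | .push k f q => .push (Sum.inr ⟨i, k⟩) (fun v => f (v.2 i).2) (translate i q)
  | .peek k f q => .peek (Sum.inr ⟨i, k⟩)
      (fun v a => (v.1, Function.update v.2 i ((v.2 i).1, f (v.2 i).2 a))) (translate i q)
  | .pop k f q => .pop (Sum.inr ⟨i, k⟩)
      (fun v a => (v.1, Function.update v.2 i ((v.2 i).1, f (v.2 i).2 a))) (translate i q)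
  | .load f q => .load
      (fun v => (v.1, Function.update v.2 i ((v.2 i).1, f (v.2 i).2))) (translate i q)
  | .branch f q₁ q₂ => .branch (fun v => f (v.2 i).2) (translate i q₁) (translate i q₂)
  | .goto f => .load
      (fun v => (v.1, Function.update v.2 i (some (f (v.2 i).2), (v.2 i).2))) .halt
  | .halt => .load (fun v => (v.1, Function.update v.2 i (none, (v.2 i).2))) .halt

/-- The configuration in which machine `i` has the configuration `c`. -/
def atCfg (o : Option Bool) (V : ∀ i, Option (B i).tm.Λ × (B i).tm.σ) (R : Fin 3 → List Bool)
    (S : ∀ i, ∀ k, List ((B i).tm.Γ k)) (i : ι) (c : (B i).tm.Cfg) :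
    St B × (∀ k, List (Alph B k)) :=
  conf o (Function.update V i (c.l, c.var)) R (Function.update S i c.stk)

/-- With jumps turned into assignments to a stored label, a statement of the called machine is
jump-free, so a whole step of that machine becomes one primitive command of the caller. -/
theorem effect_translate (i : ι) (q : TM2.Stmt (B i).tm.Γ (B i).tm.Λ (B i).tm.σ) (o V R S) :
    effect (translate i q) (conf o V R S) =
      atCfg o V R S i (TM2.stepAux q (V i).2 (S i)) := by
  induction q generalizing V S with
  | push k f q ih =>
    have := ih V (Function.update S i (Function.update (S i) k (f (V i).2 :: S i k)))
    simp only [atCfg, Function.update_self, Function.update_idem] at this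
    simp only [effect, conf, translate, TM2.stepAux, update_joinStk_inr] at this ⊢
    exact this
  | peek k f q ih =>
    have := ih (Function.update V i ((V i).1, f (V i).2 (S i k).head?)) S
    simp only [atCfg, Function.update_self, Function.update_idem] at this
    simp only [effect, conf, translate, TM2.stepAux] at this ⊢
    exact this
  | pop k f q ih =>
    have := ih (Function.update V i ((V i).1, f (V i).2 (S i k).head?))
      (Function.update S i (Function.update (S i) k (S i k).tail))
    simp only [atCfg, Function.update_self, Function.update_idem] at this
    simp only [effect, conf, translate, TM2.stepAux, update_joinStk_inr] at this ⊢
    exact this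
  | load f q ih =>
    have := ih (Function.update V i ((V i).1, f (V i).2)) S
    simp only [atCfg, Function.update_self, Function.update_idem] at this
    simp only [effect, conf, translate, TM2.stepAux] at this ⊢
    exact this
  | branch f q₁ q₂ ih₁ ih₂ =>
    have h₁ := ih₁ V S
    have h₂ := ih₂ V S
    simp only [effect, conf, translate, TM2.stepAux, atCfg] at h₁ h₂ ⊢
    cases f (V i).2
    · exact h₂
    · exact h₁
  | goto f =>
    simp [effect, conf, translate, atCfg, TM2.stepAux]
  | halt =>
    simp [effect, conf, translate, atCfg, TM2.stepAux]

open Classical in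
/-- Execute the statement at the stored label of machine `i`, found in the list `L` of labels. -/
def dispatch (i : ι) : List (B i).tm.Λ → TM2.Stmt (Alph B) Empty (St B)
  | [] => .halt
  | l :: L => .branch (fun v => decide ((v.2 i).1 = some l)) (translate i ((B i).tm.m l))
      (dispatch i L)

theorem effect_dispatch (i : ι) (L : List (B i).tm.Λ) (l : (B i).tm.Λ) (hl : l ∈ L) (s)
    (hs : (s.1.2 i).1 = some l) :
    effect (dispatch i L) s = effect (translate i ((B i).tm.m l)) s := by
  induction L with
  | nil => simp at hl
  | cons a L ih =>
    by_cases h : l = a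
    · subst h
      simp [effect, dispatch, hs]
    · have := ih (by simpa [h] using hl)
      simp only [effect, dispatch, TM2.stepAux, hs, Option.some.injEq, h, decide_false,
        cond_false] at this ⊢
      exact this

/-- Run machine `i` until it halts. -/
def runMachine (i : ι) : Prog B :=
  .loop (fun v => (v.2 i).1.isSome)
    (.prim (dispatch i (@Finset.univ _ (B i).tm.ΛFin).toList))

/-- Each simulated step costs a guard and a dispatch; the last guard finds no label and ends the
loop. -/
theorem runMachine_runsIn (o V R S) (i : ι) (n : ℕ) (c c' : (B i).tm.Cfg)
    (h : (flip bind (B i).tm.step)^[n] (some c) = some c') (hc : c'.l = none) :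
    (runMachine i).RunsIn (atCfg o V R S i c) (atCfg o V R S i c') (2 * n + 1) := by
  induction n generalizing c with
  | zero =>
    obtain rfl : c = c' := by simpa using h
    exact .loop_done (by simp [atCfg, conf, hc])
  | succ n ih =>
    rw [Function.iterate_succ_apply] at h
    obtain ⟨l, v, T⟩ := c
    cases l with
    | none =>
      -- A halted configuration has no successor, so with steps left the iteration could not end in
      -- `some c'`.
      exfalso
      have h0 : ∀ m, (flip bind (B i).tm.step)^[m] none = none := by
        intro m
        induction m with
        | zero => rfl
        | succ m ihm => rw [Function.iterate_succ_apply]; exact ihm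
      have : flip bind (B i).tm.step (some ⟨none, v, T⟩) = none := rfl
      rw [this, h0] at h
      cases h
    | some l =>
      have h1 : flip bind (B i).tm.step (some ⟨some l, v, T⟩) =
        some (TM2.stepAux ((B i).tm.m l) v T) := rfl
      rw [h1] at h
      refine (RunsIn_aux ?_ (ih _ h)).mono (show 1 + 1 + (2 * n + 1) ≤ _ by omega)
      refine .prim ?_
      rw [effect_dispatch i _ l (by simp) _ (by simp [atCfg, conf])]
      unfold atCfg
      rw [effect_translate]
      simp [atCfg]
where
  RunsIn_aux {l : (B i).tm.Λ} {v T s' s'' n m} {c : Prog B}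
      (h₁ : c.RunsIn (atCfg o V R S i ⟨some l, v, T⟩) s' n)
      (h₂ : (Cmd.loop (fun v => (v.2 i).1.isSome) c).RunsIn s' s'' m) :
      (Cmd.loop (fun v => (v.2 i).1.isSome) c).RunsIn (atCfg o V R S i ⟨some l, v, T⟩) s''
        (n + 1 + m) :=
    .loop_step (by simp [atCfg, conf]) h₁ h₂

end Calls

/-! ### Loops that read a stack of bits -/

section Scan

variable {K : Type} [DecidableEq K] {Γ : K → Type} {σ : Type}

/-- A loop that reads a stack of bits as long as the bits satisfy a condition. Here `Q o u w` is the
state after the bits in `w` and then `o` have been read, with `u` left on the stack. -/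
theorem Cmd.RunsIn.scan {Q : Option Bool → List Bool → List Bool → σ × (∀ k, List (Γ k))}
    {b : σ → Bool} {body : Cmd Γ σ} (cond : Option Bool → Bool)
    (hb : ∀ o u w, b (Q o u w).1 = cond o)
    (hbody : ∀ a u w, body.RunsIn (Q (some a) u w) (Q u.head? u.tail (a :: w)) 1)
    (u v w : List Bool) (hu : ∀ a ∈ u, cond (some a) = true) (hv : cond v.head? = false) :
    (Cmd.loop b body).RunsIn (Q (u ++ v).head? (u ++ v).tail w)
      (Q v.head? v.tail (u.reverse ++ w)) (2 * u.length + 1) := by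
  induction u generalizing w with
  | nil => exact .loop_done (by simp [hb, hv])
  | cons a u ih =>
    have := ih (a :: w) fun a ha => hu a (by simp [ha])
    refine (RunsIn.loop_step (n := 1) (by simp [hb, hu a]) (hbody a _ _)
      (by simpa using this)).mono ?_
    simp only [List.length_cons]
    omega

theorem Cmd.RunsIn.scanAll {Q : Option Bool → List Bool → List Bool → σ × (∀ k, List (Γ k))}
    {b : σ → Bool} {body : Cmd Γ σ}
    (hb : ∀ o u w, b (Q o u w).1 = o.isSome)
    (hbody : ∀ a u w, body.RunsIn (Q (some a) u w) (Q u.head? u.tail (a :: w)) 1)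
    (u w : List Bool) :
    (Cmd.loop b body).RunsIn (Q u.head? u.tail w) (Q none [] (u.reverse ++ w))
      (2 * u.length + 1) := by
  simpa using scan Option.isSome hb hbody u [] w (by simp) rfl

end Scan

/-! ### Calling a machine on the content of a bit stack -/

section Calls

variable {ι : Type} [DecidableEq ι] {B : ι → TM2ComputableAux Bool Bool}

/-- Configurations in which the given machines are in their initial states. -/
def clean (o : Option Bool) (R : Fin 3 → List Bool) : St B × (∀ k, List (Alph B k)) :=
  conf o (fun i => (none, (B i).tm.initialState)) R fun _ _ => []

/-- Pop a bit from stack `r`, then do `q`. -/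
def popThen (r : Fin 3) (q : TM2.Stmt (Alph B) Empty (St B)) : TM2.Stmt (Alph B) Empty (St B) :=
  .pop (.inl r) (fun v a => (a, v.2)) q

/-- Push the last bit read to stack `r`, then do `q`. -/
def pushThen (r : Fin 3) (q : TM2.Stmt (Alph B) Empty (St B)) : TM2.Stmt (Alph B) Empty (St B) :=
  .push (.inl r) (fun v => v.1.getD false) q

/-- Push the bit `b` to stack `r`, then do `q`. -/
def putThen (r : Fin 3) (b : Bool) (q : TM2.Stmt (Alph B) Empty (St B)) :
    TM2.Stmt (Alph B) Empty (St B) :=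
  .push (.inl r) (fun _ => b) q

theorem effect_popThen (r : Fin 3) (q : TM2.Stmt (Alph B) Empty (St B)) (o V R S) :
    effect (popThen r q) (conf o V R S) =
      effect q (conf (R r).head? V (Function.update R r (R r).tail) S) := by
  simp [effect, popThen, conf, TM2.stepAux, update_joinStk_inl]
  exact ⟨rfl, rfl⟩

theorem effect_pushThen (r : Fin 3) (q : TM2.Stmt (Alph B) Empty (St B)) (o V R S) :
    effect (pushThen r q) (conf o V R S) =
      effect q (conf o V (Function.update R r (o.getD false :: R r)) S) := by
  simp [effect, pushThen, conf, TM2.stepAux]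
  rw [← update_joinStk_inl]
  exact ⟨rfl, rfl⟩

theorem effect_putThen (r : Fin 3) (b) (q : TM2.Stmt (Alph B) Empty (St B)) (o V R S) :
    effect (putThen r b q) (conf o V R S) =
      effect q (conf o V (Function.update R r (b :: R r)) S) := by
  simp [effect, putThen, conf, TM2.stepAux]
  rw [← update_joinStk_inl]
  exact ⟨rfl, rfl⟩

theorem effect_halt (s : St B × (∀ k, List (Alph B k))) : effect .halt s = s := rfl

/-- Run machine `i` on the content of stack `r`, read from bottom to top, and write the output to
stack `r` from bottom to top. -/
def callRev (i : ι) (r : Fin 3) : Prog B :=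
  .seq (.prim (popThen r .halt))
  (.seq (.loop (fun v => v.1.isSome) (.prim
    (.push (.inr ⟨i, (B i).tm.k₀⟩) (fun v => (B i).inputAlphabet.symm (v.1.getD false))
      (popThen r .halt))))
  (.seq (.prim (.load (fun v => (v.1, Function.update v.2 i
    (some (B i).tm.main, (B i).tm.initialState))) .halt))
  (.seq (runMachine i)
  (.seq (.prim (.pop (.inr ⟨i, (B i).tm.k₁⟩)
    (fun v a => (a.map (B i).outputAlphabet, v.2)) .halt))
  (.loop (fun v => v.1.isSome) (.prim (pushThen r (.pop (.inr ⟨i, (B i).tm.k₁⟩)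
    (fun v a => (a.map (B i).outputAlphabet, v.2)) .halt))))))))

theorem initList_eq (tm : FinTM2) (s : List (tm.Γ tm.k₀)) :
    initList tm s = ⟨some tm.main, tm.initialState, Function.update (fun _ => []) tm.k₀ s⟩ := by
  unfold initList
  congr 1
  funext k
  by_cases h : k = tm.k₀
  · subst h; simp
  · simp [h]

theorem haltList_eq (tm : FinTM2) (s : List (tm.Γ tm.k₁)) :
    haltList tm s = ⟨none, tm.initialState, Function.update (fun _ => []) tm.k₁ s⟩ := by
  unfold haltList
  congr 1
  funext k
  by_cases h : k = tm.k₁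
  · subst h; simp
  · simp [h]

/-- Transferring a stack by popping and pushing reverses it, which is why input and output appear
reversed on stack `r`. The halting convention of the machine model restores the initial state and
empties all stacks except the output stack, so the configuration is clean again and the machine can
be called repeatedly. -/
theorem callRev_runsIn (i : ι) (r : Fin 3) (o : Option Bool) (R : Fin 3 → List Bool)
    (u v : List Bool) (m : ℕ)
    (h : TM2OutputsInTime (B i).tm (u.map (B i).inputAlphabet.invFun)
      (some (v.map (B i).outputAlphabet.invFun)) m) (hR : R r = u.reverse) :
    (callRev i r : Prog B).RunsIn (clean o R) (clean none (Function.update R r v.reverse))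
      (2 * (u.length + v.length + m) + 10) := by
  obtain ⟨⟨n, hn⟩, hnm⟩ := h
  set V : ∀ j, Option (B j).tm.Λ × (B j).tm.σ := fun i => (none, (B i).tm.initialState)
  have h1 : Cmd.RunsIn (.prim (popThen r .halt) : Prog B) (clean o R)
      (conf u.reverse.head? V (Function.update R r u.reverse.tail) fun _ _ => []) 1 :=
    .prim (by rw [clean, effect_popThen, effect_halt, hR])
  have h2 : Cmd.RunsIn (.loop (fun v => v.1.isSome) (.prim
      (.push (.inr ⟨i, (B i).tm.k₀⟩) (fun v => (B i).inputAlphabet.symm (v.1.getD false))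
        (popThen r .halt))) : Prog B)
      (conf u.reverse.head? V (Function.update R r u.reverse.tail) fun _ _ => [])
      (conf none V (Function.update R r []) (Function.update (fun _ _ => []) i
        (Function.update (fun _ => []) (B i).tm.k₀ (u.map (B i).inputAlphabet.symm))))
      (2 * u.length + 1) := by
    have := Cmd.RunsIn.scanAll (b := fun v : St B => v.1.isSome) (body := (.prim
      (.push (.inr ⟨i, (B i).tm.k₀⟩) (fun v => (B i).inputAlphabet.symm (v.1.getD false))
        (popThen r .halt)) : Prog B))
      (Q := fun o u w => conf (B := B) o V (Function.update R r u)
        (Function.update (fun _ _ => []) i (Function.update (fun _ => []) (B i).tm.k₀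
          (w.map (B i).inputAlphabet.symm)))) (fun _ _ _ => rfl)
      (fun a u w => by
        refine .prim ?_
        have := effect_popThen (B := B) r .halt (some a) V (Function.update R r u)
          (Function.update (fun _ _ => []) i (Function.update (fun _ => []) (B i).tm.k₀
          ((a :: w).map (B i).inputAlphabet.symm)))
        rw [effect_halt] at this
        simp only [Function.update_self, Function.update_idem] at this
        rw [← this]
        simp [effect, conf, TM2.stepAux, update_joinStk_inr, joinStk]) u.reverse []
    simpa using this
  have h3 : Cmd.RunsIn (.prim (.load (fun v => (v.1, Function.update v.2 i
      (some (B i).tm.main, (B i).tm.initialState))) .halt) : Prog B)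
      (conf none V (Function.update R r []) (Function.update (fun _ _ => []) i
        (Function.update (fun _ => []) (B i).tm.k₀ (u.map (B i).inputAlphabet.symm))))
      (atCfg none V (Function.update R r []) (fun _ _ => []) i
        (initList (B i).tm (u.map (B i).inputAlphabet.invFun))) 1 :=
    .prim (by rw [initList_eq]; rfl)
  have h4 := runMachine_runsIn none V (Function.update R r []) (fun _ _ => []) i n _ _ hn
    (by rw [haltList_eq])
  have hV : Function.update V i (none, (B i).tm.initialState) = V := by
    funext j
    by_cases hj : j = i
    · subst hj; simp [V]
    · simp [hj]
  rw [haltList_eq] at h4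
  unfold atCfg at h4
  rw [hV] at h4
  set out : Option Bool → List Bool → List Bool → St B × (∀ k, List (Alph B k)) := fun o v w =>
    conf o V (Function.update R r w) (Function.update (fun _ _ => []) i
      (Function.update (fun _ => []) (B i).tm.k₁ (v.map (B i).outputAlphabet.symm))) with hout
  have key : ∀ o v w, effect (.pop (.inr ⟨i, (B i).tm.k₁⟩)
      (fun v a => (a.map (B i).outputAlphabet, v.2)) .halt) (out o v w) =
      out v.head? v.tail w := by
    intro o v w
    simp [effect, conf, TM2.stepAux, update_joinStk_inr, out, joinStk]
  have h5 : Cmd.RunsIn (.prim (.pop (.inr ⟨i, (B i).tm.k₁⟩)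
      (fun v a => (a.map (B i).outputAlphabet, v.2)) .halt) : Prog B) (out none v [])
      (out v.head? v.tail []) 1 := .prim (key _ _ _)
  have h6 := Cmd.RunsIn.scanAll (b := fun v : St B => v.1.isSome) (Q := out)
    (body := .prim (pushThen r (.pop (.inr ⟨i, (B i).tm.k₁⟩)
      (fun v a => (a.map (B i).outputAlphabet, v.2)) .halt))) (fun _ _ _ => rfl)
    (fun a v w => .prim (by
      rw [hout, effect_pushThen]
      simpa [out] using key (some a) v (a :: w))) v []
  have hend : out none [] (v.reverse ++ []) = clean none (Function.update R r v.reverse) := by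
    have : Function.update (fun i k => ([] : List ((B i).tm.Γ k))) i (fun _ => []) =
        fun _ _ => [] := Function.update_eq_self i _
    simp only [out, clean, List.append_nil, List.map_nil, V]
    rw [show Function.update (fun k => ([] : List ((B i).tm.Γ k))) (B i).tm.k₁ [] = fun _ => []
      from Function.update_eq_self _ _, this]
  rw [hend] at h6
  refine (h1.seq (h2.seq (h3.seq (h4.seq (h5.seq h6))))).mono ?_
  change n ≤ m at hnm
  omega

end Calls

/-! ### Polynomial bounds -/

theorem polynomial_eval_mono (p : Polynomial ℕ) {a b : ℕ} (h : a ≤ b) : p.eval a ≤ p.eval b := by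
  rw [Polynomial.eval_eq_sum, Polynomial.eval_eq_sum]
  exact Finset.sum_le_sum fun i _ => Nat.mul_le_mul_left _ (Nat.pow_le_pow_left h i)

/-- `T` is bounded by a polynomial in `μ`. -/
def PolyBdd {α : Type*} (μ T : α → ℕ) : Prop := ∃ p : Polynomial ℕ, ∀ x, T x ≤ p.eval (μ x)

namespace PolyBdd

variable {α β : Type*} {μ T U : α → ℕ}

theorem self : PolyBdd μ μ := ⟨.X, fun _ => by simp⟩

theorem const (n : ℕ) : PolyBdd μ fun _ => n := ⟨.C n, fun _ => by simp⟩

theorem add (hT : PolyBdd μ T) (hU : PolyBdd μ U) : PolyBdd μ fun x => T x + U x := by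
  obtain ⟨p, hp⟩ := hT
  obtain ⟨q, hq⟩ := hU
  exact ⟨p + q, fun x => by simpa using add_le_add (hp x) (hq x)⟩

theorem mul (hT : PolyBdd μ T) (hU : PolyBdd μ U) : PolyBdd μ fun x => T x * U x := by
  obtain ⟨p, hp⟩ := hT
  obtain ⟨q, hq⟩ := hU
  exact ⟨p * q, fun x => by simpa using Nat.mul_le_mul (hp x) (hq x)⟩

theorem mono (hT : PolyBdd μ T) (h : ∀ x, U x ≤ T x) : PolyBdd μ U :=
  hT.imp fun _ hp x => (h x).trans (hp x)

theorem trans {ν : α → ℕ} (hν : PolyBdd μ ν) (hT : PolyBdd ν T) : PolyBdd μ T := by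
  obtain ⟨p, hp⟩ := hν
  obtain ⟨q, hq⟩ := hT
  exact ⟨q.comp p, fun x => by
    rw [Polynomial.eval_comp]
    exact (hq x).trans (polynomial_eval_mono q (hp x))⟩

theorem comp {ν V : β → ℕ} (hV : PolyBdd ν V) {g : α → β} (hg : PolyBdd μ fun x => ν (g x)) :
    PolyBdd μ fun x => V (g x) :=
  hg.trans (hV.imp fun _ hp x => hp (g x))

theorem eval (hT : PolyBdd μ T) (p : Polynomial ℕ) : PolyBdd μ fun x => p.eval (T x) :=
  hT.trans ⟨p, fun _ => le_rfl⟩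

end PolyBdd

/-! ### Outputs of polynomial-time machines have polynomial length -/

/-- The number of symbols pushed by a statement is at most this number. -/
def pushes {K : Type} {Γ : K → Type} {Λ σ : Type} : TM2.Stmt Γ Λ σ → ℕ
  | .push _ _ q => pushes q + 1
  | .peek _ _ q => pushes q
  | .pop _ _ q => pushes q
  | .load _ q => pushes q
  | .branch _ q₁ q₂ => pushes q₁ + pushes q₂
  | .goto _ => 0
  | .halt => 0

theorem length_stepAux_le {K : Type} [DecidableEq K] {Γ : K → Type} {Λ σ : Type}
    (q : TM2.Stmt Γ Λ σ) (v : σ) (S : ∀ k, List (Γ k)) (k : K) :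
    ((TM2.stepAux q v S).stk k).length ≤ (S k).length + pushes q := by
  induction q generalizing v S with
  | push j f q ih =>
    refine (ih _ _).trans ?_
    by_cases h : k = j
    · subst h; simp [pushes]; omega
    · simp [h, pushes]
  | peek j f q ih => exact ih _ _
  | pop j f q ih =>
    refine (ih _ _).trans ?_
    by_cases h : k = j
    · subst h; simp [pushes]
    · simp [h, pushes]
  | load f q ih => exact ih _ _
  | branch f q₁ q₂ ih₁ ih₂ =>
    simp only [TM2.stepAux, pushes]
    cases f v
    · exact (ih₂ _ _).trans (by omega)
    · exact (ih₁ _ _).trans (by omega)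
  | goto f => simp [pushes]
  | halt => simp [pushes]

/-- There are finitely many labels, so the total number of push instructions in the program bounds
the growth in one step. -/
theorem length_stk_le (tm : FinTM2) (k : tm.K) : ∃ C, ∀ n (c c' : tm.Cfg),
    (flip bind tm.step)^[n] (some c) = some c' → (c'.stk k).length ≤ (c.stk k).length + n * C := by
  let _ := tm.ΛFin
  refine ⟨∑ l, pushes (tm.m l), fun n => ?_⟩
  induction n with
  | zero =>
    intro c c' h
    obtain rfl : c = c' := by simpa using h
    simp
  | succ n ih =>
    intro c c' h
    rw [Function.iterate_succ_apply'] at h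
    cases h' : (flip bind tm.step)^[n] (some c) with
    | none =>
      rw [h'] at h
      cases h
    | some d =>
      rw [h'] at h
      have h1 := ih c d h'
      obtain ⟨l, v, S⟩ := d
      cases l with
      | none => cases h
      | some l =>
        have : c' = TM2.stepAux (tm.m l) v S := (Option.some.inj h).symm
        rw [this]
        have h2 := length_stepAux_le (tm.m l) v S k
        have h3 := Finset.single_le_sum (f := fun l => pushes (tm.m l)) (fun _ _ => Nat.zero_le _)
          (Finset.mem_univ l)
        rw [Nat.succ_mul]
        simp only at h1 h3
        omega

/-- Needed for composition: the running time of a second machine is polynomial in the length of the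
intermediate result, which is limited by the number of steps that produced it. -/
theorem PolyTime.size_le {F : List ℕ → List ℕ} (h : PolyTime F) :
    PolyBdd size fun x => size (F x) := by
  obtain ⟨h⟩ := h
  obtain ⟨C, hC⟩ := length_stk_le h.tm h.tm.k₁
  refine ((PolyBdd.self.add (.mul (T := fun x => h.time.eval (size x)) (PolyBdd.self.eval _)
    (.const C)))).mono fun x => ?_
  obtain ⟨⟨n, hn⟩, hnm⟩ := h.outputsFun x
  have := hC n _ _ hn
  rw [haltList_eq, initList_eq] at this
  simp only [Function.update_self, List.length_map] at this
  refine this.trans (add_le_add ?_ (Nat.mul_le_mul_right _ hnm))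
  -- Initially the output stack is empty, unless the machine uses the same stack for input and
  -- output.
  by_cases hk : h.tm.k₁ = h.tm.k₀
  · rw [hk]; simp [size]
  · simp [hk]

/-! ### Programs compute polynomial-time functions -/

section Calls

variable {ι : Type} [DecidableEq ι] {B : ι → TM2ComputableAux Bool Bool}

theorem update_nil_inl (r : Fin 3) (x : List Bool) :
    Function.update (fun k : Stk B => ([] : List (Alph B k))) (Sum.inl r) x =
      joinStk (Function.update (fun _ => []) r x) fun _ _ => [] := by
  rw [← update_joinStk_inl]
  congr 1
  funext k
  rcases k with k | k <;> rfl

/-- The bridge from structured programs to `PolyTime`: finitely many called machines together with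
three bit stacks and the compiled labels again form a finite stack machine. -/
theorem polyTime_of_prog [Fintype ι] (c : Prog B) (out : Fin 3) (F : List ℕ → List ℕ)
    {T : List ℕ → ℕ} (hT : PolyBdd size T)
    (h : ∀ x, c.RunsIn (clean none ![tape x, [], []])
      (clean none (Function.update (fun _ => []) out (tape (F x)))) (T x)) : PolyTime F := by
  let _ := fun i => (B i).tm.ΛFin
  let _ := fun i => (B i).tm.σFin
  let _ := fun i => (B i).tm.kFin
  obtain ⟨p, hp⟩ := hT
  let tm : FinTM2 :=
    { K := Stk B
      k₀ := .inl 0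
      k₁ := .inl out
      Γ := Alph B
      Λ := c.Lab
      main := c.entry
      σ := St B
      initialState := (none, fun i => (none, (B i).tm.initialState))
      Γk₀Fin := inferInstanceAs (Fintype Bool)
      m := c.code id .halt }
  refine ⟨⟨⟨tm, Equiv.refl _, Equiv.refl _⟩, p, fun x => ?_⟩⟩
  have hx : ∃ n ≤ p.eval (tape x).length, (flip bind tm.step)^[n]
      (some (initList tm (List.map (id : Bool → Bool) (tape x)))) =
      some (haltList tm (List.map (id : Bool → Bool) (tape (F x)))) := by
    obtain ⟨n, hn, hr⟩ := h x
    refine ⟨n, hn.trans (hp x), ?_⟩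
    have := hr.compile (M := c.code id .halt) id .halt fun _ => rfl
    rw [initList_eq, haltList_eq, List.map_id, List.map_id]
    refine Eq.trans ?_ (this.trans ?_)
    · refine congrArg (fun S => (flip bind tm.step)^[n] (some ⟨some c.entry, tm.initialState, S⟩)) ?_
      refine (update_nil_inl 0 (tape x)).trans (congrArg (fun R => joinStk R _) ?_)
      funext i
      fin_cases i <;> rfl
    · exact congrArg (fun S => some (TM2.Cfg.mk none tm.initialState S)) (update_nil_inl out _).symm
  exact ⟨⟨hx.choose, hx.choose_spec.2⟩, hx.choose_spec.1⟩

theorem update_vec_zero (a b c x : List Bool) : Function.update ![a, b, c] 0 x = ![x, b, c] := by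
  funext i; fin_cases i <;> rfl

theorem update_vec_one (a b c x : List Bool) : Function.update ![a, b, c] 1 x = ![a, x, c] := by
  funext i; fin_cases i <;> rfl

theorem update_vec_two (a b c x : List Bool) : Function.update ![a, b, c] 2 x = ![a, b, x] := by
  funext i; fin_cases i <;> rfl

theorem update_nil_zero (x : List Bool) :
    Function.update (fun _ : Fin 3 => []) 0 x = ![x, [], []] := by
  funext i; fin_cases i <;> rfl

theorem update_nil_one (x : List Bool) :
    Function.update (fun _ : Fin 3 => []) 1 x = ![[], x, []] := by
  funext i; fin_cases i <;> rfl

/-- Call a machine for `F`. -/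
theorem TM2ComputableInPolyTime.exists_call {F : List ℕ → List ℕ}
    (h : TM2ComputableInPolyTime tape tape F) : ∃ T : List ℕ → ℕ, PolyBdd size T ∧
    ∀ {ι : Type} [DecidableEq ι] {B : ι → TM2ComputableAux Bool Bool} (i : ι),
      B i = h.toTM2ComputableAux → ∀ r o R x, R r = (tape x).reverse →
        (callRev i r : Prog B).RunsIn (clean o R)
          (clean none (Function.update R r (tape (F x)).reverse)) (T x) := by
  refine ⟨fun x => 2 * (size x + size (F x) + h.time.eval (size x)) + 10,
    .add (.mul (.const 2) (.add (.add .self (PolyTime.size_le ⟨h⟩)) (PolyBdd.self.eval _)))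
      (.const _), ?_⟩
  intro ι _ B i hB r o R x hR
  have : TM2OutputsInTime (B i).tm ((tape x).map (B i).inputAlphabet.invFun)
      (some ((tape (F x)).map (B i).outputAlphabet.invFun)) (h.time.eval (size x)) := by
    rw [hB]
    exact h.outputsFun x
  exact callRev_runsIn i r o R _ _ _ this hR

/-- Move the content of stack `a` to stack `b` in reverse order. -/
def moveRev (a b : Fin 3) : Prog B :=
  .seq (.prim (popThen a .halt))
    (.loop (fun v => v.1.isSome) (.prim (pushThen b (popThen a .halt))))

theorem moveRev_runsIn {a b : Fin 3} (hab : a ≠ b) (o) (R : Fin 3 → List Bool) :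
    (moveRev a b : Prog B).RunsIn (clean o R)
      (clean none (Function.update (Function.update R a []) b ((R a).reverse ++ R b)))
      (2 * (R a).length + 2) := by
  have h1 : Cmd.RunsIn (.prim (popThen a .halt) : Prog B) (clean o R)
      (clean (R a).head? (Function.update (Function.update R a (R a).tail) b (R b))) 1 := by
    refine .prim ?_
    rw [clean, effect_popThen, effect_halt, clean, show R b = Function.update R a (R a).tail b by
      simp [hab.symm], Function.update_eq_self]
  have h2 := Cmd.RunsIn.scanAll (b := fun v : St B => v.1.isSome)
    (Q := fun o u w => clean (B := B) o (Function.update (Function.update R a u) b (w ++ R b)))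
    (body := .prim (pushThen b (popThen a .halt))) (fun _ _ _ => rfl)
    (fun c u w => .prim (by
      simp only [clean]
      rw [effect_pushThen, effect_popThen, effect_halt]
      simp only [Function.update_self, Function.update_idem, Function.update_of_ne hab,
        Option.getD_some, List.cons_append]
      congr 1
      rw [Function.update_comm hab.symm, Function.update_idem])) (R a) []
  rw [List.append_nil] at h2
  exact (h1.seq h2).mono (by omega)

end Calls

/-! ### Composition, concatenation, iteration -/

section Calls

variable {ι : Type} [DecidableEq ι] {B : ι → TM2ComputableAux Bool Bool}

theorem moveRev_zero_one (o) (x y z : List Bool) :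
    (moveRev 0 1 : Prog B).RunsIn (clean o ![x, y, z]) (clean none ![[], x.reverse ++ y, z])
      (2 * x.length + 2) := by
  simpa [update_vec_zero, update_vec_one] using
    moveRev_runsIn (B := B) (a := 0) (b := 1) (by decide) o ![x, y, z]

theorem moveRev_one_zero (o) (x y z : List Bool) :
    (moveRev 1 0 : Prog B).RunsIn (clean o ![x, y, z]) (clean none ![y.reverse ++ x, [], z])
      (2 * y.length + 2) := by
  simpa [update_vec_zero, update_vec_one] using
    moveRev_runsIn (B := B) (a := 1) (b := 0) (by decide) o ![x, y, z]

theorem moveRev_two_zero (o) (x y z : List Bool) :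
    (moveRev 2 0 : Prog B).RunsIn (clean o ![x, y, z]) (clean none ![z.reverse ++ x, y, []])
      (2 * z.length + 2) := by
  simpa [update_vec_zero, update_vec_two] using
    moveRev_runsIn (B := B) (a := 2) (b := 0) (by decide) o ![x, y, z]

/-- Move the content of stack `0` to both other stacks in reverse order. -/
def dupRev : Prog B :=
  .seq (.prim (popThen 0 .halt))
    (.loop (fun v => v.1.isSome) (.prim (pushThen 1 (pushThen 2 (popThen 0 .halt)))))

theorem effect_popThen_zero (o) (x y z : List Bool) (q) :
    effect (popThen 0 q) (clean (B := B) o ![x, y, z]) =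
      effect q (clean x.head? ![x.tail, y, z]) := by
  rw [clean, effect_popThen]; simp [update_vec_zero, clean]

theorem effect_pushThen_one (o) (x y z : List Bool) (q) :
    effect (pushThen 1 q) (clean (B := B) o ![x, y, z]) =
      effect q (clean o ![x, o.getD false :: y, z]) := by
  rw [clean, effect_pushThen]; simp [update_vec_one, clean]

theorem effect_pushThen_two (o) (x y z : List Bool) (q) :
    effect (pushThen 2 q) (clean (B := B) o ![x, y, z]) =
      effect q (clean o ![x, y, o.getD false :: z]) := by
  rw [clean, effect_pushThen]; simp [update_vec_two, clean]

theorem effect_putThen_zero (b) (o) (x y z : List Bool) (q) :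
    effect (putThen 0 b q) (clean (B := B) o ![x, y, z]) =
      effect q (clean o ![b :: x, y, z]) := by
  rw [clean, effect_putThen]; simp [update_vec_zero, clean]

theorem effect_putThen_one (b) (o) (x y z : List Bool) (q) :
    effect (putThen 1 b q) (clean (B := B) o ![x, y, z]) =
      effect q (clean o ![x, b :: y, z]) := by
  rw [clean, effect_putThen]; simp [update_vec_one, clean]

theorem dupRev_runsIn (x : List Bool) :
    (dupRev : Prog B).RunsIn (clean none ![x, [], []]) (clean none ![[], x.reverse, x.reverse])
      (2 * x.length + 2) := by
  have h1 : Cmd.RunsIn (.prim (popThen 0 .halt) : Prog B) (clean none ![x, [], []])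
      (clean x.head? ![x.tail, [], []]) 1 := .prim (by rw [effect_popThen_zero, effect_halt])
  have h2 := Cmd.RunsIn.scanAll (b := fun v : St B => v.1.isSome)
    (Q := fun o u w => clean (B := B) o ![u, w, w])
    (body := .prim (pushThen 1 (pushThen 2 (popThen 0 .halt)))) (fun _ _ _ => rfl)
    (fun c u w => .prim (by
      rw [effect_pushThen_one, effect_pushThen_two, effect_popThen_zero, effect_halt]
      rfl)) x []
  rw [List.append_nil] at h2
  exact (h1.seq h2).mono (by omega)

/-- Read the top of stack `0` without removing it. -/
def look : Prog B := .prim (.peek (.inl 0) (fun v a => (a, v.2)) .halt)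

theorem look_runsIn (o) (x y z : List Bool) :
    (look : Prog B).RunsIn (clean o ![x, y, z]) (clean x.head? ![x, y, z]) 1 :=
  .prim rfl

/-- Forget the last bit read. -/
def forget : Prog B := .prim (.load (fun v => (none, v.2)) .halt)

theorem forget_runsIn (o) (R) :
    (forget : Prog B).RunsIn (clean o R) (clean none R) 1 :=
  .prim rfl

end Calls

theorem tape_append (a b : List ℕ) : tape (a ++ b) = tape a ++ tape b := by simp [tape]

theorem tape_cons (a : ℕ) (l : List ℕ) : tape (a :: l) = List.replicate a true ++ false :: tape l := by
  simp [tape]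

theorem size_append (a b : List ℕ) : size (a ++ b) = size a + size b := by
  simp [size, tape_append]

theorem size_cons (a : ℕ) (l : List ℕ) : size (a :: l) = a + 1 + size l := by
  simp [size, tape_cons]; omega

theorem size_nil : size [] = 0 := rfl

theorem head?_tape (l : List ℕ) : (tape l).head? = l.head?.map fun a => decide (a ≠ 0) := by
  cases l with
  | nil => rfl
  | cons a l => cases a <;> simp [tape_cons, List.replicate_succ]

namespace PolyTime

theorem comp {F G : List ℕ → List ℕ} (hG : PolyTime G) (hF : PolyTime F) :
    PolyTime fun x => G (F x) := by
  have hs := hF.size_le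
  have hsG := hG.size_le
  obtain ⟨hF⟩ := hF
  obtain ⟨hG⟩ := hG
  obtain ⟨T, hT, hT'⟩ := TM2ComputableInPolyTime.exists_call hF
  obtain ⟨U, hU, hU'⟩ := TM2ComputableInPolyTime.exists_call hG
  let B : Bool → TM2ComputableAux Bool Bool := fun b =>
    bif b then hG.toTM2ComputableAux else hF.toTM2ComputableAux
  refine polyTime_of_prog (B := B) (.seq (moveRev 0 1) (.seq (callRev false 1)
    (.seq (callRev true 1) (moveRev 1 0)))) 0 _
    (T := fun x => (2 * size x + 2) + (T x + (U (F x) + (2 * size (G (F x)) + 2)))) ?_ fun x => ?_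
  · exact .add (.add (.mul (.const _) .self) (.const _)) (.add hT (.add (.comp hU hs)
      (.add (.mul (.const _) (.comp hsG hs)) (.const _))))
  · have h1 := moveRev_zero_one (B := B) none (tape x) [] []
    have h2 := hT' (B := B) false rfl 1 none ![[], (tape x).reverse ++ [], []] x (by simp)
    have h3 := hU' (B := B) true rfl 1 none ![[], (tape (F x)).reverse, []] (F x) (by simp)
    have h4 := moveRev_one_zero (B := B) none [] (tape (G (F x))).reverse []
    rw [update_vec_one] at h2 h3
    rw [update_nil_zero]
    simp only [List.reverse_reverse, List.append_nil, List.length_reverse] at h4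
    exact h1.seq (h2.seq (h3.seq h4))

theorem append {F G : List ℕ → List ℕ} (hF : PolyTime F) (hG : PolyTime G) :
    PolyTime fun x => F x ++ G x := by
  have hs := hF.size_le
  have hsG := hG.size_le
  obtain ⟨hF⟩ := hF
  obtain ⟨hG⟩ := hG
  obtain ⟨T, hT, hT'⟩ := TM2ComputableInPolyTime.exists_call hF
  obtain ⟨U, hU, hU'⟩ := TM2ComputableInPolyTime.exists_call hG
  let B : Bool → TM2ComputableAux Bool Bool := fun b =>
    bif b then hG.toTM2ComputableAux else hF.toTM2ComputableAux
  refine polyTime_of_prog (B := B) (.seq dupRev (.seq (callRev false 1)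
    (.seq (callRev true 2) (.seq (moveRev 2 0) (moveRev 1 0))))) 0 _
    (T := fun x => (2 * size x + 2) + (T x + (U x + ((2 * size (G x) + 2) +
      (2 * size (F x) + 2))))) ?_ fun x => ?_
  · exact .add (.add (.mul (.const _) .self) (.const _)) (.add hT (.add hU
      (.add (.add (.mul (.const _) hsG) (.const _)) (.add (.mul (.const _) hs) (.const _)))))
  · have h1 := dupRev_runsIn (B := B) (tape x)
    have h2 := hT' (B := B) false rfl 1 none ![[], (tape x).reverse, (tape x).reverse] x (by simp)
    have h3 := hU' (B := B) true rfl 2 none ![[], (tape (F x)).reverse, (tape x).reverse] x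
      (by simp)
    have h4 := moveRev_two_zero (B := B) none [] (tape (F x)).reverse (tape (G x)).reverse
    have h5 := moveRev_one_zero (B := B) none (tape (G x)) (tape (F x)).reverse []
    rw [update_vec_one] at h2
    rw [update_vec_two] at h3
    rw [update_nil_zero, tape_append]
    simp only [List.reverse_reverse, List.append_nil, List.length_reverse] at h4 h5
    exact h1.seq (h2.seq (h3.seq (h4.seq h5)))

/-- Iterate `F` on `I x` as long as the first entry is positive. -/
theorem whilePos {F I : List ℕ → List ℕ} (hF : PolyTime F) (hI : PolyTime I) (n S : List ℕ → ℕ)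
    (hn : PolyBdd size n) (hS : PolyBdd size S)
    (hpos : ∀ x, ∀ i < n x, (F^[i] (I x)).headD 0 ≠ 0) (hend : ∀ x, (F^[n x] (I x)).headD 0 = 0)
    (hsize : ∀ x, ∀ i ≤ n x, size (F^[i] (I x)) ≤ S x) :
    PolyTime fun x => F^[n x] (I x) := by
  have hsI := hI.size_le
  obtain ⟨hF⟩ := hF
  obtain ⟨hI⟩ := hI
  obtain ⟨T, ⟨p, hp⟩, hT'⟩ := TM2ComputableInPolyTime.exists_call hF
  obtain ⟨U, hU, hU'⟩ := TM2ComputableInPolyTime.exists_call hI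
  let B : Bool → TM2ComputableAux Bool Bool := fun b =>
    bif b then hI.toTM2ComputableAux else hF.toTM2ComputableAux
  let body : Prog B := .seq (moveRev 0 1) (.seq (callRev false 1) (.seq (moveRev 1 0) look))
  let cost : List ℕ → ℕ := fun x => 2 * S x + 2 + (p.eval (S x) + (2 * S x + 2 + 1)) + 1
  have hbody : ∀ x y, size y ≤ S x → size (F y) ≤ S x → ∀ o,
      body.RunsIn (clean o ![tape y, [], []]) (clean (tape (F y)).head? ![tape (F y), [], []])
        (2 * S x + 2 + (p.eval (S x) + (2 * S x + 2 + 1))) := by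
    intro x y hy hy' o
    have h1 := moveRev_zero_one (B := B) o (tape y) [] []
    have h2 := hT' (B := B) false rfl 1 none ![[], (tape y).reverse ++ [], []] y (by simp)
    have h3 := moveRev_one_zero (B := B) none [] (tape (F y)).reverse []
    rw [update_vec_one] at h2
    simp only [List.reverse_reverse, List.append_nil, List.length_reverse] at h1 h2 h3
    refine (h1.seq (h2.seq (h3.seq (look_runsIn _ _ _ _)))).mono ?_
    have h4 := (hp y).trans (polynomial_eval_mono p hy)
    change (tape y).length ≤ _ at hy
    change (tape (F y)).length ≤ _ at hy'
    omega
  -- Entries are in unary, so the first tape bit already tells whether the first entry is positive.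
  have hcond : ∀ l : List ℕ, decide ((tape l).head? = some true) = decide (l.headD 0 ≠ 0) := by
    intro l
    rw [head?_tape]
    cases l <;> simp
  -- Induction on the number `k` of rounds still to come, since the loop rules peel off the first
  -- round.
  have hloop : ∀ x, ∀ k ≤ n x,
      (Cmd.loop (fun v : St B => decide (v.1 = some true)) body).RunsIn
        (clean (tape (F^[n x - k] (I x))).head? ![tape (F^[n x - k] (I x)), [], []])
        (clean (tape (F^[n x] (I x))).head? ![tape (F^[n x] (I x)), [], []])
        (k * cost x + 1) := by
    intro x k
    induction k with
    | zero =>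
      intro _
      rw [Nat.zero_mul]
      refine .loop_done ?_
      change decide ((tape _).head? = some true) = false
      rw [hcond]
      simp only [Nat.sub_zero, hend x, ne_eq, not_true_eq_false, decide_false]
    | succ k ih =>
      intro hk
      have e : n x - k = n x - (k + 1) + 1 := by omega
      have h1 := ih (by omega)
      have h2 := hsize x (n x - k) (by omega)
      rw [e, Function.iterate_succ_apply'] at h1 h2
      refine (RunsIn_step ?_ (hbody x _ (hsize x _ (by omega)) h2 _) h1).mono ?_
      · change decide ((tape _).head? = some true) = true
        rw [hcond]
        exact decide_eq_true (hpos x _ (by omega))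
      · have : (k + 1) * cost x = k * cost x + cost x := by ring
        rw [this]
        simp only [cost]
        omega
  refine polyTime_of_prog (B := B) (.seq (moveRev 0 1) (.seq (callRev true 1) (.seq (moveRev 1 0)
    (.seq look (.seq (.loop (fun v : St B => decide (v.1 = some true)) body) forget))))) 0 _
    (T := fun x => (2 * size x + 2) + (U x + ((2 * size (I x) + 2) +
      (1 + ((n x * cost x + 1) + 1))))) ?_ fun x => ?_
  · have h2S : PolyBdd size fun x => 2 * S x + 2 := .add (.mul (.const _) hS) (.const _)
    exact .add (.add (.mul (.const _) .self) (.const _)) (.add hU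
      (.add (.add (.mul (.const _) hsI) (.const _)) (.add (.const _) (.add (.add (.mul hn
        (.add (.add h2S (.add (.eval hS p) (.add h2S (.const _)))) (.const _)))
        (.const _)) (.const _)))))
  · have h1 := moveRev_zero_one (B := B) none (tape x) [] []
    have h2 := hU' (B := B) true rfl 1 none ![[], (tape x).reverse ++ [], []] x (by simp)
    have h3 := moveRev_one_zero (B := B) none [] (tape (I x)).reverse []
    rw [update_vec_one] at h2
    rw [update_nil_zero]
    have h4 := hloop x (n x) le_rfl
    simp only [Nat.sub_self, Function.iterate_zero, id_eq] at h4
    simp only [List.reverse_reverse, List.append_nil, List.length_reverse] at h3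
    exact h1.seq (h2.seq (h3.seq ((look_runsIn _ _ _ _).seq (h4.seq (forget_runsIn _ _)))))
where
  RunsIn_step {B : Bool → TM2ComputableAux Bool Bool} {b : St B → Bool} {c : Prog B}
      {s s' s'' n m} (hb : b s.1 = true) (h₁ : c.RunsIn s s' n)
      (h₂ : (Cmd.loop b c).RunsIn s' s'' m) : (Cmd.loop b c).RunsIn s s'' (n + 1 + m) :=
    .loop_step hb h₁ h₂

/-! ### Elementary functions -/

theorem of_prim (c : Prog fun i : Empty => i.elim) (out : Fin 3) (F : List ℕ → List ℕ)
    (k : ℕ) (h : ∀ x, c.RunsIn (clean none ![tape x, [], []])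
      (clean none (Function.update (fun _ => []) out (tape (F x)))) (k * size x + k)) :
    PolyTime F :=
  polyTime_of_prog c out F (.add (.mul (.const k) .self) (.const k)) h

theorem id : PolyTime fun x => x :=
  of_prim forget 0 _ 1 fun x => by
    rw [update_nil_zero]
    exact (forget_runsIn _ _).mono (by omega)

theorem cons_zero : PolyTime fun x => 0 :: x :=
  of_prim (.prim (putThen 0 false .halt)) 0 _ 1 fun x => by
    rw [update_nil_zero]
    exact (Cmd.RunsIn.prim (by rw [effect_putThen_zero, effect_halt]; simp [tape_cons])).mono
      (by omega)

/-- Increment the first entry. -/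
def succHead : List ℕ → List ℕ
  | [] => []
  | n :: l => (n + 1) :: l

/-- Decrement the first entry. -/
def predHead : List ℕ → List ℕ
  | [] => []
  | n :: l => (n - 1) :: l

theorem succHead_polyTime : PolyTime succHead :=
  of_prim (.seq look (.seq (.ite (fun v => v.1.isSome) (.prim (putThen 0 true .halt)) forget)
    forget)) 0 _ 4 fun x => by
    rw [update_nil_zero]
    cases x with
    | nil =>
      exact ((look_runsIn _ _ _ _).seq (Cmd.RunsIn.seq (.ite_false rfl (forget_runsIn _ _))
        (forget_runsIn _ _))).mono (by omega)
    | cons n l =>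
      refine ((look_runsIn _ _ _ _).seq (Cmd.RunsIn.seq (.ite_true ?_ (.prim ?_))
        (forget_runsIn (tape (n :: l)).head? _))).mono (by omega)
      · change (tape (n :: l)).head?.isSome = true
        simp [head?_tape]
      · rw [effect_putThen_zero, effect_halt]
        simp only [succHead, tape_cons, List.replicate_succ, List.cons_append]

theorem predHead_polyTime : PolyTime predHead :=
  of_prim (.seq (.prim (popThen 0 .halt)) (.seq (.ite (fun v => decide (v.1 = some false))
    (.prim (putThen 0 false .halt)) forget) forget)) 0 _ 4 fun x => by
    rw [update_nil_zero]
    have h1 : Cmd.RunsIn (.prim (popThen 0 .halt)) (clean none ![tape x, [], []])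
      (clean (B := fun i : Empty => i.elim) (tape x).head? ![(tape x).tail, [], []]) 1 :=
      .prim (by rw [effect_popThen_zero, effect_halt])
    rcases x with _ | ⟨_ | n, l⟩
    · exact (h1.seq (Cmd.RunsIn.seq (.ite_false rfl (forget_runsIn _ _))
        (forget_runsIn _ _))).mono (by omega)
    · exact (h1.seq (Cmd.RunsIn.seq (.ite_true rfl (.prim (by
        rw [effect_putThen_zero, effect_halt]
        rfl))) (forget_runsIn (tape (0 :: l)).head? _))).mono (by omega)
    · exact (h1.seq (Cmd.RunsIn.seq (.ite_false rfl (forget_runsIn _ _))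
        (forget_runsIn _ _))).mono (by omega)

theorem head_polyTime : PolyTime fun x => [x.headD 0] :=
  of_prim (.seq (.prim (putThen 1 false (popThen 0 .halt)))
    (.seq (.loop (fun v => decide (v.1 = some true)) (.prim (pushThen 1 (popThen 0 .halt))))
    (.seq (.loop (fun v => v.1.isSome) (.prim (popThen 0 .halt))) forget))) 1 _ 8 fun x => by
    have h1 : Cmd.RunsIn (.prim (putThen 1 false (popThen 0 .halt)))
        (clean none ![tape x, [], []])
        (clean (B := fun i : Empty => i.elim) (tape x).head? ![(tape x).tail, [false], []]) 1 :=
      .prim (by rw [effect_putThen_one, effect_popThen_zero, effect_halt])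
    obtain ⟨u, v, hx, hu, hv, hF⟩ : ∃ u v, tape x = List.replicate u true ++ v ∧
        (decide (v.head? = some true) = false) ∧ u + v.length ≤ size x ∧
        tape [x.headD 0] = List.replicate u true ++ [false] := by
      cases x with
      | nil => exact ⟨0, [], rfl, rfl, by simp [size], rfl⟩
      | cons n l =>
        exact ⟨n, false :: tape l, tape_cons _ _, rfl, by
          simp [size, tape_cons], by simp [tape]⟩
    have h2 := Cmd.RunsIn.scan (b := fun v : St (fun i : Empty => i.elim) =>
        decide (v.1 = some true))
      (Q := fun o u w => clean (B := fun i : Empty => i.elim) o ![u, w ++ [false], []])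
      (body := .prim (pushThen 1 (popThen 0 .halt))) (fun o => decide (o = some true))
      (fun _ _ _ => rfl) (fun c u w => .prim (by
        rw [effect_pushThen_one, effect_popThen_zero, effect_halt]; rfl))
      (List.replicate u true) v [] (by simp) hu
    have h3 := Cmd.RunsIn.scanAll (b := fun v : St (fun i : Empty => i.elim) => v.1.isSome)
      (Q := fun o z _ => clean (B := fun i : Empty => i.elim) o
        ![z, List.replicate u true ++ [false], []])
      (body := .prim (popThen 0 .halt)) (fun _ _ _ => rfl) (fun c u w => .prim (by
        rw [effect_popThen_zero, effect_halt])) v []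
    rw [hx] at h1
    simp only [List.reverse_replicate, List.append_nil, List.nil_append] at h2 h3
    rw [update_nil_one, hF, hx]
    refine (h1.seq (h2.seq (h3.seq (forget_runsIn _ _)))).mono ?_
    simp only [List.length_replicate]
    omega

theorem tail_polyTime : PolyTime fun x => x.tail :=
  of_prim (.seq (.prim (popThen 0 .halt))
    (.seq (.loop (fun v => decide (v.1 = some true)) (.prim (popThen 0 .halt))) forget)) 0 _ 8
    fun x => by
    have h1 : Cmd.RunsIn (.prim (popThen 0 .halt))
        (clean none ![tape x, [], []])
        (clean (B := fun i : Empty => i.elim) (tape x).head? ![(tape x).tail, [], []]) 1 :=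
      .prim (by rw [effect_popThen_zero, effect_halt])
    obtain ⟨u, v, hx, hu, hv, hF⟩ : ∃ u v, tape x = List.replicate u true ++ v ∧
        (decide (v.head? = some true) = false) ∧ u + v.length ≤ size x ∧
        tape x.tail = v.tail := by
      cases x with
      | nil => exact ⟨0, [], rfl, rfl, by simp [size], rfl⟩
      | cons n l =>
        exact ⟨n, false :: tape l, tape_cons _ _, rfl, by
          simp [size, tape_cons], by simp⟩
    have h2 := Cmd.RunsIn.scan (b := fun v : St (fun i : Empty => i.elim) =>
        decide (v.1 = some true))
      (Q := fun o u _ => clean (B := fun i : Empty => i.elim) o ![u, [], []])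
      (body := .prim (popThen 0 .halt)) (fun o => decide (o = some true))
      (fun _ _ _ => rfl) (fun c u w => .prim (by
        rw [effect_popThen_zero, effect_halt]))
      (List.replicate u true) v [] (by simp) hu
    rw [hx] at h1
    rw [update_nil_zero, hF, hx]
    refine (h1.seq (h2.seq (forget_runsIn _ _))).mono ?_
    simp only [List.length_replicate]
    omega

theorem length_polyTime : PolyTime fun x => [x.length] :=
  of_prim (.seq (.prim (putThen 1 false (popThen 0 .halt)))
    (.seq (.loop (fun v => v.1.isSome) (.prim (.branch (fun v => v.1.getD false)
      (popThen 0 .halt) (putThen 1 true (popThen 0 .halt))))) forget)) 1 _ 8 fun x => by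
    have h1 : Cmd.RunsIn (.prim (putThen 1 false (popThen 0 .halt)))
        (clean none ![tape x, [], []])
        (clean (B := fun i : Empty => i.elim) (tape x).head? ![(tape x).tail, [false], []]) 1 :=
      .prim (by rw [effect_putThen_one, effect_popThen_zero, effect_halt])
    have h2 := Cmd.RunsIn.scanAll (b := fun v : St (fun i : Empty => i.elim) => v.1.isSome)
      (Q := fun o u w => clean (B := fun i : Empty => i.elim) o
        ![u, List.replicate (w.count false) true ++ [false], []])
      (body := .prim (.branch (fun v => v.1.getD false)
      (popThen 0 .halt) (putThen 1 true (popThen 0 .halt)))) (fun _ _ _ => rfl)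
      (fun c u w => .prim (by
        cases c
        · refine (effect_putThen_one true (some false) u
            (List.replicate (w.count false) true ++ [false]) [] (popThen 0 .halt)).trans ?_
          rw [effect_popThen_zero, effect_halt]
          simp [List.replicate_succ]
        · refine (effect_popThen_zero (some true) u
            (List.replicate (w.count false) true ++ [false]) [] .halt).trans ?_
          rw [effect_halt]
          simp)) (tape x) []
    have hc : ∀ l : List ℕ, (tape l).count false = l.length := by
      intro l
      induction l with
      | nil => rfl
      | cons a l ih => simp [tape_cons, ih, List.count_replicate]
    rw [update_nil_one]
    simp only [List.append_nil, List.count_reverse, hc] at h2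
    have hF : tape [x.length] = List.replicate x.length true ++ [false] := by simp [tape]
    rw [hF]
    refine (h1.seq (h2.seq (forget_runsIn _ _))).mono ?_
    simp only [size]
    omega

end PolyTime

/-! ### Control structures, list operations and unary arithmetic -/

namespace PolyTime

theorem const (c : List ℕ) : PolyTime fun _ => c := by
  induction c with
  | nil => exact tail_polyTime.comp head_polyTime
  | cons n l ih =>
    induction n with
    | zero => exact cons_zero.comp ih
    | succ n ihn => exact succHead_polyTime.comp ihn

theorem congr {F G : List ℕ → List ℕ} (hF : PolyTime F) (h : ∀ x, F x = G x) : PolyTime G :=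
  (funext h : F = G) ▸ hF

theorem nat_le {N : List ℕ → ℕ} (hN : PolyTime fun x => [N x]) : PolyBdd size N :=
  hN.size_le.mono fun x => by simp [size, tape]

/-- Iterate `F` on `I x` for `N x` rounds. -/
theorem iterate {N : List ℕ → ℕ} {I F : List ℕ → List ℕ} (hN : PolyTime fun x => [N x])
    (hI : PolyTime I) (hF : PolyTime F) {S : List ℕ → ℕ} (hS : PolyBdd size S)
    (hsize : ∀ x, ∀ i ≤ N x, size (F^[i] (I x)) ≤ S x) :
    PolyTime fun x => F^[N x] (I x) := by
  -- A counter in front of the state is decremented in every round and serves as the loop condition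
  -- of `whilePos`.
  let G : List ℕ → List ℕ := fun s => predHead [s.headD 0] ++ F s.tail
  have hG : PolyTime G := (predHead_polyTime.comp head_polyTime).append (hF.comp tail_polyTime)
  have hiter : ∀ x i, G^[i] ([N x] ++ I x) = (N x - i) :: F^[i] (I x) := by
    intro x i
    induction i with
    | zero => rfl
    | succ i ih =>
      rw [Function.iterate_succ_apply', ih, Function.iterate_succ_apply']
      simp [G, predHead, Nat.sub_sub]
  have h := whilePos hG (hN.append hI) N (fun x => N x + 1 + S x) hN.nat_le
    (.add (.add hN.nat_le (.const 1)) hS)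
    (fun x i hi => by rw [hiter]; simp; omega) (fun x => by rw [hiter]; simp)
    (fun x i hi => by
      rw [hiter, size_cons]
      have := hsize x i hi
      omega)
  have h' := tail_polyTime.comp h
  simpa only [hiter, List.tail_cons] using h'

/-- A branch is made of two while loops with at most one round each. The first runs `F` if the test
is nonzero and leaves a flag saying whether it was skipped; the second runs `G` if the flag is set.
-/
theorem cond {N F G : List ℕ → List ℕ} (hN : PolyTime N) (hF : PolyTime F) (hG : PolyTime G) :
    PolyTime fun x => if (N x).headD 0 = 0 then G x else F x := by
  let F₁ : List ℕ → List ℕ := fun s => [0] ++ ([0] ++ F s.tail.tail)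
  have hF₁ : PolyTime F₁ := (const [0]).append ((const [0]).append
    (hF.comp (tail_polyTime.comp tail_polyTime)))
  let I₁ : List ℕ → List ℕ := fun x => [(N x).headD 0] ++ ([1] ++ x)
  have hI₁ : PolyTime I₁ := (head_polyTime.comp hN).append ((const [1]).append id)
  let n : List ℕ → ℕ := fun x => if (N x).headD 0 = 0 then 0 else 1
  let P : List ℕ → List ℕ := fun x => if (N x).headD 0 = 0 then 1 :: x else 0 :: F x
  have hP : PolyTime P := by
    have h := whilePos hF₁ hI₁ n (fun x => size (F₁ (I₁ x)) + size (I₁ x))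
      ((PolyBdd.const 1).mono fun x => by simp only [n]; split <;> omega)
      (.add (hF₁.comp hI₁).size_le hI₁.size_le)
      (fun x i hi => by
        by_cases h : (N x).headD 0 = 0
        · simp only [n, h, if_true] at hi; omega
        · simp only [n, h, if_false] at hi
          obtain rfl : i = 0 := by omega
          simpa [I₁] using h)
      (fun x => by
        by_cases h : (N x).headD 0 = 0
        · simp only [n, h, if_true]; simpa [I₁] using h
        · simp only [n, h, if_false]; simp [F₁])
      (fun x i hi => by
        have : i ≤ 1 := hi.trans (by simp only [n]; split <;> omega)
        interval_cases i
        · exact Nat.le_add_left _ _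
        · exact Nat.le_add_right _ _)
    have h' := tail_polyTime.comp h
    refine h'.congr fun x => ?_
    by_cases h : (N x).headD 0 = 0
    · simp only [n, P, h, if_true]; simp [I₁]
    · simp only [n, P, h, if_false]; simp [F₁, I₁]
  let F₂ : List ℕ → List ℕ := fun s => [0] ++ G s.tail
  have hF₂ : PolyTime F₂ := (const [0]).append (hG.comp tail_polyTime)
  let n' : List ℕ → ℕ := fun x => if (N x).headD 0 = 0 then 1 else 0
  have h := whilePos hF₂ hP n' (fun x => size (F₂ (P x)) + size (P x))
    ((PolyBdd.const 1).mono fun x => by simp only [n']; split <;> omega)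
    (.add (hF₂.comp hP).size_le hP.size_le)
    (fun x i hi => by
      by_cases h : (N x).headD 0 = 0
      · simp only [n', h, if_true] at hi
        obtain rfl : i = 0 := by omega
        simp only [P, h, if_true]
        simp
      · simp only [n', h, if_false] at hi; omega)
    (fun x => by
      by_cases h : (N x).headD 0 = 0
      · simp only [n', h, if_true]; simp [F₂]
      · simp only [n', P, h, if_false]; simp)
    (fun x i hi => by
      have : i ≤ 1 := hi.trans (by simp only [n']; split <;> omega)
      interval_cases i
      · exact Nat.le_add_left _ _
      · exact Nat.le_add_right _ _)
  have h' := tail_polyTime.comp h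
  refine h'.congr fun x => ?_
  by_cases h : (N x).headD 0 = 0
  · simp only [n', P, h, if_true]; simp [F₂]
  · simp only [n', P, h, if_false]; simp

theorem size_tail_le (l : List ℕ) : size l.tail ≤ size l := by
  cases l
  · simp
  · simp [size_cons]

theorem drop {N : List ℕ → ℕ} {L : List ℕ → List ℕ} (hN : PolyTime fun x => [N x])
    (hL : PolyTime L) : PolyTime fun x => (L x).drop (N x) := by
  have hiter : ∀ (l : List ℕ) i, List.tail^[i] l = l.drop i := by
    intro l i
    induction i with
    | zero => rfl
    | succ i ih => rw [Function.iterate_succ_apply', ih, List.tail_drop]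
  have := iterate hN hL tail_polyTime hL.size_le fun x i _ => by
    induction i with
    | zero => exact le_rfl
    | succ i ih => rw [Function.iterate_succ_apply']; exact (size_tail_le _).trans (ih (by omega))
  simpa only [hiter] using this

theorem sub {M N : List ℕ → ℕ} (hM : PolyTime fun x => [M x]) (hN : PolyTime fun x => [N x]) :
    PolyTime fun x => [M x - N x] := by
  have hiter : ∀ m i, predHead^[i] [m] = [m - i] := by
    intro m i
    induction i with
    | zero => rfl
    | succ i ih => rw [Function.iterate_succ_apply', ih]; simp [predHead, Nat.sub_sub]
  have := iterate hN hM predHead_polyTime hM.size_le fun x i _ => by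
    rw [hiter]; simp [size_cons]
  simpa only [hiter] using this

/-- Move the first entry to the end. -/
def rot (l : List ℕ) : List ℕ := l.tail ++ [l.headD 0]

theorem rot_iterate (l m : List ℕ) : rot^[l.length] (l ++ m) = m ++ l := by
  induction l generalizing m with
  | nil => simp
  | cons a l ih =>
    rw [List.length_cons, Function.iterate_succ_apply]
    have : rot (a :: l ++ m) = l ++ (m ++ [a]) := by simp [rot]
    rw [this, ih]
    simp

/-- The first `N` entries are rotated to the end and everything before them is dropped. The result
is kept in this form because it is a genuine prefix only when `N` is at most the length
(`rot_iterate_drop`). -/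
theorem take {N : List ℕ → ℕ} {L : List ℕ → List ℕ} (hN : PolyTime fun x => [N x])
    (hL : PolyTime L) :
    PolyTime fun x => (rot^[N x] (L x)).drop ((L x).length - N x) := by
  refine drop (sub (length_polyTime.comp hL) hN) (iterate hN hL
    (F := rot) (tail_polyTime.append head_polyTime) (S := fun x => size (L x) + 1)
    (.add hL.size_le (.const 1)) fun x i _ => ?_)
  have key : ∀ l : List ℕ, l ≠ [] → size (rot l) = size l ∧ rot l ≠ [] := by
    intro l hl
    cases l with
    | nil => exact absurd rfl hl
    | cons a l =>
      refine ⟨?_, by simp [rot]⟩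
      simp only [rot, List.tail_cons, List.headD_cons, size_append, size_cons, size_nil]
      omega
  have key' : ∀ (l : List ℕ) i, l ≠ [] → size (rot^[i] l) = size l ∧ rot^[i] l ≠ [] := by
    intro l i hl
    induction i with
    | zero => exact ⟨rfl, hl⟩
    | succ i ih =>
      rw [Function.iterate_succ_apply']
      exact ⟨(key _ ih.2).1.trans ih.1, (key _ ih.2).2⟩
  -- Rotation keeps the size, except that it turns the empty list into `[0]`; this is the `+ 1` in
  -- the size bound.
  by_cases hx : L x = []
  · rw [hx]
    cases i with
    | zero => simp
    | succ i =>
      rw [Function.iterate_succ_apply]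
      have : rot [] = [0] := rfl
      rw [this, (key' [0] i (by simp)).1]
      simp [size_cons, size_nil]
  · exact ((key' _ i hx).1.le).trans (Nat.le_succ _)

theorem rot_iterate_drop (l : List ℕ) {n : ℕ} (h : n ≤ l.length) :
    (rot^[n] l).drop (l.length - n) = l.take n := by
  have := rot_iterate (l.take n) (l.drop n)
  rw [List.take_append_drop, List.length_take, min_eq_left h] at this
  rw [this, List.drop_left' (by simp)]

theorem add {M N : List ℕ → ℕ} (hM : PolyTime fun x => [M x]) (hN : PolyTime fun x => [N x]) :
    PolyTime fun x => [M x + N x] := by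
  have hiter : ∀ m i, succHead^[i] [m] = [m + i] := by
    intro m i
    induction i with
    | zero => rfl
    | succ i ih => rw [Function.iterate_succ_apply', ih]; rfl
  have := iterate hN hM succHead_polyTime (S := fun x => M x + N x + 1)
    (.add (.add hM.nat_le hN.nat_le) (.const 1)) fun x i hi => by
      rw [hiter]; simp [size_cons, size_nil]; omega
  simpa only [hiter] using this

theorem mul {M N : List ℕ → ℕ} (hM : PolyTime fun x => [M x]) (hN : PolyTime fun x => [N x]) :
    PolyTime fun x => [M x * N x] := by
  let F : List ℕ → List ℕ := fun s => [s.headD 0 + s.tail.headD 0] ++ [s.tail.headD 0]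
  have hF : PolyTime F := (add head_polyTime (head_polyTime.comp tail_polyTime)).append
    (head_polyTime.comp tail_polyTime)
  have hiter : ∀ m i, F^[i] ([0] ++ [m]) = [i * m, m] := by
    intro m i
    induction i with
    | zero => simp
    | succ i ih => rw [Function.iterate_succ_apply', ih]; simp [F]; ring
  have := head_polyTime.comp (iterate hM ((const [0]).append hN) hF
    (S := fun x => M x * N x + N x + 2)
    (.add (.add (hM.nat_le.mul hN.nat_le) hN.nat_le) (.const 2)) fun x i hi => by
      rw [hiter]
      have := Nat.mul_le_mul_right (N x) hi
      simp only [size_cons, size_nil]; omega)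
  simpa only [hiter, List.headD_cons] using this

theorem polynomial_eval {N : List ℕ → ℕ} (hN : PolyTime fun x => [N x]) (p : Polynomial ℕ) :
    PolyTime fun x => [p.eval (N x)] := by
  have hpow : ∀ n, PolyTime fun x => [N x ^ n] := by
    intro n
    induction n with
    | zero => simpa using const [1]
    | succ n ih => simpa only [pow_succ] using mul ih hN
  induction p using Polynomial.induction_on' with
  | add p q hp hq => simpa only [Polynomial.eval_add] using add hp hq
  | monomial n c => simpa only [Polynomial.eval_monomial] using mul (const [c]) (hpow n)

theorem size : PolyTime fun x => [size x] := by
  let F : List ℕ → List ℕ := fun s => [s.headD 0 + (s.tail.headD 0 + 1)] ++ s.tail.tail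
  have hF : PolyTime F := (add head_polyTime (add (head_polyTime.comp tail_polyTime)
    (const [1]))).append (tail_polyTime.comp tail_polyTime)
  have hiter : ∀ x i, i ≤ x.length → F^[i] ([0] ++ x) =
      RobustPPH.size (x.take i) :: x.drop i := by
    intro x i
    induction i with
    | zero => intro _; simp [size_nil]
    | succ i ih =>
      intro hi
      rw [Function.iterate_succ_apply', ih (by omega), List.drop_eq_getElem_cons (by omega),
        ← List.take_concat_get' x i (by omega), size_append]
      simp [F, size_cons, size_nil, List.getElem?_eq_getElem (show i < x.length by omega)]
  have := head_polyTime.comp (iterate length_polyTime ((const [0]).append id) hF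
    (S := fun x => RobustPPH.size x + 1) (PolyBdd.self.add (.const 1)) fun x i hi => by
      rw [hiter x i hi, size_cons]
      have := congrArg RobustPPH.size (List.take_append_drop i x)
      rw [size_append] at this
      omega)
  refine this.congr fun x => ?_
  rw [hiter x _ le_rfl]
  simp

end PolyTime

/-! ### Polynomial-time functions between coded types -/

/-- Types with a serialisation. -/
class Enc (α : Type) where
  enc : α → List ℕ

/-- Lists of natural numbers that stand for themselves. -/
structure Raw where
  list : List ℕ

instance : Enc Raw := ⟨Raw.list⟩
instance : Enc ℕ := ⟨fun n => [n]⟩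
instance : Enc Bool := ⟨fun b => [b.toNat]⟩
instance {α β : Type} [Enc α] [Enc β] : Enc (α × β) := ⟨fun p => pack [Enc.enc p.1, Enc.enc p.2]⟩
instance {α : Type} [Enc α] : Enc (List α) := ⟨fun l => pack (l.map Enc.enc)⟩

theorem enc_nat (n : ℕ) : Enc.enc n = [n] := rfl
theorem enc_bool (b : Bool) : Enc.enc b = [b.toNat] := rfl
theorem enc_raw (l : Raw) : Enc.enc l = l.list := rfl
theorem enc_pair {α β : Type} [Enc α] [Enc β] (p : α × β) : Enc.enc p =
    [(Enc.enc p.1).length] ++ (Enc.enc p.1 ++ ([(Enc.enc p.2).length] ++ Enc.enc p.2)) := by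
  change pack _ = _
  simp [pack]
theorem enc_cons {α : Type} [Enc α] (a : α) (l : List α) :
    Enc.enc (a :: l) = [(Enc.enc a).length] ++ (Enc.enc a ++ Enc.enc l) := by
  change pack _ = _
  simp [pack]
  rfl
theorem enc_append {α : Type} [Enc α] (l l' : List α) :
    Enc.enc (l ++ l') = Enc.enc l ++ Enc.enc l' := by
  change pack _ = pack _ ++ pack _
  simp [pack]

/-- The input length. -/
def bits {α : Type} [Enc α] (a : α) : ℕ := size (Enc.enc a)

/-- Polynomial-time functions. -/
@[fun_prop]
def Poly {α β : Type} [Enc α] [Enc β] (f : α → β) : Prop :=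
  ∃ F, PolyTime F ∧ ∀ a, F (Enc.enc a) = Enc.enc (f a)

section

variable {α β γ δ : Type} [Enc α] [Enc β] [Enc γ] [Enc δ]

namespace Poly

theorem bits_le {f : α → β} (hf : Poly f) : PolyBdd bits fun a => bits (f a) := by
  obtain ⟨F, hF, h⟩ := hf
  obtain ⟨p, hp⟩ := hF.size_le
  exact ⟨p, fun a => by simpa only [bits, ← h] using hp _⟩

@[fun_prop]
theorem id : Poly fun a : α => a := ⟨_, PolyTime.id, fun _ => rfl⟩

@[fun_prop]
theorem const (b : β) : Poly fun _ : α => b := ⟨_, PolyTime.const (Enc.enc b), fun _ => rfl⟩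

@[fun_prop]
theorem comp {g : β → γ} {f : α → β} (hg : Poly g) (hf : Poly f) : Poly fun a => g (f a) := by
  obtain ⟨F, hF, h⟩ := hf
  obtain ⟨G, hG, h'⟩ := hg
  exact ⟨_, hG.comp hF, fun a => by rw [h, h']⟩

@[fun_prop]
theorem prodMk {f : α → β} {g : α → γ} (hf : Poly f) (hg : Poly g) : Poly fun a => (f a, g a) := by
  obtain ⟨F, hF, h⟩ := hf
  obtain ⟨G, hG, h'⟩ := hg
  refine ⟨_, (PolyTime.length_polyTime.comp hF).append (hF.append
    ((PolyTime.length_polyTime.comp hG).append hG)), fun a => ?_⟩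
  rw [enc_pair, h, h']

@[fun_prop]
theorem fst : Poly fun p : α × β => p.1 := by
  refine ⟨_, PolyTime.take PolyTime.head_polyTime PolyTime.tail_polyTime, fun p => ?_⟩
  rw [PolyTime.rot_iterate_drop _ (by rw [enc_pair]; simp), enc_pair]
  simp

@[fun_prop]
theorem snd : Poly fun p : α × β => p.2 := by
  refine ⟨_, PolyTime.tail_polyTime.comp
    (PolyTime.drop PolyTime.head_polyTime PolyTime.tail_polyTime), fun p => ?_⟩
  rw [enc_pair]
  simp

@[fun_prop]
theorem cond {b : α → Bool} {f g : α → β} (hb : Poly b) (hf : Poly f) (hg : Poly g) :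
    Poly fun a => bif b a then f a else g a := by
  obtain ⟨F, hF, h⟩ := hf
  obtain ⟨G, hG, h'⟩ := hg
  obtain ⟨N, hN, h''⟩ := hb
  refine ⟨_, hN.cond hF hG, fun a => ?_⟩
  rw [h, h', h'', enc_bool]
  cases hba : b a <;> simp [hba]

@[fun_prop]
theorem cons {f : α → β} {l : α → List β} (hf : Poly f) (hl : Poly l) :
    Poly fun a => f a :: l a := by
  obtain ⟨F, hF, h⟩ := hf
  obtain ⟨G, hG, h'⟩ := hl
  refine ⟨_, (PolyTime.length_polyTime.comp hF).append (hF.append hG), fun a => ?_⟩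
  rw [enc_cons, h, h']

@[fun_prop]
theorem append {l l' : α → List β} (hl : Poly l) (hl' : Poly l') :
    Poly fun a => l a ++ l' a := by
  obtain ⟨F, hF, h⟩ := hl
  obtain ⟨G, hG, h'⟩ := hl'
  exact ⟨_, hF.append hG, fun a => by rw [h, h', enc_append]⟩

@[fun_prop]
theorem tail {l : α → List β} (hl : Poly l) : Poly fun a => (l a).tail := by
  refine comp (g := fun l : List β => l.tail) ?_ hl
  refine ⟨_, PolyTime.drop PolyTime.head_polyTime PolyTime.tail_polyTime, fun l => ?_⟩
  cases l with
  | nil => rfl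
  | cons a l => rw [enc_cons]; simp

@[fun_prop]
theorem isEmpty {l : α → List β} (hl : Poly l) : Poly fun a => (l a).isEmpty := by
  refine comp (g := fun l : List β => l.isEmpty) ?_ hl
  refine ⟨_, PolyTime.length_polyTime.cond (PolyTime.const [0]) (PolyTime.const [1]), fun l => ?_⟩
  cases l with
  | nil => rfl
  | cons a l => rw [enc_cons]; simp [enc_bool]

@[fun_prop]
theorem headD {l : α → List β} {f : α → β} (hl : Poly l) (hf : Poly f) :
    Poly fun a => (l a).headD (f a) := by
  refine comp (g := fun p : List β × β => p.1.headD p.2) ?_ (hl.prodMk hf)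
  obtain ⟨N, hN, hN'⟩ := isEmpty (fst (α := List β) (β := β))
  obtain ⟨L, hL, hL'⟩ := fst (α := List β) (β := β)
  obtain ⟨D, hD, hD'⟩ := snd (α := List β) (β := β)
  refine ⟨_, hN.cond hD (PolyTime.take (PolyTime.head_polyTime.comp hL)
    (PolyTime.tail_polyTime.comp hL)), fun p => ?_⟩
  simp only [hN', hL', hD', enc_bool]
  rcases p with ⟨_ | ⟨a, l⟩, d⟩
  · simp
  · rw [PolyTime.rot_iterate_drop _ (by simp [enc_cons])]
    simp [enc_cons]

/-- Machine-level arithmetic wants a number for every list, valid code or not; the first entry of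
the output, with default 0, provides one. -/
theorem of_nat {f : α → ℕ} (hf : Poly f) : ∃ N : List ℕ → ℕ, PolyTime (fun x => [N x]) ∧
    ∀ a, N (Enc.enc a) = f a := by
  obtain ⟨F, hF, h⟩ := hf
  exact ⟨_, PolyTime.head_polyTime.comp hF, fun a => by rw [h]; rfl⟩

@[fun_prop]
theorem add {f g : α → ℕ} (hf : Poly f) (hg : Poly g) : Poly fun a => f a + g a := by
  obtain ⟨M, hM, h⟩ := hf.of_nat
  obtain ⟨N, hN, h'⟩ := hg.of_nat
  exact ⟨_, hM.add hN, fun a => by rw [h, h']; rfl⟩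

@[fun_prop]
theorem sub {f g : α → ℕ} (hf : Poly f) (hg : Poly g) : Poly fun a => f a - g a := by
  obtain ⟨M, hM, h⟩ := hf.of_nat
  obtain ⟨N, hN, h'⟩ := hg.of_nat
  exact ⟨_, hM.sub hN, fun a => by rw [h, h']; rfl⟩

@[fun_prop]
theorem mul {f g : α → ℕ} (hf : Poly f) (hg : Poly g) : Poly fun a => f a * g a := by
  obtain ⟨M, hM, h⟩ := hf.of_nat
  obtain ⟨N, hN, h'⟩ := hg.of_nat
  exact ⟨_, hM.mul hN, fun a => by rw [h, h']; rfl⟩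

theorem polynomial_eval {f : α → ℕ} (hf : Poly f) (p : Polynomial ℕ) :
    Poly fun a => p.eval (f a) := by
  obtain ⟨M, hM, h⟩ := hf.of_nat
  exact ⟨_, hM.polynomial_eval p, fun a => by rw [h]; rfl⟩

theorem bits_poly : Poly (bits : α → ℕ) := ⟨_, PolyTime.size, fun _ => rfl⟩

/-- Test for zero. -/
theorem ifZero {n : α → ℕ} {f g : α → β} (hn : Poly n) (hf : Poly f) (hg : Poly g) :
    Poly fun a => if n a = 0 then f a else g a := by
  obtain ⟨F, hF, h⟩ := hf
  obtain ⟨G, hG, h'⟩ := hg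
  obtain ⟨N, hN, h''⟩ := hn
  refine ⟨_, hN.cond hG hF, fun a => ?_⟩
  rw [h, h', h'', enc_nat]
  by_cases h0 : n a = 0 <;> simp [h0]

@[fun_prop]
theorem ble {f g : α → ℕ} (hf : Poly f) (hg : Poly g) : Poly fun a => Nat.ble (f a) (g a) := by
  have : (fun a => Nat.ble (f a) (g a)) = fun a => if f a - g a = 0 then true else false := by
    funext a
    rw [Bool.eq_iff_iff, Nat.ble_eq]
    simp [Nat.sub_eq_zero_iff_le]
  rw [this]
  exact ifZero (hf.sub hg) (const _) (const _)

/-- Iterate `f a` on `g a` for `n a` rounds, if intermediate results have polynomial length. -/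
theorem iterate {n : α → ℕ} {g : α → β} {f : α → β → β} (hn : Poly n) (hg : Poly g)
    (hf : Poly fun p : α × β => f p.1 p.2)
    (hsize : PolyBdd bits fun a => (Finset.range (n a + 1)).sup fun i => bits ((f a)^[i] (g a))) :
    Poly fun a => (f a)^[n a] (g a) := by
  obtain ⟨N, hN, hN'⟩ := hn.of_nat
  obtain ⟨G, hG, hG'⟩ := hg
  obtain ⟨F, hF, hF'⟩ := hf
  obtain ⟨p, hp⟩ := hsize
  have hFp : Poly (α := Raw × Raw) (β := Raw) fun s => ⟨F (Enc.enc s)⟩ := ⟨F, hF, fun _ => rfl⟩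
  have hcap : Poly (α := Raw) fun x => p.eval (bits x) := polynomial_eval bits_poly p
  -- The machine for `f` is controlled only on valid codes, whereas iteration needs a size bound on
  -- every input. Results longer than the polynomial `p` allows are therefore replaced by the empty
  -- list. On valid codes this never happens, by `hsize`. The original input is carried along so
  -- that the cap can be recomputed.
  let step : Raw × Raw → Raw × Raw := fun s =>
    (s.1, bif Nat.ble (bits (Raw.mk (F (Enc.enc s)))) (p.eval (bits s.1)) then
      ⟨F (Enc.enc s)⟩ else ⟨[]⟩)
  have hstep : Poly step := fst.prodMk (cond (ble (bits_poly.comp hFp) (hcap.comp fst)) hFp (const _))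
  obtain ⟨K, hK, hK'⟩ := hstep
  have hinit : Poly (α := Raw) (β := Raw × Raw) fun x => (x, ⟨G x.list⟩) :=
    id.prodMk ⟨G, hG, fun _ => rfl⟩
  obtain ⟨I, hI, hI'⟩ := hinit
  have hiter : ∀ x i, K^[i] (I x) = Enc.enc (step^[i] (⟨x⟩, ⟨G x⟩)) := by
    intro x i
    induction i with
    | zero => exact hI' ⟨x⟩
    | succ i ih => rw [Function.iterate_succ_apply', Function.iterate_succ_apply', ih, hK']
  have hfst : ∀ x i, (step^[i] (⟨x⟩, ⟨G x⟩)).1 = ⟨x⟩ := by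
    intro x i
    induction i with
    | zero => rfl
    | succ i ih => rw [Function.iterate_succ_apply']; exact ih
  have hsnd : ∀ x i, bits (step^[i] (⟨x⟩, ⟨G x⟩)).2 ≤ p.eval (size x) + size (G x) := by
    intro x i
    cases i with
    | zero => exact Nat.le_add_left _ _
    | succ i =>
      rw [Function.iterate_succ_apply']
      have h1 := hfst x i
      generalize step^[i] (⟨x⟩, ⟨G x⟩) = s at h1
      simp only [step]
      cases h : Nat.ble (bits (Raw.mk (F (Enc.enc s)))) (p.eval (bits s.1))
      · simp [bits, enc_raw, size_nil]
      · rw [Nat.ble_eq, h1] at h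
        exact h.trans (Nat.le_add_right _ _)
  have hlen : ∀ l : List ℕ, l.length ≤ size l := by
    intro l
    induction l with
    | nil => simp
    | cons a l ih => rw [size_cons, List.length_cons]; omega
  have := hN.iterate hI hK (S := fun x => 2 * (size x + (p.eval (size x) + size (G x))) + 2)
    (.add (.mul (.const 2) (.add .self (.add (.eval .self p) hG.size_le))) (.const 2))
    fun x i _ => by
      rw [hiter, enc_pair, hfst]
      have h1 := hsnd x i
      have h2 := hlen x
      have h3 := hlen (step^[i] (⟨x⟩, ⟨G x⟩)).2.list
      simp only [bits, enc_raw, size_append, size_cons, size_nil] at h1 ⊢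
      omega
  obtain ⟨P, hP, hP'⟩ := snd (α := Raw) (β := Raw)
  refine ⟨_, hP.comp this, fun a => ?_⟩
  rw [hiter, hP', hN', enc_raw]
  -- On valid codes the capped iteration coincides with the intended one.
  have key : ∀ i ≤ n a, step^[i] (⟨Enc.enc a⟩, ⟨G (Enc.enc a)⟩) =
      (⟨Enc.enc a⟩, ⟨Enc.enc ((f a)^[i] (g a))⟩) := by
    intro i
    induction i with
    | zero => intro _; rw [hG']; rfl
    | succ i ih =>
      intro hi
      rw [Function.iterate_succ_apply', Function.iterate_succ_apply', ih (by omega)]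
      have h1 : F (Enc.enc (Raw.mk (Enc.enc a), Raw.mk (Enc.enc ((f a)^[i] (g a))))) =
        Enc.enc (f a ((f a)^[i] (g a))) := hF' (a, (f a)^[i] (g a))
      have h2 : bits (f a ((f a)^[i] (g a))) ≤ p.eval (bits a) := by
        refine le_trans ?_ (hp a)
        rw [← Function.iterate_succ_apply' (f a)]
        exact Finset.le_sup (f := fun i => bits ((f a)^[i] (g a)))
          (Finset.mem_range.2 (by omega))
      have h3 : Nat.ble (bits (Raw.mk (Enc.enc (f a ((f a)^[i] (g a))))))
          (p.eval (bits (Raw.mk (Enc.enc a)))) = true := by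
        rw [Nat.ble_eq]
        exact h2
      simp only [step]
      rw [h1, h3, cond_true]
  rw [key _ le_rfl]

end Poly

end

/-! ### Lengths of codes and polynomial-time list functions -/

section

variable {α β γ δ : Type} [Enc α] [Enc β] [Enc γ] [Enc δ]

theorem length_le_size (l : List ℕ) : l.length ≤ size l := by
  induction l with
  | nil => simp
  | cons a l ih => rw [size_cons, List.length_cons]; omega

theorem bits_nat (n : ℕ) : bits n = n + 1 := by simp [bits, enc_nat, size_cons, size_nil]

theorem bits_pair_le (p : α × β) : bits p ≤ 2 * (bits p.1 + bits p.2) + 2 := by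
  have h1 := length_le_size (Enc.enc p.1)
  have h2 := length_le_size (Enc.enc p.2)
  simp only [bits, enc_pair, size_append, size_cons, size_nil]
  omega

theorem bits_nil : bits ([] : List α) = 0 := rfl

theorem bits_cons (a : α) (l : List α) :
    bits (a :: l) = (Enc.enc a).length + 1 + bits a + bits l := by
  simp only [bits, enc_cons, size_append, size_cons, size_nil]
  omega

theorem bits_append (l l' : List α) : bits (l ++ l') = bits l + bits l' := by
  simp only [bits, enc_append, size_append]

theorem bits_le_of_mem {a : α} {l : List α} (h : a ∈ l) : bits a ≤ bits l := by
  induction l with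
  | nil => simp at h
  | cons b l ih =>
    rw [bits_cons]
    rcases List.mem_cons.1 h with rfl | h
    · omega
    · have := ih h
      omega

theorem length_le_bits (l : List α) : l.length ≤ bits l := by
  induction l with
  | nil => simp
  | cons b l ih => rw [bits_cons, List.length_cons]; omega

theorem bits_list_le {l : List α} {M : ℕ} (h : ∀ a ∈ l, bits a ≤ M) :
    bits l ≤ l.length * (2 * M + 1) := by
  induction l with
  | nil => simp [bits_nil]
  | cons b l ih =>
    have h1 := ih fun a ha => h a (List.mem_cons_of_mem _ ha)
    have h2 := h b List.mem_cons_self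
    have h3 := length_le_size (Enc.enc b)
    rw [bits_cons, List.length_cons, Nat.succ_mul]
    simp only [bits] at *
    omega

theorem bits_sublist_le {l l' : List α} (h : l.Sublist l') : bits l ≤ bits l' := by
  induction h with
  | slnil => exact le_rfl
  | cons a _ ih => rw [bits_cons]; omega
  | cons_cons a _ ih => rw [bits_cons, bits_cons]; omega

instance : Inhabited Raw := ⟨⟨[]⟩⟩

namespace Poly

theorem congr {f g : α → β} (hf : Poly f) (h : ∀ a, f a = g a) : Poly g :=
  (funext h : f = g) ▸ hf

theorem iterate_of_le {n : α → ℕ} {g : α → β} {f : α → β → β} (hn : Poly n) (hg : Poly g)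
    (hf : Poly fun p : α × β => f p.1 p.2) {S : α → ℕ} (hS : PolyBdd bits S)
    (hsize : ∀ a, ∀ i ≤ n a, bits ((f a)^[i] (g a)) ≤ S a) :
    Poly fun a => (f a)^[n a] (g a) :=
  iterate hn hg hf (hS.mono fun a => Finset.sup_le fun i hi =>
    hsize a i (by rw [Finset.mem_range] at hi; omega))

@[fun_prop]
theorem and {f g : α → Bool} (hf : Poly f) (hg : Poly g) : Poly fun a => f a && g a :=
  (cond hf hg (const false)).congr fun a => by cases f a <;> rfl

@[fun_prop]
theorem or {f g : α → Bool} (hf : Poly f) (hg : Poly g) : Poly fun a => f a || g a :=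
  (cond hf (const true) hg).congr fun a => by cases f a <;> rfl

@[fun_prop]
theorem not {f : α → Bool} (hf : Poly f) : Poly fun a => !f a :=
  (cond hf (const false) (const true)).congr fun a => by cases f a <;> rfl

@[fun_prop]
theorem toNat {f : α → Bool} (hf : Poly f) : Poly fun a => (f a).toNat :=
  (cond hf (const 1) (const 0)).congr fun a => by cases f a <;> rfl

@[fun_prop]
theorem beq {f g : α → ℕ} (hf : Poly f) (hg : Poly g) : Poly fun a => Nat.beq (f a) (g a) :=
  ((ble hf hg).and (ble hg hf)).congr fun a => by
    rw [Bool.eq_iff_iff, Bool.and_eq_true, Nat.ble_eq, Nat.ble_eq, Nat.beq_eq]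
    omega

@[fun_prop]
theorem drop {l : γ → List α} {n : γ → ℕ} (hl : Poly l) (hn : Poly n) :
    Poly fun c => (l c).drop (n c) := by
  have hiter : ∀ (l : List α) i, List.tail^[i] l = l.drop i := by
    intro l i
    induction i with
    | zero => rfl
    | succ i ih => rw [Function.iterate_succ_apply', ih, List.tail_drop]
  refine (iterate_of_le (f := fun _ => List.tail) hn hl (tail snd) hl.bits_le
    fun c i _ => ?_).congr fun c => hiter _ _
  rw [hiter]
  exact bits_sublist_le (List.drop_sublist _ _)

@[fun_prop]
theorem getD {l : γ → List α} {n : γ → ℕ} {d : γ → α} (hl : Poly l) (hn : Poly n) (hd : Poly d) :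
    Poly fun c => (l c).getD (n c) (d c) :=
  (headD (drop hl hn) hd).congr fun c => by
    simp [List.headD_eq_head?_getD, List.head?_drop]

/-- The fold is an iteration on pairs of remaining list and accumulator. The accumulator bound is
required exactly for prefixes of the list, as these are the intermediate stages. -/
theorem foldl [Inhabited α] {l : γ → List α} {g : γ → β} {f : γ → β → α → β} (hl : Poly l)
    (hg : Poly g) (hf : Poly fun p : γ × (β × α) => f p.1 p.2.1 p.2.2) {S : γ → ℕ}
    (hS : PolyBdd bits S)
    (hsize : ∀ c, ∀ l', l' <+: l c → bits (l'.foldl (f c) (g c)) ≤ S c) :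
    Poly fun c => (l c).foldl (f c) (g c) := by
  let step : γ → List α × β → List α × β := fun c s =>
    bif s.1.isEmpty then s else (s.1.tail, f c s.2 (s.1.headD default))
  have hstep : Poly fun p : γ × (List α × β) => step p.1 p.2 := by
    have : Poly fun p : γ × (List α × β) => f p.1 p.2.2 (p.2.1.headD default) :=
      hf.comp (f := fun p : γ × (List α × β) => (p.1, (p.2.2, p.2.1.headD default))) (by fun_prop)
    fun_prop
  have hiter : ∀ c i, (step c)^[i] (l c, g c) =
      ((l c).drop i, ((l c).take i).foldl (f c) (g c)) := by
    intro c i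
    induction i with
    | zero => simp
    | succ i ih =>
      rw [Function.iterate_succ_apply', ih]
      simp only [step]
      by_cases h : i < (l c).length
      · have e := (List.take_concat_get' _ i h).symm
        rw [List.drop_eq_getElem_cons h, e, List.foldl_append]
        rfl
      · rw [List.drop_eq_nil_of_le (by omega), List.drop_eq_nil_of_le (by omega),
          List.take_of_length_le (by omega), List.take_of_length_le (by omega)]
        rfl
  -- The number of rounds is the code length of the list: it is at least the list length and already
  -- known to be computable, and surplus rounds on the empty list do nothing.
  refine (snd.comp (iterate_of_le (f := step) (bits_poly.comp hl) (hl.prodMk hg) hstep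
    (S := fun c => 2 * (bits (l c) + S c) + 2)
    (.add (.mul (.const 2) (.add hl.bits_le hS)) (.const 2)) fun c i _ => ?_)).congr fun c => ?_
  · rw [hiter]
    refine (bits_pair_le _).trans ?_
    have h1 := hsize c _ (List.take_prefix i (l c))
    have h2 := bits_sublist_le (List.drop_sublist i (l c))
    dsimp only
    omega
  · rw [hiter, List.take_of_length_le (length_le_bits _)]

@[fun_prop]
theorem map [Inhabited α] {l : γ → List α} {f : γ → α → β} (hl : Poly l)
    (hf : Poly fun p : γ × α => f p.1 p.2) : Poly fun c => (l c).map (f c) := by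
  obtain ⟨p, hp⟩ := hf.bits_le
  have hfold : ∀ (c) (m : List α) (acc : List β),
      m.foldl (fun acc a => acc ++ [f c a]) acc = acc ++ m.map (f c) := by
    intro c m
    induction m with
    | nil => simp
    | cons a m ih => intro acc; rw [List.foldl_cons, ih]; simp
  refine (foldl (f := fun c acc a => acc ++ [f c a]) hl (const [])
    (append (fst.comp snd) (cons (hf.comp (fst.prodMk (snd.comp snd))) (const [])))
    (S := fun c => bits (l c) * (2 * p.eval (2 * (bits c + bits (l c)) + 2) + 1))
    (.mul hl.bits_le (.add (.mul (.const 2) (.eval (.add (.mul (.const 2)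
      (.add .self hl.bits_le)) (.const 2)) p)) (.const 1))) fun c l' hl' => ?_).congr
    fun c => (hfold c _ _).trans (List.nil_append _)
  rw [hfold, List.nil_append]
  refine (bits_list_le (M := p.eval (2 * (bits c + bits (l c)) + 2)) fun b hb => ?_).trans
    (Nat.mul_le_mul_right _ ?_)
  · obtain ⟨a, ha, rfl⟩ := List.mem_map.1 hb
    have h1 := bits_le_of_mem (hl'.subset ha)
    exact (hp (c, a)).trans (polynomial_eval_mono p ((bits_pair_le _).trans (by dsimp only; omega)))
  · rw [List.length_map]
    exact hl'.length_le.trans (length_le_bits _)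

@[fun_prop]
theorem flatten [Inhabited α] {l : γ → List (List α)} (hl : Poly l) :
    Poly fun c => (l c).flatten := by
  have hfold : ∀ (m : List (List α)) (acc : List α),
      m.foldl (fun acc a => acc ++ a) acc = acc ++ m.flatten := by
    intro m
    induction m with
    | nil => simp
    | cons a m ih => intro acc; rw [List.foldl_cons, ih]; simp
  have hbits : ∀ m : List (List α), bits m.flatten ≤ bits m := by
    intro m
    induction m with
    | nil => exact le_rfl
    | cons a m ih => rw [List.flatten_cons, bits_append, bits_cons]; omega
  refine (foldl (f := fun c acc a => acc ++ a) hl (const [])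
    (append (fst.comp snd) (snd.comp snd)) hl.bits_le fun c l' hl' => ?_).congr
    fun c => (hfold _ _).trans (List.nil_append _)
  rw [hfold, List.nil_append]
  exact (hbits l').trans (bits_sublist_le hl'.sublist)

@[fun_prop]
theorem flatMap [Inhabited α] [Inhabited β] {l : γ → List α} {f : γ → α → List β} (hl : Poly l)
    (hf : Poly fun p : γ × α => f p.1 p.2) : Poly fun c => (l c).flatMap (f c) :=
  flatten (map hl hf)

@[fun_prop]
theorem filter [Inhabited α] {l : γ → List α} {f : γ → α → Bool} (hl : Poly l)
    (hf : Poly fun p : γ × α => f p.1 p.2) : Poly fun c => (l c).filter (f c) := by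
  refine (flatMap (f := fun c a => bif f c a then [a] else []) hl
    (cond hf (cons snd (const [])) (const []))).congr fun c => ?_
  induction l c with
  | nil => rfl
  | cons a m ih => rw [List.flatMap_cons, ih, List.filter_cons]; cases f c a <;> rfl

@[fun_prop]
theorem sum {l : γ → List ℕ} (hl : Poly l) : Poly fun c => (l c).sum := by
  refine (foldl (f := fun c s a => s + a) hl (const 0) (add (fst.comp snd) (snd.comp snd))
    (S := fun c => bits (l c) + 1) (.add hl.bits_le (.const 1)) fun c l' hl' => ?_).congr
    fun c => List.sum_eq_foldl.symm
  have h : ∀ m : List ℕ, m.sum ≤ bits m := by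
    intro m
    induction m with
    | nil => simp
    | cons a m ih => rw [List.sum_cons, bits_cons, bits_nat]; omega
  rw [← List.sum_eq_foldl, bits_nat]
  exact Nat.succ_le_succ ((h _).trans (bits_sublist_le hl'.sublist))

@[fun_prop]
theorem length [Inhabited α] {l : γ → List α} (hl : Poly l) : Poly fun c => (l c).length :=
  (sum (map (f := fun _ _ => 1) hl (const 1))).congr fun c => by simp

@[fun_prop]
theorem any [Inhabited α] {l : γ → List α} {f : γ → α → Bool} (hl : Poly l)
    (hf : Poly fun p : γ × α => f p.1 p.2) : Poly fun c => (l c).any (f c) :=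
  (not (isEmpty (filter hl hf))).congr fun c => by
    rw [Bool.eq_iff_iff]
    simp

@[fun_prop]
theorem all [Inhabited α] {l : γ → List α} {f : γ → α → Bool} (hl : Poly l)
    (hf : Poly fun p : γ × α => f p.1 p.2) : Poly fun c => (l c).all (f c) :=
  (not (any (f := fun c a => !f c a) hl (not hf))).congr fun c => by
    rw [Bool.eq_iff_iff]
    simp

@[fun_prop]
theorem range {n : γ → ℕ} (hn : Poly n) : Poly fun c => List.range (n c) := by
  have hiter : ∀ i, (fun l : List ℕ => l ++ [l.length])^[i] [] = List.range i := by
    intro i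
    induction i with
    | zero => rfl
    | succ i ih => rw [Function.iterate_succ_apply', ih, List.range_succ, List.length_range]
  refine (iterate_of_le (f := fun _ (l : List ℕ) => l ++ [l.length]) hn (const [])
    (append snd (cons (length snd) (const []))) (S := fun c => n c * (2 * (n c + 1) + 1))
    ?_ fun c i hi => ?_).congr fun c => hiter _
  · have : PolyBdd bits n := hn.bits_le.mono fun c => by rw [bits_nat]; omega
    exact this.mul (.add (.mul (.const 2) (this.add (.const 1))) (.const 1))
  · rw [hiter]
    refine (bits_list_le (M := n c + 1) fun a ha => ?_).trans ?_
    · rw [List.mem_range] at ha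
      rw [bits_nat]
      omega
    · rw [List.length_range]
      exact Nat.mul_le_mul_right _ hi

theorem nat_le {n : γ → ℕ} (hn : Poly n) : PolyBdd bits n :=
  hn.bits_le.mono fun c => by rw [bits_nat]; omega

-- A counter that resets on reaching `q` shows `i % q` after `i` increments. For `q = 0` it never
-- resets, in accordance with `i % 0 = i`.
@[fun_prop]
theorem mod {f g : γ → ℕ} (hf : Poly f) (hg : Poly g) : Poly fun c => f c % g c := by
  have hiter : ∀ q i, (fun r => bif Nat.beq (r + 1) q then 0 else r + 1)^[i] 0 = i % q := by
    intro q i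
    induction i with
    | zero => simp
    | succ i ih =>
      rw [Function.iterate_succ_apply', ih]
      rcases Nat.eq_zero_or_pos q with rfl | hq
      · rw [Nat.mod_zero, Nat.mod_zero]
        rfl
      · by_cases h : i % q + 1 = q
        · have h2 : (i + 1) % q = 0 := by
            rw [Nat.add_mod]
            rcases Nat.lt_or_ge 1 q with h1 | h1
            · rw [Nat.mod_eq_of_lt h1, h, Nat.mod_self]
            · obtain rfl : q = 1 := by omega
              omega
          rw [h2, show Nat.beq (i % q + 1) q = true by rw [Nat.beq_eq]; exact h]
          rfl
        · have h1 : i % q + 1 < q := by have := Nat.mod_lt i hq; omega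
          have h2 : (i + 1) % q = i % q + 1 := by
            rw [Nat.add_mod, Nat.mod_eq_of_lt (show 1 < q by omega), Nat.mod_eq_of_lt h1]
          have h3 : Nat.beq (i % q + 1) q = false := by
            rw [← Bool.not_eq_true, Nat.beq_eq]
            exact h
          rw [h2, h3]
          rfl
  refine (iterate_of_le (f := fun c r => bif Nat.beq (r + 1) (g c) then 0 else r + 1) hf (const 0)
    (by fun_prop) (S := fun c => f c + 1) (.add hf.nat_le (.const 1)) fun c i hi => ?_).congr
    fun c => hiter _ _
  rw [hiter, bits_nat]
  exact Nat.succ_le_succ ((Nat.mod_le _ _).trans hi)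

@[fun_prop]
theorem max {f g : γ → ℕ} (hf : Poly f) (hg : Poly g) : Poly fun c => Max.max (f c) (g c) :=
  (cond (ble hf hg) hg hf).congr fun c => by
    cases h : Nat.ble (f c) (g c)
    · have : ¬ f c ≤ g c := by rw [← Nat.ble_eq, h]; simp
      simp; omega
    · rw [Nat.ble_eq] at h
      simp [h]

-- The integer square root of `n` is the number of `i < n` with `(i + 1)² ≤ n`. The exhaustive count
-- is affordable because numbers are in unary.
@[fun_prop]
theorem sqrt {f : γ → ℕ} (hf : Poly f) : Poly fun c => Nat.sqrt (f c) := by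
  have : Poly fun n : ℕ =>
      ((List.range n).filter fun i => Nat.ble ((i + 1) * (i + 1)) n).length :=
    length (filter (f := fun n i => Nat.ble ((i + 1) * (i + 1)) n) (by fun_prop) (by fun_prop))
  refine (this.comp hf).congr fun c => ?_
  have h : ∀ n m, ((List.range m).filter fun i => Nat.ble ((i + 1) * (i + 1)) n).length =
      min m (Nat.sqrt n) := by
    intro n m
    induction m with
    | zero => simp
    | succ m ih =>
      rw [List.range_succ, List.filter_append, List.length_append, ih]
      cases hb : Nat.ble ((m + 1) * (m + 1)) n
      · have : ¬ (m + 1) * (m + 1) ≤ n := by rw [← Nat.ble_eq, hb]; simp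
        rw [← Nat.le_sqrt] at this
        simp [hb]; omega
      · rw [Nat.ble_eq, ← Nat.le_sqrt] at hb
        have hb' : Nat.ble ((m + 1) * (m + 1)) n = true := by rwa [Nat.ble_eq, ← Nat.le_sqrt]
        simp [hb']; omega
  rw [h, min_eq_right (Nat.sqrt_le_self _)]

/-! ### Conversions -/

/-- The serialisation as an uninterpreted list. -/
@[fun_prop]
theorem toRaw {f : γ → α} (hf : Poly f) : Poly fun c => Raw.mk (Enc.enc (f c)) := by
  obtain ⟨F, hF, h⟩ := hf
  exact ⟨F, hF, h⟩

theorem of_polyTime {F : List ℕ → List ℕ} (hF : PolyTime F) : Poly fun r : Raw => Raw.mk (F r.list) :=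
  ⟨F, hF, fun _ => rfl⟩

-- A raw list is its own code, while in the code of a `List ℕ` every entry is preceded by its block
-- length 1. Passing between the two is thus a computation; `rawMk` is the converse.
@[fun_prop]
theorem rawList {f : γ → Raw} (hf : Poly f) : Poly fun c => (f c).list := by
  refine comp (g := Raw.list) ?_ hf
  let step : Raw × List ℕ → Raw × List ℕ := fun s => (⟨s.1.list.tail⟩, s.2 ++ [s.1.list.headD 0])
  have hhead : Poly fun r : Raw => r.list.headD 0 := ⟨_, PolyTime.head_polyTime, fun _ => rfl⟩
  have htail : Poly fun r : Raw => Raw.mk r.list.tail := ⟨_, PolyTime.tail_polyTime, fun _ => rfl⟩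
  have hlen : Poly fun r : Raw => r.list.length := ⟨_, PolyTime.length_polyTime, fun _ => rfl⟩
  have hiter : ∀ (r : List ℕ) i, i ≤ r.length → step^[i] (⟨r⟩, []) = (⟨r.drop i⟩, r.take i) := by
    intro r i
    induction i with
    | zero => simp
    | succ i ih =>
      intro hi
      rw [Function.iterate_succ_apply', ih (by omega)]
      simp only [step]
      have e := (List.take_concat_get' r i (by omega)).symm
      rw [List.drop_eq_getElem_cons (show i < r.length by omega), e]
      rfl
  have hstep : Poly step := by
    have h1 := htail.comp (fst (α := Raw) (β := List ℕ))
    have h2 := hhead.comp (fst (α := Raw) (β := List ℕ))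
    exact prodMk h1 (append snd (cons h2 (const [])))
  have hb : ∀ l : List ℕ, bits l ≤ 3 * size l := by
    intro l
    induction l with
    | nil => simp [bits_nil]
    | cons a l ih => rw [bits_cons, bits_nat, size_cons, enc_nat]; simp only [List.length_singleton]; omega
  refine (snd.comp (iterate_of_le (f := fun _ => step) (g := fun r => (r, [])) hlen
    (id.prodMk (const [])) (hstep.comp snd) (S := fun r => 8 * bits r + 2)
    (.add (.mul (.const _) .self) (.const _)) fun r i hi => ?_)).congr fun r => ?_
  · rw [hiter _ _ hi]
    refine (bits_pair_le _).trans ?_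
    have h1 := hb (r.list.take i)
    have h2 := congrArg size (List.take_append_drop i r.list)
    rw [size_append] at h2
    simp only [bits, enc_raw] at h1 ⊢
    omega
  · rw [hiter _ _ le_rfl]
    simp

@[fun_prop]
theorem rawMk {f : γ → List ℕ} (hf : Poly f) : Poly fun c => Raw.mk (f c) := by
  have hfold : ∀ (m : List ℕ) (acc : List ℕ),
      m.foldl (fun (r : Raw) a => ⟨r.list ++ [a]⟩) ⟨acc⟩ = ⟨acc ++ m⟩ := by
    intro m
    induction m with
    | nil => simp
    | cons a m ih => intro acc; rw [List.foldl_cons, ih]; simp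
  have happ : Poly fun p : Raw × ℕ => Raw.mk (p.1.list ++ [p.2]) := by
    obtain ⟨F, hF, h⟩ := fst (α := Raw) (β := ℕ)
    obtain ⟨G, hG, h'⟩ := snd (α := Raw) (β := ℕ)
    exact ⟨_, hF.append hG, fun p => by rw [h, h']; rfl⟩
  refine (foldl (f := fun _ (r : Raw) a => ⟨r.list ++ [a]⟩) (g := fun _ => ⟨[]⟩) hf (const _)
    (happ.comp snd) hf.bits_le fun c l' hl' => ?_).congr fun c => hfold _ _
  have hb : ∀ l : List ℕ, size l ≤ bits l := by
    intro l
    induction l with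
    | nil => simp [size_nil]
    | cons a l ih => rw [bits_cons, bits_nat, size_cons]; omega
  rw [hfold]
  exact (hb l').trans (bits_sublist_le hl'.sublist)

end Poly

end

/-! ### Peeling as iteration -/

section PeelStep

variable {k n m q c : ℕ} [NeZero q]

/-- One round of peeling. -/
def peelStep (r : Fin k → Fin m → Fin c) (A : Matrix (Fin n) (Fin m) (ZMod q))
    (s : Sketch k n q c × Finset (Fin m)) : Sketch k n q c × Finset (Fin m) :=
  (peel r s.1 (peelable A s.1), s.2 ∪ (peelable A s.1).image Prod.fst)

theorem peelStep_of_peelable_eq_empty {r : Fin k → Fin m → Fin c}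
    {A : Matrix (Fin n) (Fin m) (ZMod q)} {s : Sketch k n q c × Finset (Fin m)}
    (h : peelable A s.1 = ∅) : peelStep r A s = s := by
  refine Prod.ext ?_ ?_
  · funext i j
    simp [peelStep, h, peel]
  · simp [peelStep, h]

/-- A round with nothing to peel changes nothing, so stopping early is the same as iterating on. Of
`f + 1` rounds the last one only has to find that nothing is left to peel, whence `f` iterations. -/
theorem peelLoop_eq (r : Fin k → Fin m → Fin c) (A : Matrix (Fin n) (Fin m) (ZMod q)) (f : ℕ)
    (s : Sketch k n q c × Finset (Fin m)) :
    peelLoop r A (f + 1) s.1 s.2 =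
      if peelable A ((peelStep r A)^[f] s).1 = ∅ ∧ ((peelStep r A)^[f] s).1 = 0 then
        some ((peelStep r A)^[f] s).2 else none := by
  induction f generalizing s with
  | zero =>
    rw [peelLoop]
    by_cases h : peelable A s.1 = ∅
    · have h1 := peelStep_of_peelable_eq_empty (r := r) h
      have h2 : peel r s.1 (peelable A s.1) = s.1 := congrArg Prod.fst h1
      have h3 : s.2 ∪ (peelable A s.1).image Prod.fst = s.2 := congrArg Prod.snd h1
      simp only [h2, h3]
      simp [h]
    · simp [h, peelLoop]
  | succ f ih =>
    by_cases h : peelable A s.1 = ∅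
    · have h1 := peelStep_of_peelable_eq_empty (r := r) h
      have h2 : peel r s.1 (peelable A s.1) = s.1 := congrArg Prod.fst h1
      have h3 : s.2 ∪ (peelable A s.1).image Prod.fst = s.2 := congrArg Prod.snd h1
      rw [Function.iterate_fixed h1, peelLoop]
      simp only [h2, h3]
      simp [h]
    · rw [peelLoop]
      simp only [h, if_false]
      exact ih (peelStep r A s)

theorem sketchDecode_eq (r : Fin k → Fin m → Fin c) (A : Matrix (Fin n) (Fin m) (ZMod q))
    (H₀ H₁ : Sketch k n q c) : sketchDecode r A H₀ H₁ =
      if peelable A ((peelStep r A)^[m] (H₀ - H₁, ∅)).1 = ∅ ∧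
        ((peelStep r A)^[m] (H₀ - H₁, ∅)).1 = 0 then
        some ((peelStep r A)^[m] (H₀ - H₁, ∅)).2 else none :=
  peelLoop_eq r A m (H₀ - H₁, ∅)

end PeelStep

/-! ### Arrays as lists -/

/-- The entry at position `i` of a list of numbers, `0` outside the range. -/
def at1 (l : List ℕ) (i : ℕ) : ℕ := l.getD i 0
def at2 (l : List (List ℕ)) (i j : ℕ) : ℕ := at1 (l.getD i []) j
def at3 (l : List (List (List ℕ))) (i j a : ℕ) : ℕ := at2 (l.getD i []) j a

section

variable {γ : Type} [Enc γ]

namespace Poly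

@[fun_prop]
theorem at1 {l : γ → List ℕ} {i : γ → ℕ} (hl : Poly l) (hi : Poly i) :
    Poly fun e => at1 (l e) (i e) := by
  unfold RobustPPH.at1; fun_prop

@[fun_prop]
theorem at2 {l : γ → List (List ℕ)} {i j : γ → ℕ} (hl : Poly l) (hi : Poly i) (hj : Poly j) :
    Poly fun e => at2 (l e) (i e) (j e) := by
  unfold RobustPPH.at2; fun_prop

@[fun_prop]
theorem at3 {l : γ → List (List (List ℕ))} {i j a : γ → ℕ} (hl : Poly l) (hi : Poly i)
    (hj : Poly j) (ha : Poly a) : Poly fun e => at3 (l e) (i e) (j e) (a e) := by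
  unfold RobustPPH.at3; fun_prop

end Poly

end

theorem getD_ofFn {α : Type} {n : ℕ} (f : Fin n → α) (d : α) (i : Fin n) :
    (List.ofFn f).getD i d = f i := by
  simp [List.getD_eq_getElem?_getD]

theorem at1_ofFn {n : ℕ} (f : Fin n → ℕ) (i : Fin n) : at1 (List.ofFn f) i = f i :=
  getD_ofFn f 0 i

theorem at2_ofFn {n m : ℕ} (f : Fin n → Fin m → ℕ) (i : Fin n) (j : Fin m) :
    at2 (List.ofFn fun i => List.ofFn (f i)) i j = f i j := by
  rw [at2, getD_ofFn (fun i => List.ofFn (f i)), at1_ofFn]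

theorem at3_ofFn {n m l : ℕ} (f : Fin n → Fin m → Fin l → ℕ) (i : Fin n) (j : Fin m) (a : Fin l) :
    at3 (List.ofFn fun i => List.ofFn fun j => List.ofFn (f i j)) i j a = f i j a := by
  rw [at3, getD_ofFn (fun i => List.ofFn fun j => List.ofFn (f i j)), at2_ofFn]

theorem map_range_eq_ofFn {α : Type} (n : ℕ) (f : ℕ → α) :
    (List.range n).map f = List.ofFn fun i : Fin n => f i := by
  apply List.ext_getElem <;> simp

theorem enc_ofFn {α : Type} [Enc α] {n : ℕ} (f : Fin n → α) :
    Enc.enc (List.ofFn f) = pack (List.ofFn fun i => Enc.enc (f i)) := by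
  change pack ((List.ofFn f).map Enc.enc) = _
  rw [List.map_ofFn]
  rfl

theorem mod_eq_val {q : ℕ} [NeZero q] {N : ℕ} {z : ZMod q} (h : (N : ZMod q) = z) :
    N % q = z.val := by
  rw [← h, ZMod.val_natCast]

theorem cast_neg_mod {q : ℕ} [NeZero q] (N : ℕ) : ((q - N % q : ℕ) : ZMod q) = -(N : ZMod q) := by
  rw [Nat.cast_sub (Nat.mod_lt _ (NeZero.pos q)).le]
  simp

/-- A sketch as a list. -/
def sketchList {k n q c : ℕ} (H : Sketch k n q c) : List (List (List ℕ)) :=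
  List.ofFn fun i => List.ofFn fun j => List.ofFn fun a => (H i j a).val

/-- A matrix as a list. -/
def matList {n m q : ℕ} (A : Matrix (Fin n) (Fin m) (ZMod q)) : List (List ℕ) :=
  List.ofFn fun a => List.ofFn fun x => (A a x).val

/-- The table of values of the functions `rᵢ`. -/
def tableList {k m c : ℕ} (r : Fin k → Fin m → Fin c) : List (List ℕ) :=
  List.ofFn fun i => List.ofFn fun x => (r i x).val

open Classical in
/-- The indicator of a set. -/
def setList {m : ℕ} (X : Finset (Fin m)) : List ℕ :=
  List.ofFn fun x => if x ∈ X then 1 else 0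

/-! ### The algorithms on lists -/

/-- A list over an initial segment of the natural numbers. -/
def tab {α : Type} (n : ℕ) (f : ℕ → α) : List α := (List.range n).map f

theorem tab_eq_ofFn {α : Type} (n : ℕ) (f : ℕ → α) : tab n f = List.ofFn fun i : Fin n => f i :=
  map_range_eq_ofFn n f

/-- The vectors `w` and `v` agree. -/
def eqVec (n : ℕ) (w v : List ℕ) : Bool := (List.range n).all fun a => Nat.beq (at1 w a) (at1 v a)

/-- The vector `v` is an entry of the sketch. -/
def hasEntry (n : ℕ) (H : List (List (List ℕ))) (v : List ℕ) : Bool :=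
  H.any fun row => row.any fun w => eqVec n w v

def colList (n : ℕ) (A : List (List ℕ)) (x : ℕ) : List ℕ := tab n fun a => at2 A a x

def negColList (n q : ℕ) (A : List (List ℕ)) (x : ℕ) : List ℕ :=
  tab n fun a => (q - at2 A a x % q) % q

/-- Some pair `(x, w)` can be peeled. -/
def canPeel (n q : ℕ) (A : List (List ℕ)) (H : List (List (List ℕ))) (x : ℕ) : Bool :=
  hasEntry n H (colList n A x) || hasEntry n H (negColList n q A x)

/-- The sum of all `w` such that `(x, w)` is peeled. -/
def contrib (n q : ℕ) (A : List (List ℕ)) (H : List (List (List ℕ))) (x : ℕ) (a : ℕ) : ℕ :=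
  (bif hasEntry n H (colList n A x) then at2 A a x else 0) +
    bif hasEntry n H (negColList n q A x) && !eqVec n (colList n A x) (negColList n q A x) then
      q - at2 A a x % q else 0

def stepList (k c n m q : ℕ) (rt A : List (List ℕ)) (s : List (List (List ℕ)) × List ℕ) :
    List (List (List ℕ)) × List ℕ :=
  (tab k fun i => tab c fun j => tab n fun a =>
    (at3 s.1 i j a + (tab m fun x => bif Nat.beq (at2 rt i x) j then
      q - contrib n q A s.1 x a % q else 0).sum) % q,
  tab m fun x => (Nat.beq (at1 s.2 x) 1 || canPeel n q A s.1 x).toNat)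

section Correct

variable {k n m q c : ℕ} [NeZero q]

theorem eqVec_iff (w v : Fin n → ZMod q) :
    eqVec n (List.ofFn fun a => (w a).val) (List.ofFn fun a => (v a).val) = true ↔ w = v := by
  simp only [eqVec, List.all_eq_true, List.mem_range, Nat.beq_eq]
  constructor
  · intro h
    funext a
    have := h a a.2
    rw [at1_ofFn (fun a => (w a).val), at1_ofFn (fun a => (v a).val)] at this
    exact ZMod.val_injective q this
  · rintro rfl a ha
    rfl

theorem hasEntry_iff (H : Sketch k n q c) (v : Fin n → ZMod q) :
    hasEntry n (sketchList H) (List.ofFn fun a => (v a).val) = true ↔ ∃ i j, H i j = v := by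
  simp [hasEntry, sketchList, List.any_eq_true, List.mem_ofFn, eqVec_iff]

omit [NeZero q] in
theorem colList_eq (A : Matrix (Fin n) (Fin m) (ZMod q)) (x : Fin m) :
    colList n (matList A) x = List.ofFn fun a => (A.col x a).val := by
  rw [colList, tab_eq_ofFn]
  congr 1
  funext a
  exact at2_ofFn (fun a x => (A a x).val) a x

theorem negColList_eq (A : Matrix (Fin n) (Fin m) (ZMod q)) (x : Fin m) :
    negColList n q (matList A) x = List.ofFn fun a => ((-A.col x) a).val := by
  rw [negColList, tab_eq_ofFn]
  congr 1
  funext a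
  refine mod_eq_val ?_
  rw [cast_neg_mod]
  have := at2_ofFn (fun a x => (A a x).val) a x
  rw [matList, this]
  simp [Matrix.col]

theorem canPeel_iff (A : Matrix (Fin n) (Fin m) (ZMod q)) (H : Sketch k n q c) (x : Fin m) :
    canPeel n q (matList A) (sketchList H) x = true ↔ x ∈ (peelable A H).image Prod.fst := by
  rw [canPeel, Bool.or_eq_true, colList_eq, negColList_eq, hasEntry_iff, hasEntry_iff]
  simp only [peelable, Finset.mem_image, Finset.mem_filter, Finset.mem_univ, true_and, Prod.exists]
  constructor
  · rintro (⟨i, j, h⟩ | ⟨i, j, h⟩)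
    · exact ⟨x, _, ⟨⟨i, j, h⟩, .inl rfl⟩, rfl⟩
    · exact ⟨x, _, ⟨⟨i, j, h⟩, .inr rfl⟩, rfl⟩
  · rintro ⟨x, w, ⟨⟨i, j, h⟩, rfl | rfl⟩, rfl⟩
    · exact .inl ⟨i, j, h⟩
    · exact .inr ⟨i, j, h⟩

-- The peeled pairs form a set, so if `A eₓ = -A eₓ` this vector must be subtracted only once; hence
-- the inequality test in the second summand of `contrib`.
open Classical in
theorem cast_contrib (A : Matrix (Fin n) (Fin m) (ZMod q)) (H : Sketch k n q c) (x : Fin m)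
    (a : Fin n) : (contrib n q (matList A) (sketchList H) x a : ZMod q) =
      ∑ w with (x, w) ∈ peelable A H, w a := by
  have hA := at2_ofFn (fun a x => (A a x).val) a x
  have hset : ({w | (x, w) ∈ peelable A H} : Finset (Fin n → ZMod q)) =
      ({A.col x, -A.col x} : Finset _).filter fun w => ∃ i j, H i j = w := by
    ext w
    simp only [peelable, Finset.mem_filter, Finset.mem_univ, true_and, Finset.mem_insert,
      Finset.mem_singleton]
    tauto
  rw [hset, contrib, colList_eq, negColList_eq, Finset.sum_filter]
  change at2 (matList A) a x = _ at hA
  simp only [Bool.cond_eq_ite, Bool.and_eq_true, Bool.not_eq_true', ← Bool.not_eq_true,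
    hasEntry_iff, eqVec_iff, Nat.cast_add, Nat.cast_ite, hA, Nat.cast_zero, cast_neg_mod]
  rw [ZMod.natCast_zmod_val, show A a x = A.col x a from rfl]
  generalize A.col x = v
  by_cases h : v = -v
  · rw [← h, Finset.pair_eq_singleton, Finset.sum_singleton]
    simp
  · rw [Finset.sum_pair h]
    simp [h]

theorem stepList_eq (r : Fin k → Fin m → Fin c) (A : Matrix (Fin n) (Fin m) (ZMod q))
    (s : Sketch k n q c × Finset (Fin m)) :
    stepList k c n m q (tableList r) (matList A) (sketchList s.1, setList s.2) =
      (sketchList (peelStep r A s).1, setList (peelStep r A s).2) := by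
  classical
  refine Prod.ext ?_ ?_
  · simp only [stepList, tab_eq_ofFn]
    unfold sketchList
    congr 1; funext i; congr 1; funext j; congr 1; funext a
    refine mod_eq_val ?_
    have h1 := at3_ofFn (fun i j a => (s.1 i j a).val) i j a
    rw [List.sum_ofFn, h1]
    have h2 : ∀ x : Fin m, at2 (tableList r) i x = (r i x).val :=
      fun x => at2_ofFn (fun i x => (r i x).val) i x
    simp only [h2, Bool.cond_eq_ite, Nat.beq_eq, Nat.cast_add, Nat.cast_sum, Nat.cast_ite,
      cast_neg_mod, Nat.cast_zero, ZMod.natCast_val, ZMod.cast_id, peelStep, peel,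
      Pi.sub_apply, sub_eq_add_neg]
    congr 1
    rw [Finset.sum_apply, Finset.sum_filter, ← Finset.sum_neg_distrib]
    have h3 : ∀ x : Fin m, (contrib n q (matList A) (sketchList s.1) x a : ZMod q) =
      ∑ w with (x, w) ∈ peelable A s.1, w a := fun x => cast_contrib A s.1 x a
    unfold sketchList at h3
    simp only [h3]
    -- Writing the set as a filtered product turns the sum over pairs into a double sum, which
    -- matches the list algorithm's sum over `x` of the contributions of `x`.
    have h4 : peelable A s.1 = (Finset.univ ×ˢ Finset.univ).filter (· ∈ peelable A s.1) := by
      ext p; simp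
    rw [h4, Finset.sum_filter, Finset.sum_product]
    refine Finset.sum_congr rfl fun x _ => ?_
    by_cases hx : r i x = j
    · rw [if_pos (congrArg Fin.val hx), Finset.sum_filter, ← Finset.sum_neg_distrib]
      refine Finset.sum_congr rfl fun w _ => ?_
      by_cases hw : (x, w) ∈ peelable A s.1 <;> simp [hx, hw]
    · rw [if_neg fun h => hx (Fin.ext h)]
      simp [hx]
  · simp only [stepList, tab_eq_ofFn]
    unfold setList
    congr 1; funext x
    rw [at1_ofFn (fun x => if x ∈ s.2 then 1 else 0)]
    have := canPeel_iff A s.1 x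
    simp only [peelStep, Finset.mem_union, ← this]
    by_cases hx : x ∈ s.2 <;>
    cases canPeel n q (matList A) (sketchList s.1) x <;> simp [hx, Nat.beq]

end Correct

section

variable {γ : Type} [Enc γ]

namespace Poly

@[fun_prop]
theorem tab {α : Type} [Enc α] {n : γ → ℕ} {f : γ → ℕ → α} (hn : Poly n)
    (hf : Poly fun p : γ × ℕ => f p.1 p.2) : Poly fun e => tab (n e) (f e) :=
  map (range hn) hf

@[fun_prop]
theorem eqVec {n : γ → ℕ} {w v : γ → List ℕ} (hn : Poly n) (hw : Poly w) (hv : Poly v) :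
    Poly fun e => eqVec (n e) (w e) (v e) := by
  unfold RobustPPH.eqVec; fun_prop

@[fun_prop]
theorem hasEntry {n : γ → ℕ} {H : γ → List (List (List ℕ))} {v : γ → List ℕ} (hn : Poly n)
    (hH : Poly H) (hv : Poly v) : Poly fun e => hasEntry (n e) (H e) (v e) := by
  unfold RobustPPH.hasEntry; fun_prop

@[fun_prop]
theorem colList {n x : γ → ℕ} {A : γ → List (List ℕ)} (hn : Poly n) (hA : Poly A) (hx : Poly x) :
    Poly fun e => colList (n e) (A e) (x e) := by
  unfold RobustPPH.colList; fun_prop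

@[fun_prop]
theorem negColList {n q x : γ → ℕ} {A : γ → List (List ℕ)} (hn : Poly n) (hq : Poly q)
    (hA : Poly A) (hx : Poly x) : Poly fun e => negColList (n e) (q e) (A e) (x e) := by
  unfold RobustPPH.negColList; fun_prop

@[fun_prop]
theorem canPeel {n q x : γ → ℕ} {A : γ → List (List ℕ)} {H : γ → List (List (List ℕ))}
    (hn : Poly n) (hq : Poly q) (hA : Poly A) (hH : Poly H) (hx : Poly x) :
    Poly fun e => canPeel (n e) (q e) (A e) (H e) (x e) := by
  unfold RobustPPH.canPeel; fun_prop

@[fun_prop]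
theorem contrib {n q x a : γ → ℕ} {A : γ → List (List ℕ)} {H : γ → List (List (List ℕ))}
    (hn : Poly n) (hq : Poly q) (hA : Poly A) (hH : Poly H) (hx : Poly x) (ha : Poly a) :
    Poly fun e => contrib (n e) (q e) (A e) (H e) (x e) (a e) := by
  unfold RobustPPH.contrib; fun_prop

@[fun_prop]
theorem stepList {k c n m q : γ → ℕ} {rt A : γ → List (List ℕ)}
    {s : γ → List (List (List ℕ)) × List ℕ} (hk : Poly k) (hc : Poly c) (hn : Poly n)
    (hm : Poly m) (hq : Poly q) (hrt : Poly rt) (hA : Poly A) (hs : Poly s) :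
    Poly fun e => stepList (k e) (c e) (n e) (m e) (q e) (rt e) (A e) (s e) := by
  unfold RobustPPH.stepList; fun_prop

end Poly

theorem bits_tab_le {α : Type} [Enc α] {n : ℕ} {f : ℕ → α} {M : ℕ} (h : ∀ i, bits (f i) ≤ M) :
    bits (tab n f) ≤ n * (2 * M + 1) := by
  refine (bits_list_le (M := M) fun a ha => ?_).trans ?_
  · obtain ⟨i, _, rfl⟩ := List.mem_map.1 ha
    exact h i
  · simp [tab]

/-- The bound does not involve the state `s`: a round rebuilds tables of fixed dimensions with
entries reduced modulo `q`. Any number of rounds therefore stays short. -/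
theorem bits_stepList_le (k c n m q : ℕ) (hq : 0 < q) (rt A : List (List ℕ))
    (s : List (List (List ℕ)) × List ℕ) : bits (stepList k c n m q rt A s) ≤
      2 * (k * (2 * (c * (2 * (n * (2 * (q + 1) + 1)) + 1)) + 1) + m * (2 * 2 + 1)) + 2 := by
  refine (bits_pair_le _).trans (Nat.add_le_add_right (Nat.mul_le_mul_left 2 (add_le_add ?_ ?_)) 2)
  · refine bits_tab_le fun i => bits_tab_le fun j => bits_tab_le fun a => ?_
    rw [bits_nat]
    exact Nat.succ_le_succ (Nat.mod_lt _ hq).le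
  · refine bits_tab_le fun x => ?_
    rw [bits_nat]
    exact Nat.succ_le_succ (Bool.toNat_le _)

namespace Poly

theorem iterate_stepList {k c n m q N : γ → ℕ} {rt A : γ → List (List ℕ)}
    {s : γ → List (List (List ℕ)) × List ℕ} (hk : Poly k) (hc : Poly c) (hn : Poly n)
    (hm : Poly m) (hq : Poly q) (hrt : Poly rt) (hA : Poly A) (hs : Poly s) (hN : Poly N)
    (hpos : ∀ e, 0 < q e) :
    Poly fun e => (RobustPPH.stepList (k e) (c e) (n e) (m e) (q e) (rt e) (A e))^[N e] (s e) := by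
  refine iterate_of_le (f := fun e s => RobustPPH.stepList (k e) (c e) (n e) (m e) (q e) (rt e)
    (A e) s) hN hs (by fun_prop) (S := fun e => bits (s e) + (2 * (k e * (2 * (c e *
    (2 * (n e * (2 * (q e + 1) + 1)) + 1)) + 1) + m e * (2 * 2 + 1)) + 2))
    (hs.bits_le.add (nat_le (by fun_prop))) fun e i _ => ?_
  cases i with
  | zero => exact Nat.le_add_right _ _
  | succ i =>
    rw [Function.iterate_succ_apply']
    exact (bits_stepList_le _ _ _ _ _ (hpos e) _ _ _).trans (Nat.le_add_left _ _)

end Poly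

end

/-! ### Encoding -/

/-- Encoding of the set with indicator `s`. -/
def encodeList (k c n m q : ℕ) (rt A : List (List ℕ)) (s : List ℕ) : List (List (List ℕ)) :=
  tab k fun i => tab c fun j => tab n fun a =>
    (tab m fun x => bif Nat.beq (at1 s x) 1 && Nat.beq (at2 rt i x) j then at2 A a x else 0).sum % q

theorem encodeList_eq {k n m q c : ℕ} [NeZero q] (r : Fin k → Fin m → Fin c)
    (A : Matrix (Fin n) (Fin m) (ZMod q)) (X : Finset (Fin m)) :
    encodeList k c n m q (tableList r) (matList A) (setList X) =
      sketchList (sketchEncode r A X) := by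
  classical
  simp only [encodeList, tab_eq_ofFn]
  unfold sketchList
  congr 1; funext i; congr 1; funext j; congr 1; funext a
  refine mod_eq_val ?_
  have h1 : ∀ x : Fin m, at2 (tableList r) i x = (r i x).val :=
    fun x => at2_ofFn (fun i x => (r i x).val) i x
  have h2 : ∀ x : Fin m, at2 (matList A) a x = (A a x).val :=
    fun x => at2_ofFn (fun a x => (A a x).val) a x
  have h3 : ∀ x : Fin m, at1 (setList X) x = if x ∈ X then 1 else 0 :=
    fun x => at1_ofFn (fun x => if x ∈ X then 1 else 0) x
  rw [List.sum_ofFn, sketchEncode, Finset.sum_apply, Finset.sum_filter, Nat.cast_sum]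
  simp only [h1, h2, h3]
  rw [← Finset.sum_filter_add_sum_filter_not Finset.univ (· ∈ X), Finset.filter_univ_mem,
    Finset.sum_eq_zero (s := Finset.univ.filter (· ∉ X)), add_zero]
  · refine Finset.sum_congr rfl fun x hx => ?_
    by_cases h : r i x = j
    · simp [hx, h, Matrix.col]
    · have : Nat.beq (r i x).val j.val = false := by
        rw [← Bool.not_eq_true, Nat.beq_eq]
        exact fun h' => h (Fin.ext h')
      simp [h, this]
  · intro x hx
    simp [(Finset.mem_filter.1 hx).2, Nat.beq]

/-- Entrywise difference. -/
def subList (k c n q : ℕ) (G H : List (List (List ℕ))) : List (List (List ℕ)) :=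
  tab k fun i => tab c fun j => tab n fun a => (at3 G i j a + (q - at3 H i j a % q)) % q

theorem subList_eq {k n q c : ℕ} [NeZero q] (G H : Sketch k n q c) :
    subList k c n q (sketchList G) (sketchList H) = sketchList (G - H) := by
  simp only [subList, tab_eq_ofFn]
  unfold sketchList
  congr 1; funext i; congr 1; funext j; congr 1; funext a
  refine mod_eq_val ?_
  rw [at3_ofFn (fun i j a => (G i j a).val), at3_ofFn (fun i j a => (H i j a).val),
    Nat.cast_add, cast_neg_mod]
  simp [sub_eq_add_neg]

/-- The indicator of `{2i - xᵢ}`. -/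
def membList (l : ℕ) (x : List Bool) : List ℕ :=
  tab (2 * l) fun p => ((List.range l).any fun i =>
    Nat.beq (2 * i + 1 - (x.getD i false).toNat) p).toNat

theorem membList_eq {l : ℕ} (x : Fin l → Bool) :
    membList l (List.ofFn x) = setList (bitsToSet x) := by
  classical
  simp only [membList, tab_eq_ofFn]
  unfold setList
  congr 1; funext p
  have : ((List.range l).any fun i =>
      Nat.beq (2 * i + 1 - ((List.ofFn x).getD i false).toNat) p) = true ↔ p ∈ bitsToSet x := by
    rw [List.any_eq_true]
    simp only [List.mem_range, Nat.beq_eq, bitsToSet, Finset.mem_image, Finset.mem_univ, true_and,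
      Fin.ext_iff]
    constructor
    · rintro ⟨i, hi, h⟩
      rw [getD_ofFn x false ⟨i, hi⟩] at h
      exact ⟨⟨i, hi⟩, h⟩
    · rintro ⟨i, h⟩
      exact ⟨i, i.2, by rwa [getD_ofFn x false i]⟩
  by_cases h : p ∈ bitsToSet x
  · rw [if_pos h, this.2 h]; rfl
  · rw [if_neg h, Bool.eq_false_iff.2 fun h' => h (this.1 h')]; rfl

section

variable {γ : Type} [Enc γ]

namespace Poly

@[fun_prop]
theorem encodeList {k c n m q : γ → ℕ} {rt A : γ → List (List ℕ)} {s : γ → List ℕ} (hk : Poly k)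
    (hc : Poly c) (hn : Poly n) (hm : Poly m) (hq : Poly q) (hrt : Poly rt) (hA : Poly A)
    (hs : Poly s) :
    Poly fun e => encodeList (k e) (c e) (n e) (m e) (q e) (rt e) (A e) (s e) := by
  unfold RobustPPH.encodeList; fun_prop

@[fun_prop]
theorem subList {k c n q : γ → ℕ} {G H : γ → List (List (List ℕ))} (hk : Poly k)
    (hc : Poly c) (hn : Poly n) (hq : Poly q) (hG : Poly G) (hH : Poly H) :
    Poly fun e => subList (k e) (c e) (n e) (q e) (G e) (H e) := by
  unfold RobustPPH.subList; fun_prop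

@[fun_prop]
theorem membList {l : γ → ℕ} {x : γ → List Bool} (hl : Poly l) (hx : Poly x) :
    Poly fun e => membList (l e) (x e) := by
  unfold RobustPPH.membList; fun_prop

end Poly

end

/-! ### Hashing and evaluation are efficient -/

section Scheme

variable {ℓ t : ℕ → ℕ} {R : FunctionFamily (fun κ => 2 * ℓ κ) fun κ => 2 * (2 * t κ)}

theorem EfficientParam.poly {a : ℕ → ℕ} (ha : EfficientParam a) : Poly a := ha

theorem modulus_poly (hℓ : Poly ℓ) : Poly (modulus ℓ) := by
  unfold modulus; fun_prop

/-- Forgetting the bounds of the `Fin` types gives a total function on numbers, which fits the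
`Poly` calculus; its values outside the universe are irrelevant. -/
theorem FunctionFamily.IsEfficient.exists_poly {m c : ℕ → ℕ} {R : FunctionFamily m c}
    (hR : R.IsEfficient) : ∃ ρ : ℕ × (Raw × ℕ) → ℕ, Poly ρ ∧
      ∀ κ r (x : Fin (m κ)), ρ (κ, (⟨r⟩, x)) = R.eval κ r x := by
  obtain ⟨F, hF, h⟩ := hR.eval
  refine ⟨fun p => (F (Enc.enc p)).headD 0, ⟨_, PolyTime.head_polyTime.comp hF, fun _ => rfl⟩,
    fun κ r x => ?_⟩
  have : F (Enc.enc (κ, (Raw.mk r, x.val))) = [(R.eval κ r x).val] := h κ r x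
  dsimp only
  rw [this]
  rfl

/-- The table of the functions with keys `rs`. -/
def keyTable (ρ : ℕ × (Raw × ℕ) → ℕ) (κ m : ℕ) (rs : List Raw) : List (List ℕ) :=
  rs.map fun r => tab m fun x => ρ (κ, (r, x))

@[fun_prop]
theorem Poly.keyTable {γ : Type} [Enc γ] {ρ : ℕ × (Raw × ℕ) → ℕ} {κ m : γ → ℕ} {rs : γ → List Raw}
    (hρ : Poly ρ) (hκ : Poly κ) (hm : Poly m) (hrs : Poly rs) :
    Poly fun e => keyTable ρ (κ e) (m e) (rs e) := by
  unfold RobustPPH.keyTable; fun_prop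

theorem keyTable_eq {ρ : ℕ × (Raw × ℕ) → ℕ} {m c : ℕ → ℕ} {R : FunctionFamily m c}
    (hρ : ∀ κ r (x : Fin (m κ)), ρ (κ, (⟨r⟩, x)) = R.eval κ r x) (κ k : ℕ) (r : Fin k → List ℕ) :
    keyTable ρ κ (m κ) (List.ofFn fun i => ⟨r i⟩) = tableList fun i => R.eval κ (r i) := by
  simp only [keyTable, tableList, List.map_ofFn, tab_eq_ofFn, Function.comp_def, hρ]

/-- The typed form of a key. -/
def keyList {k n m q : ℕ} (h : (Fin k → List ℕ) × Matrix (Fin n) (Fin m) (ZMod q)) :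
    List Raw × List (List ℕ) := (List.ofFn fun i => ⟨h.1 i⟩, matList h.2)

theorem enc_matList {n m q : ℕ} [NeZero q] (A : Matrix (Fin n) (Fin m) (ZMod q)) :
    ((Code.zmod q).mat n m).enc A = Enc.enc (matList A) := by
  simp only [matList, enc_ofFn]
  rfl

theorem enc_keyList {k n m q : ℕ} [NeZero q]
    (h : (Fin k → List ℕ) × Matrix (Fin n) (Fin m) (ZMod q)) :
    ((Code.list.vec k).prod ((Code.zmod q).mat n m)).enc h = Enc.enc (keyList h) := by
  change pack [_, _] = pack [_, _]
  rw [enc_matList]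
  simp only [keyList, enc_ofFn]
  rfl

theorem enc_sketchList {k n q c : ℕ} [NeZero q] (H : Sketch k n q c) :
    ((((Code.zmod q).vec n).vec c).vec k).enc H = Enc.enc (sketchList H) := by
  simp only [sketchList, enc_ofFn]
  rfl

theorem enc_boolVec {l : ℕ} (x : Fin l → Bool) :
    (Code.bool.vec l).enc x = Enc.enc (List.ofFn x) := by
  simp only [enc_ofFn]
  rfl

/-- The keys of the hash family. -/
abbrev SisKey (ℓ : ℕ → ℕ) (κ : ℕ) : Type :=
  (Fin κ → List ℕ) × Matrix (Fin κ) (Fin (2 * ℓ κ)) (ZMod (modulus ℓ κ))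

/-- The hash values of the hash family. -/
abbrev SisImg (ℓ t : ℕ → ℕ) (κ : ℕ) : Type := Sketch κ κ (modulus ℓ κ) (2 * (2 * t κ))

def hashList (ℓ t : ℕ → ℕ) (ρ : ℕ × (Raw × ℕ) → ℕ)
    (p : ℕ × ((List Raw × List (List ℕ)) × List Bool)) : List (List (List ℕ)) :=
  encodeList p.1 (2 * (2 * t p.1)) p.1 (2 * ℓ p.1) (modulus ℓ p.1)
    (keyTable ρ p.1 (2 * ℓ p.1) p.2.1.1) p.2.1.2 (membList (ℓ p.1) p.2.2)

theorem hashList_poly {ρ : ℕ × (Raw × ℕ) → ℕ} (hℓ : Poly ℓ) (ht : Poly t) (hρ : Poly ρ) :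
    Poly (hashList ℓ t ρ) := by
  have := modulus_poly hℓ
  unfold hashList
  fun_prop

theorem hashList_eq {ρ : ℕ × (Raw × ℕ) → ℕ}
    (hρ : ∀ κ r (x : Fin (2 * ℓ κ)), ρ (κ, (⟨r⟩, x)) = R.eval κ r x) (κ : ℕ)
    (h : SisKey ℓ κ) (x : Fin (ℓ κ) → Bool) :
    hashList ℓ t ρ (κ, (keyList h, List.ofFn x)) =
      sketchList (k := κ) (n := κ) (q := modulus ℓ κ) (c := 2 * (2 * t κ))
        ((sisHammingPPH ℓ t R).hash κ h x) := by
  simp only [hashList, keyList]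
  rw [keyTable_eq (m := fun κ => 2 * ℓ κ) hρ, membList_eq, encodeList_eq]
  rfl

/-- The state of the decoder after `N` rounds. -/
def peelState (ℓ t : ℕ → ℕ) (ρ : ℕ × (Raw × ℕ) → ℕ) (N κ : ℕ) (h : List Raw × List (List ℕ))
    (y : List (List (List ℕ)) × List (List (List ℕ))) : List (List (List ℕ)) × List ℕ :=
  (stepList κ (2 * (2 * t κ)) κ (2 * ℓ κ) (modulus ℓ κ) (keyTable ρ κ (2 * ℓ κ) h.1) h.2)^[N]
    (subList κ (2 * (2 * t κ)) κ (modulus ℓ κ) y.1 y.2, tab (2 * ℓ κ) fun _ => 0)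

@[fun_prop]
theorem Poly.peelState {γ : Type} [Enc γ] {ρ : ℕ × (Raw × ℕ) → ℕ} {N κ : γ → ℕ}
    {h : γ → List Raw × List (List ℕ)} {y : γ → List (List (List ℕ)) × List (List (List ℕ))}
    (hℓ : Poly ℓ) (ht : Poly t) (hρ : Poly ρ) (hN : Poly N) (hκ : Poly κ) (hh : Poly h)
    (hy : Poly y) : Poly fun e => peelState ℓ t ρ (N e) (κ e) (h e) (y e) := by
  have := modulus_poly hℓ
  unfold RobustPPH.peelState
  exact iterate_stepList (by fun_prop) (by fun_prop) (by fun_prop) (by fun_prop) (by fun_prop)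
    (by fun_prop) (by fun_prop) (by fun_prop) (by fun_prop) fun e => NeZero.pos _

theorem peelState_eq {ρ : ℕ × (Raw × ℕ) → ℕ}
    (hρ : ∀ κ r (x : Fin (2 * ℓ κ)), ρ (κ, (⟨r⟩, x)) = R.eval κ r x) (κ N : ℕ)
    (h : SisKey ℓ κ) (y₀ y₁ : SisImg ℓ t κ) :
    peelState ℓ t ρ N κ (keyList h) (sketchList y₀, sketchList y₁) =
      (sketchList ((peelStep (fun i => R.eval κ (h.1 i)) h.2)^[N] (y₀ - y₁, ∅)).1,
        setList ((peelStep (fun i => R.eval κ (h.1 i)) h.2)^[N] (y₀ - y₁, ∅)).2) := by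
  rw [peelState]
  induction N with
  | zero =>
    refine Prod.ext (subList_eq y₀ y₁) ?_
    simp [tab_eq_ofFn, setList]
  | succ N ih =>
    rw [Function.iterate_succ_apply', Function.iterate_succ_apply', ih, keyList,
      keyTable_eq (m := fun κ => 2 * ℓ κ) hρ, stepList_eq]

/-- The three disjuncts are the three reasons for answering 1: peeling has not stopped, a nonzero
sketch remains, or the decoded set is large. -/
def evalList (ℓ t : ℕ → ℕ) (ρ : ℕ × (Raw × ℕ) → ℕ) (p : ℕ × ((List Raw × List (List ℕ)) ×
    (List (List (List ℕ)) × List (List (List ℕ))))) : Bool :=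
  ((List.range (2 * ℓ p.1)).any fun x => canPeel p.1 (modulus ℓ p.1) p.2.1.2
    (peelState ℓ t ρ (2 * ℓ p.1) p.1 p.2.1 p.2.2).1 x) ||
  (!(peelState ℓ t ρ (2 * ℓ p.1) p.1 p.2.1 p.2.2).1.all fun row => row.all fun w =>
    w.all fun a => Nat.beq a 0) ||
  Nat.ble (2 * t p.1) (peelState ℓ t ρ (2 * ℓ p.1) p.1 p.2.1 p.2.2).2.sum

theorem evalList_poly {ρ : ℕ × (Raw × ℕ) → ℕ} (hℓ : Poly ℓ) (ht : Poly t) (hρ : Poly ρ) :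
    Poly (evalList ℓ t ρ) := by
  have := modulus_poly hℓ
  unfold evalList
  fun_prop

theorem evalList_eq {ρ : ℕ × (Raw × ℕ) → ℕ}
    (hρ : ∀ κ r (x : Fin (2 * ℓ κ)), ρ (κ, (⟨r⟩, x)) = R.eval κ r x) (κ : ℕ)
    (h : SisKey ℓ κ) (y₀ y₁ : SisImg ℓ t κ) :
    evalList ℓ t ρ (κ, (keyList h, (sketchList y₀, sketchList y₁))) =
      (sisHammingPPH ℓ t R).eval κ h y₀ y₁ := by
  classical
  rw [evalList]
  simp only [peelState_eq hρ]
  have hdec : (sisHammingPPH ℓ t R).eval κ h y₀ y₁ =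
    match sketchDecode (fun i => R.eval κ (h.1 i)) h.2 y₀ y₁ with
    | none => true
    | some X' => decide (2 * t κ ≤ X'.card) := rfl
  rw [hdec, sketchDecode_eq]
  generalize (peelStep (fun i => R.eval κ (h.1 i)) h.2)^[2 * ℓ κ] (y₀ - y₁, ∅) = s
  have h1 : ((List.range (2 * ℓ κ)).any fun x => canPeel κ (modulus ℓ κ) (matList h.2)
      (sketchList s.1) x) = true ↔ peelable h.2 s.1 ≠ ∅ := by
    rw [List.any_eq_true, ← Finset.nonempty_iff_ne_empty, ← Finset.image_nonempty (f := Prod.fst)]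
    constructor
    · rintro ⟨x, hx, hx'⟩
      exact ⟨⟨x, List.mem_range.1 hx⟩, (canPeel_iff h.2 s.1 ⟨x, List.mem_range.1 hx⟩).1 hx'⟩
    · rintro ⟨x, hx⟩
      exact ⟨x, List.mem_range.2 x.2, (canPeel_iff h.2 s.1 x).2 hx⟩
  have h2 : ((sketchList s.1).all fun row => row.all fun w => w.all fun a => Nat.beq a 0) = true ↔
      s.1 = 0 := by
    simp only [sketchList, List.all_eq_true, List.mem_ofFn, forall_exists_index,
      forall_apply_eq_imp_iff, Nat.beq_eq, ZMod.val_eq_zero]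
    exact ⟨fun h => by funext i j a; exact h i j a, fun h i j a => by rw [h]; rfl⟩
  have h3 : (setList s.2).sum = s.2.card := by
    rw [setList, List.sum_ofFn]
    simp
  rw [h3, keyList]
  by_cases hZ : peelable h.2 s.1 = ∅
  · have h1' := Bool.eq_false_iff.2 fun h' => h1.1 h' hZ
    by_cases h0 : s.1 = 0
    · rw [h1', h2.2 h0, if_pos ⟨hZ, h0⟩, Bool.eq_iff_iff]
      simp [Nat.ble_eq]
    · rw [h1', Bool.eq_false_iff.2 fun h' => h0 (h2.1 h'), if_neg fun h => h0 h.2]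
      rfl
  · rw [h1.2 hZ, if_neg fun h => hZ h.1]
    rfl

end Scheme

/-! ### Correctness of decoding -/

section Decode

variable {k n m q c : ℕ}

/-- The sketch of a signed set. -/
def signedSketch (r : Fin k → Fin m → Fin c) (A : Matrix (Fin n) (Fin m) (ZMod q))
    (D : Fin m → ℤ) : Sketch k n q c :=
  fun i j => A.mulVec fun x => if r i x = j then (D x : ZMod q) else 0

/-- The signed indicator of the symmetric difference. -/
def signedDiff (X₀ X₁ : Finset (Fin m)) (x : Fin m) : ℤ :=
  (if x ∈ X₀ then 1 else 0) - if x ∈ X₁ then 1 else 0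

/-- `D` outside `X`. -/
def restrictOff (D : Fin m → ℤ) (X : Finset (Fin m)) (x : Fin m) : ℤ := if x ∈ X then 0 else D x

/-- The difference between the part of `D` in a cell and a multiple of a unit vector. -/
def cellVec (r : Fin k → Fin m → Fin c) (D : Fin m → ℤ) (i : Fin k) (j : Fin c) (x : Fin m)
    (d : ℤ) (y : Fin m) : ℤ :=
  (if r i y = j then D y else 0) - if y = x then d else 0

/-- The matrix has no kernel vectors of the form `cellVec`. -/
def NoCollision (r : Fin k → Fin m → Fin c) (A : Matrix (Fin n) (Fin m) (ZMod q))
    (D : Fin m → ℤ) : Prop :=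
  ∀ i j x, ∀ d : ℤ, d = 0 ∨ d = 1 ∨ d = -1 →
    A.mulVec (fun y => (cellVec r D i j x d y : ZMod q)) = 0 → cellVec r D i j x d = 0

/-- Some row isolates an element of every nonempty set of at most `T` elements. -/
def Isolating (r : Fin k → Fin m → Fin c) (T : ℕ) : Prop :=
  ∀ S : Finset (Fin m), S.Nonempty → S.card ≤ T → ∃ i, ∃ x ∈ S, ∀ y ∈ S, r i y = r i x → y = x

theorem mulVec_eq_sum_col (A : Matrix (Fin n) (Fin m) (ZMod q)) (v : Fin m → ZMod q) :
    A.mulVec v = ∑ x, v x • A.col x := by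
  funext a
  simp [Matrix.mulVec, dotProduct, Matrix.col, mul_comm]

/-- This translates equalities seen by the decoder into kernel vectors: a cell has content `d • A
eₓ` exactly when `A` annihilates the integer vector `cellVec`. -/
theorem mulVec_cellVec (r : Fin k → Fin m → Fin c) (A : Matrix (Fin n) (Fin m) (ZMod q))
    (D : Fin m → ℤ) (i j x d) : A.mulVec (fun y => (cellVec r D i j x d y : ZMod q)) =
      signedSketch r A D i j - (d : ZMod q) • A.col x := by
  rw [signedSketch, mulVec_eq_sum_col, mulVec_eq_sum_col]
  simp only [cellVec, Int.cast_sub, Int.cast_ite, Int.cast_zero, sub_smul, ite_smul, zero_smul,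
    Finset.sum_sub_distrib, Finset.sum_ite_eq', Finset.mem_univ, if_true]

/-- Encoding is linear in the indicator of the set, so common elements cancel. -/
theorem sketchEncode_sub (r : Fin k → Fin m → Fin c) (A : Matrix (Fin n) (Fin m) (ZMod q))
    (X₀ X₁ : Finset (Fin m)) : sketchEncode r A X₀ - sketchEncode r A X₁ =
      signedSketch r A (signedDiff X₀ X₁) := by
  have h : ∀ X : Finset (Fin m), ∀ i j, sketchEncode r A X i j =
      ∑ x, if r i x = j then (if x ∈ X then (1 : ZMod q) else 0) • A.col x else 0 := by
    intro X i j
    rw [sketchEncode, Finset.sum_filter, ← Finset.sum_filter_add_sum_filter_not Finset.univ (· ∈ X),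
      Finset.filter_univ_mem, Finset.sum_eq_zero (s := Finset.univ.filter (· ∉ X)), add_zero]
    · refine Finset.sum_congr rfl fun x hx => ?_
      rw [if_pos hx, one_smul]
    · intro x hx
      rw [if_neg (Finset.mem_filter.1 hx).2]
      simp
  funext i j
  rw [Pi.sub_apply, Pi.sub_apply, h, h, signedSketch, mulVec_eq_sum_col,
    ← Finset.sum_sub_distrib]
  refine Finset.sum_congr rfl fun x _ => ?_
  by_cases hx : r i x = j
  · simp only [hx, if_true, ← sub_smul, signedDiff]
    push_cast
    rfl
  · simp [hx]

variable [NeZero q] {r : Fin k → Fin m → Fin c} {A : Matrix (Fin n) (Fin m) (ZMod q)}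
  {D : Fin m → ℤ}

/-- If a cell equals `d • A eₓ` with `d = ±1`, the absence of collisions forces equality of integer
vectors. Coordinate `x` then reads `D x = d`; were `x` not hashed to this cell, it would read `0 =
d`. -/
theorem NoCollision.of_mem_peelable (h : NoCollision r A D) {p : Fin m × (Fin n → ZMod q)}
    (hp : p ∈ peelable A (signedSketch r A D)) :
    (D p.1 = 1 ∨ D p.1 = -1) ∧ p.2 = (D p.1 : ZMod q) • A.col p.1 := by
  obtain ⟨x, w⟩ := p
  simp only [peelable, Finset.mem_filter, Finset.mem_univ, true_and] at hp
  obtain ⟨⟨i, j, hw⟩, hw'⟩ := hp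
  obtain ⟨d, hd, hwd⟩ : ∃ d : ℤ, (d = 1 ∨ d = -1) ∧ w = (d : ZMod q) • A.col x := by
    rcases hw' with hw' | hw'
    · exact ⟨1, .inl rfl, by simp [hw']⟩
    · exact ⟨-1, .inr rfl, by simp [hw']⟩
  have h0 := h i j x d (.inr hd) (by rw [mulVec_cellVec, hw, hwd, sub_self])
  have hx := congrFun h0 x
  have hd0 : d ≠ 0 := by rcases hd with rfl | rfl <;> decide
  simp only [cellVec, if_true, Pi.zero_apply, sub_eq_zero] at hx
  have : D x = d := by
    by_cases hr : r i x = j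
    · rwa [if_pos hr] at hx
    · rw [if_neg hr] at hx
      exact absurd hx.symm hd0
  exact ⟨this ▸ hd, this ▸ hwd⟩

/-- Every peeled vector is determined by its element, being `D x • A eₓ`. So no element is peeled
twice in one round, and the subtraction removes exactly its share from each cell. -/
theorem NoCollision.peel_eq (h : NoCollision r A D) :
    peel r (signedSketch r A D) (peelable A (signedSketch r A D)) =
      signedSketch r A
        (restrictOff D ((peelable A (signedSketch r A D)).image Prod.fst)) := by
  classical
  funext i j
  set Z := peelable A (signedSketch r A D) with hZ
  have hsum : ∑ p ∈ Z with r i p.1 = j, p.2 =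
      ∑ x ∈ Z.image Prod.fst, if r i x = j then (D x : ZMod q) • A.col x else 0 := by
    rw [Finset.sum_image, Finset.sum_filter]
    · refine Finset.sum_congr rfl fun p hp => ?_
      rw [(h.of_mem_peelable hp).2]
    · intro p hp p' hp' e
      refine Prod.ext e ?_
      rw [(h.of_mem_peelable hp).2, (h.of_mem_peelable hp').2, e]
  rw [peel, hsum, signedSketch, signedSketch, mulVec_eq_sum_col, mulVec_eq_sum_col,
    ← Finset.sum_filter_add_sum_filter_not Finset.univ (· ∈ Z.image Prod.fst) fun x =>
      (if r i x = j then (D x : ZMod q) else 0) • A.col x,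
    ← Finset.sum_filter_add_sum_filter_not Finset.univ (· ∈ Z.image Prod.fst) fun x =>
      (if r i x = j then (restrictOff D (Z.image Prod.fst) x : ZMod q) else 0) • A.col x,
    Finset.filter_univ_mem]
  rw [Finset.sum_eq_zero (s := Z.image Prod.fst) (f := fun x =>
      (if r i x = j then (restrictOff D (Z.image Prod.fst) x : ZMod q) else 0) • A.col x)
    (fun x hx => by simp only [restrictOff, hx, if_true]; simp), zero_add]
  have h1 : ∑ x ∈ Z.image Prod.fst, (if r i x = j then (D x : ZMod q) • A.col x else 0) =
      ∑ x ∈ Z.image Prod.fst, (if r i x = j then (D x : ZMod q) else 0) • A.col x :=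
    Finset.sum_congr rfl fun x _ => by split <;> simp
  rw [h1, add_sub_cancel_left]
  refine Finset.sum_congr rfl fun x hx => ?_
  rw [restrictOff, if_neg (Finset.mem_filter.1 hx).2]

theorem restrictOff_union (X Y : Finset (Fin m)) :
    restrictOff (restrictOff D X) Y = restrictOff D (X ∪ Y) := by
  funext x
  by_cases hx : x ∈ X <;> by_cases hy : x ∈ Y <;> simp [restrictOff, hx, hy]

/-- The set peeled after `N` rounds. -/
def peeledSet (r : Fin k → Fin m → Fin c) (A : Matrix (Fin n) (Fin m) (ZMod q)) (D : Fin m → ℤ)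
    (N : ℕ) : Finset (Fin m) := ((peelStep r A)^[N] (signedSketch r A D, ∅)).2

/-- The loop invariant. It holds after `N` rounds as soon as the states before these rounds are free
of collisions, so nothing is assumed about the last state. -/
theorem peelStep_iterate {M : ℕ}
    (h : ∀ N < M, NoCollision r A (restrictOff D (peeledSet r A D N))) (N : ℕ) (hN : N ≤ M) :
    ((peelStep r A)^[N] (signedSketch r A D, ∅)).1 =
        signedSketch r A (restrictOff D (peeledSet r A D N)) ∧
      ∀ x ∈ peeledSet r A D N, D x ≠ 0 := by
  induction N with
  | zero =>
    have : restrictOff D (peeledSet r A D 0) = D := by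
      funext x
      simp [peeledSet, restrictOff]
    exact ⟨by rw [this]; rfl, by simp [peeledSet]⟩
  | succ N ih =>
    obtain ⟨h1, h2⟩ := ih (by omega)
    have hc := h N (by omega)
    have h3 : peeledSet r A D (N + 1) = peeledSet r A D N ∪
        (peelable A (signedSketch r A (restrictOff D (peeledSet r A D N)))).image Prod.fst := by
      rw [← h1, peeledSet, Function.iterate_succ_apply']
      rfl
    constructor
    · rw [Function.iterate_succ_apply', peelStep]
      dsimp only
      rw [h1, hc.peel_eq, restrictOff_union, h3]
    · intro x hx
      rw [h3, Finset.mem_union] at hx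
      rcases hx with hx | hx
      · exact h2 x hx
      · obtain ⟨p, hp, rfl⟩ := Finset.mem_image.1 hx
        have := (hc.of_mem_peelable hp).1
        rw [restrictOff] at this
        intro h0
        rw [h0] at this
        split at this <;> simp at this

/-- If decoding succeeds, it returns the symmetric difference. -/
theorem peeledSet_eq_of_sketch_eq_zero
    (h : ∀ N ≤ m, NoCollision r A (restrictOff D (peeledSet r A D N))) (hk : 0 < k)
    (h0 : ((peelStep r A)^[m] (signedSketch r A D, ∅)).1 = 0) (x : Fin m) :
    x ∈ peeledSet r A D m ↔ D x ≠ 0 := by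
  obtain ⟨h1, h2⟩ := peelStep_iterate (M := m) (fun N hN => h N hN.le) m le_rfl
  refine ⟨h2 x, fun hx => ?_⟩
  by_contra hxm
  -- Here the case `d = 0` of a collision is used: an unpeeled `x` in the support lies in a cell
  -- with content 0. Row 0 exists because `k` is positive.
  have h3 := h m le_rfl ⟨0, hk⟩ (r ⟨0, hk⟩ x) x 0 (.inl rfl) (by
    rw [mulVec_cellVec, ← h1, h0]
    simp)
  have h4 := congrFun h3 x
  simp [cellVec, restrictOff, hxm] at h4
  exact hx h4

/-- Decoding of small differences succeeds. -/
theorem peel_of_isolating {T : ℕ} (hD : ∀ x, D x = 0 ∨ D x = 1 ∨ D x = -1)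
    (h : ∀ N ≤ m, NoCollision r A (restrictOff D (peeledSet r A D N)))
    (hr : Isolating r T) (hT : (Finset.univ.filter fun x => D x ≠ 0).card ≤ T) :
    peelable A ((peelStep r A)^[m] (signedSketch r A D, ∅)).1 = ∅ ∧
      ((peelStep r A)^[m] (signedSketch r A D, ∅)).1 = 0 ∧
      peeledSet r A D m = Finset.univ.filter fun x => D x ≠ 0 := by
  classical
  set S := Finset.univ.filter fun x => D x ≠ 0 with hS
  have hinv := peelStep_iterate (M := m) (fun N hN => h N hN.le)
  have hsub : ∀ N ≤ m, peeledSet r A D N ⊆ S := fun N hN x hx => by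
    simpa [hS] using (hinv N hN).2 x hx
  -- An isolated element of the unpeeled support is alone in its cell, so that cell contains `±A eₓ`
  -- and the next round peels it.
  have hgrow : ∀ N < m, peeledSet r A D N ≠ S →
      (peeledSet r A D N).card < (peeledSet r A D (N + 1)).card := by
    intro N hN hne
    obtain ⟨i, x, hx, hxu⟩ := hr (S \ peeledSet r A D N)
      (Finset.sdiff_nonempty.2 fun h' => hne ((hsub N hN.le).antisymm h'))
      ((Finset.card_le_card Finset.sdiff_subset).trans hT)
    rw [Finset.mem_sdiff] at hx
    have hcell : signedSketch r A (restrictOff D (peeledSet r A D N)) i (r i x) =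
        (D x : ZMod q) • A.col x := by
      rw [signedSketch, mulVec_eq_sum_col, Finset.sum_eq_single x]
      · simp [restrictOff, hx.2]
      · intro y _ hy
        by_cases hyr : r i y = r i x
        · have : restrictOff D (peeledSet r A D N) y = 0 := by
            by_contra h0
            refine hy (hxu y ?_ hyr)
            rw [restrictOff] at h0
            rw [Finset.mem_sdiff]
            split at h0
            · exact absurd rfl h0
            · rename_i hy'
              exact ⟨by simpa [hS] using h0, hy'⟩
          simp [this]
        · simp [hyr]
      · simp
    have hmem : x ∈ (peelable A (signedSketch r A
        (restrictOff D (peeledSet r A D N)))).image Prod.fst := by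
      refine Finset.mem_image.2 ⟨(x, (D x : ZMod q) • A.col x), ?_, rfl⟩
      simp only [peelable, Finset.mem_filter, Finset.mem_univ, true_and]
      refine ⟨⟨i, r i x, hcell⟩, ?_⟩
      have hx0 : D x ≠ 0 := by simpa [hS] using hx.1
      rcases hD x with h' | h' | h'
      · exact absurd h' hx0
      · simp [h']
      · simp [h']
    have h3 : peeledSet r A D (N + 1) = peeledSet r A D N ∪
        (peelable A (signedSketch r A (restrictOff D (peeledSet r A D N)))).image Prod.fst := by
      rw [← (hinv N hN.le).1, peeledSet, Function.iterate_succ_apply']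
      rfl
    rw [h3]
    exact Finset.card_lt_card ((Finset.ssubset_iff_of_subset Finset.subset_union_left).2
      ⟨x, Finset.mem_union_right _ hmem, hx.2⟩)
  have hmono : ∀ N, peeledSet r A D N ⊆ peeledSet r A D (N + 1) := by
    intro N
    rw [peeledSet, peeledSet, Function.iterate_succ_apply']
    exact Finset.subset_union_left
  -- One new element per round until the support is exhausted; since the support has at most `m`
  -- elements, `m` rounds are enough.
  have hcard : ∀ N ≤ m, min N S.card ≤ (peeledSet r A D N).card := by
    intro N
    induction N with
    | zero => simp
    | succ N ih =>
      intro hN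
      have h1 := ih (by omega)
      by_cases hne : peeledSet r A D N = S
      · have h2 := Finset.card_le_card (hmono N)
        rw [hne] at h2
        exact (min_le_right _ _).trans h2
      · have h2 := hgrow N (by omega) hne
        omega
  have hSm : S.card ≤ m := by
    simpa using Finset.card_le_univ S
  have heq : peeledSet r A D m = S :=
    Finset.eq_of_subset_of_card_le (hsub m le_rfl) (by
      have := hcard m le_rfl
      omega)
  have hzero : restrictOff D (peeledSet r A D m) = 0 := by
    funext x
    rw [restrictOff, heq]
    by_cases hx : D x = 0 <;> simp [hS, hx]
  refine ⟨?_, ?_, heq⟩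
  -- Even the zero sketch could be peelable if `A` had a zero column; this too would be a collision,
  -- in the final state.
  · refine Finset.eq_empty_of_forall_notMem fun p hp => ?_
    rw [(hinv m le_rfl).1] at hp
    have := ((h m le_rfl).of_mem_peelable hp).1
    rw [hzero] at this
    simp at this
  · rw [(hinv m le_rfl).1, hzero]
    funext i j
    simp [signedSketch, mulVec_eq_sum_col]

end Decode

/-! ### The sets of bit strings -/

theorem mem_bitsToSet {l : ℕ} (x : Fin l → Bool) (p : Fin (2 * l)) :
    p ∈ bitsToSet x ↔ (x ⟨p / 2, by omega⟩).toNat = 1 - p % 2 := by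
  simp only [bitsToSet, Finset.mem_image, Finset.mem_univ, true_and, Fin.ext_iff]
  constructor
  · rintro ⟨i, h⟩
    have hi : (⟨p / 2, by omega⟩ : Fin l) = i := by
      apply Fin.ext
      have := Bool.toNat_le (x i)
      simp only
      omega
    rw [hi]
    have := Bool.toNat_le (x i)
    omega
  · intro h
    exact ⟨⟨p / 2, by omega⟩, by simp only [h]; omega⟩

theorem signedDiff_bitsToSet {l : ℕ} (x y : Fin l → Bool) (p : Fin (2 * l)) :
    signedDiff (bitsToSet x) (bitsToSet y) p ≠ 0 ↔ x ⟨p / 2, by omega⟩ ≠ y ⟨p / 2, by omega⟩ := by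
  rw [signedDiff]
  simp only [mem_bitsToSet]
  have : (p : ℕ) % 2 = 0 ∨ (p : ℕ) % 2 = 1 := by omega
  rcases this with h | h <;> rw [h] <;>
  cases x ⟨p / 2, by omega⟩ <;> cases y ⟨p / 2, by omega⟩ <;> simp

/-- If the strings differ at `i`, one set contains `2i` and the other `2i + 1`; otherwise both
contain the same one of the two. So each differing position counts twice. -/
theorem card_signedDiff_bitsToSet {l : ℕ} (x y : Fin l → Bool) :
    (Finset.univ.filter fun p => signedDiff (bitsToSet x) (bitsToSet y) p ≠ 0).card =
      2 * hammingDist x y := by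
  have : (Finset.univ.filter fun p => signedDiff (bitsToSet x) (bitsToSet y) p ≠ 0) =
      ((Finset.univ.filter fun i => x i ≠ y i) ×ˢ (Finset.univ : Finset (Fin 2))).image
        fun p => (⟨2 * p.1 + p.2, by omega⟩ : Fin (2 * l)) := by
    ext p
    simp only [Finset.mem_filter, Finset.mem_univ, true_and, signedDiff_bitsToSet,
      Finset.mem_image, Finset.mem_product, and_true, Prod.exists, Fin.ext_iff]
    constructor
    · intro h
      exact ⟨⟨p / 2, by omega⟩, ⟨p % 2, by omega⟩, h, by simp only; omega⟩
    · rintro ⟨i, b, h, hp⟩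
      have hi : (⟨p / 2, by omega⟩ : Fin l) = i := Fin.ext (by simp only; omega)
      rwa [hi]
  rw [this, Finset.card_image_of_injective, Finset.card_product, hammingDist]
  · simp [mul_comm]
  · rintro ⟨i, b⟩ ⟨i', b'⟩ h
    simp only [Fin.mk.injEq] at h
    exact Prod.ext (Fin.ext (by simp only; omega)) (Fin.ext (by simp only; omega))

theorem signedDiff_cases {m : ℕ} (X₀ X₁ : Finset (Fin m)) (x : Fin m) :
    signedDiff X₀ X₁ x = 0 ∨ signedDiff X₀ X₁ x = 1 ∨ signedDiff X₀ X₁ x = -1 := by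
  rw [signedDiff]
  split <;> split <;> simp

/-- Without collisions, evaluation is correct. -/
theorem eval_hash_eq {ℓ t : ℕ → ℕ} {R : FunctionFamily (fun κ => 2 * ℓ κ) fun κ => 2 * (2 * t κ)}
    {κ : ℕ} (hκ : 0 < κ) (h : SisKey ℓ κ) (x₀ x₁ : Fin (ℓ κ) → Bool)
    (hr : Isolating (fun i => R.eval κ (h.1 i)) (2 * t κ))
    (hc : ∀ N ≤ 2 * ℓ κ, NoCollision (fun i => R.eval κ (h.1 i)) h.2
      (restrictOff (signedDiff (bitsToSet x₀) (bitsToSet x₁))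
        (peeledSet (fun i => R.eval κ (h.1 i)) h.2
          (signedDiff (bitsToSet x₀) (bitsToSet x₁)) N))) :
    (sisHammingPPH ℓ t R).eval κ h ((sisHammingPPH ℓ t R).hash κ h x₀)
      ((sisHammingPPH ℓ t R).hash κ h x₁) = HAM (t κ) x₀ x₁ := by
  have hdec : (sisHammingPPH ℓ t R).eval κ h ((sisHammingPPH ℓ t R).hash κ h x₀)
      ((sisHammingPPH ℓ t R).hash κ h x₁) =
    match sketchDecode (fun i => R.eval κ (h.1 i)) h.2
      (sketchEncode (fun i => R.eval κ (h.1 i)) h.2 (bitsToSet x₀))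
      (sketchEncode (fun i => R.eval κ (h.1 i)) h.2 (bitsToSet x₁)) with
    | none => true
    | some X' => decide (2 * t κ ≤ X'.card) := rfl
  rw [hdec, sketchDecode_eq, sketchEncode_sub, HAM]
  have hcard := card_signedDiff_bitsToSet x₀ x₁
  -- For small distance the support is within the threshold `2t` and decoding succeeds. For large
  -- distance isolation is not needed: failure gives the right answer 1, and success returns at
  -- least `2t` elements.
  rcases lt_or_ge (hammingDist x₀ x₁) (t κ) with hd | hd
  · obtain ⟨h1, h2, h3⟩ := peel_of_isolating (signedDiff_cases _ _) hc hr (by omega)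
    rw [peeledSet] at h3
    rw [if_pos ⟨h1, h2⟩]
    dsimp only
    rw [h3, hcard]
    simp
  · split
    · simpa using hd
    · rename_i X' hX
      split at hX
      · rename_i hz
        have h3 := peeledSet_eq_of_sketch_eq_zero hc hκ hz.2
        have h4 : X' = Finset.univ.filter fun p =>
            signedDiff (bitsToSet x₀) (bitsToSet x₁) p ≠ 0 := by
          ext x
          rw [← Option.some.inj hX]
          have := h3 x
          rw [peeledSet] at this
          simpa using this
        rw [h4, hcard]
        simp
      · cases hX

/-! ### Probabilities -/

section Prob

variable {α β γ : Type}

theorem prob_ne_top (p : PMF α) (E : Set α) : p.toOuterMeasure E ≠ ⊤ := by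
  rw [PMF.toOuterMeasure_apply]
  exact ne_top_of_le_ne_top p.tsum_coe_ne_top (ENNReal.tsum_le_tsum fun _ =>
    Set.indicator_le_self' (fun _ _ => zero_le) _)

theorem prob_nonneg (p : PMF α) (E : Set α) : 0 ≤ prob p E := ENNReal.toReal_nonneg

theorem prob_mono (p : PMF α) {E F : Set α} (h : E ⊆ F) : prob p E ≤ prob p F :=
  ENNReal.toReal_mono (prob_ne_top p F) (p.toOuterMeasure.mono h)

theorem prob_univ (p : PMF α) : prob p Set.univ = 1 := by
  rw [prob, (PMF.toOuterMeasure_apply_eq_one_iff p _).2 (Set.subset_univ _), ENNReal.toReal_one]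

theorem prob_empty (p : PMF α) : prob p ∅ = 0 := by simp [prob]

theorem prob_le_one (p : PMF α) (E : Set α) : prob p E ≤ 1 :=
  (prob_mono p (Set.subset_univ E)).trans_eq (prob_univ p)

theorem prob_eq_tsum (p : PMF α) (E : Set α) :
    prob p E = ∑' a, E.indicator (fun a => (p a).toReal) a := by
  classical
  rw [prob, PMF.toOuterMeasure_apply, ENNReal.tsum_toReal_eq]
  · refine tsum_congr fun a => ?_
    by_cases h : a ∈ E <;> simp [h]
  · intro a
    by_cases h : a ∈ E <;> simp [h, p.apply_ne_top]

theorem summable_toReal (p : PMF α) : Summable fun a => (p a).toReal :=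
  ENNReal.summable_toReal p.tsum_coe_ne_top

theorem tsum_toReal (p : PMF α) : ∑' a, (p a).toReal = 1 := by
  rw [← ENNReal.tsum_toReal_eq p.apply_ne_top, p.tsum_coe, ENNReal.toReal_one]

theorem prob_union_le (p : PMF α) (E F : Set α) : prob p (E ∪ F) ≤ prob p E + prob p F := by
  rw [prob, prob, prob, ← ENNReal.toReal_add (prob_ne_top p E) (prob_ne_top p F)]
  exact ENNReal.toReal_mono (ENNReal.add_ne_top.2 ⟨prob_ne_top p E, prob_ne_top p F⟩)
    (MeasureTheory.measure_union_le _ _)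

theorem prob_biUnion_le {ι : Type} (p : PMF α) (s : Finset ι) (E : ι → Set α) :
    prob p (⋃ i ∈ s, E i) ≤ ∑ i ∈ s, prob p (E i) := by
  classical
  induction s using Finset.induction_on with
  | empty => simp [prob_empty]
  | insert i s hi ih =>
    rw [Finset.sum_insert hi, Finset.set_biUnion_insert]
    exact (prob_union_le p _ _).trans (by gcongr)

theorem prob_map (p : PMF α) (f : α → β) (E : Set β) : prob (p.map f) E = prob p (f ⁻¹' E) := by
  rw [prob, PMF.toOuterMeasure_map_apply, prob]

theorem prob_pure (a : α) (E : Set α) [Decidable (a ∈ E)] :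
    prob (PMF.pure a) E = if a ∈ E then 1 else 0 := by
  rw [prob, PMF.toOuterMeasure_pure_apply]
  split <;> simp

theorem prob_bind (p : PMF α) (f : α → PMF β) (E : Set β) :
    prob (p.bind f) E = ∑' a, (p a).toReal * prob (f a) E := by
  rw [prob, PMF.toOuterMeasure_bind_apply, ENNReal.tsum_toReal_eq]
  · exact tsum_congr fun a => ENNReal.toReal_mul
  · exact fun a => ENNReal.mul_ne_top (p.apply_ne_top a) (prob_ne_top _ _)

theorem summable_mul_prob (p : PMF α) (f : α → PMF β) (E : Set β) :
    Summable fun a => (p a).toReal * prob (f a) E :=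
  (summable_toReal p).of_nonneg_of_le
    (fun _ => mul_nonneg ENNReal.toReal_nonneg (prob_nonneg _ _))
    fun _ => mul_le_of_le_one_right ENNReal.toReal_nonneg (prob_le_one _ _)

theorem bind_congr_support (p : PMF α) {f g : α → PMF β} (h : ∀ a ∈ p.support, f a = g a) :
    p.bind f = p.bind g := by
  ext b
  rw [PMF.bind_apply, PMF.bind_apply]
  refine tsum_congr fun a => ?_
  by_cases ha : a ∈ p.support
  · rw [h a ha]
  · rw [(p.apply_eq_zero_iff a).2 ha, zero_mul, zero_mul]

theorem map_congr_support (p : PMF α) {f g : α → β} (h : ∀ a ∈ p.support, f a = g a) :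
    p.map f = p.map g :=
  bind_congr_support p fun a ha => by rw [Function.comp_apply, Function.comp_apply, h a ha]

/-! ### Statistical distance -/

/-- The statistical distance is at most `ε`. -/
def Close (p q : PMF α) (ε : ℝ) : Prop := ∀ E : Set α, |prob p E - prob q E| ≤ ε

theorem Close.refl (p : PMF α) : Close p p 0 := fun E => by simp

theorem Close.symm {p q : PMF α} {ε : ℝ} (h : Close p q ε) : Close q p ε := fun E => by
  rw [abs_sub_comm]
  exact h E

theorem Close.trans {p q r : PMF α} {ε δ : ℝ} (h : Close p q ε) (h' : Close q r δ) :
    Close p r (ε + δ) := fun E =>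
  (abs_sub_le _ (prob q E) _).trans (add_le_add (h E) (h' E))

theorem Close.map {p q : PMF α} {ε : ℝ} (h : Close p q ε) (f : α → β) :
    Close (p.map f) (q.map f) ε := fun E => by
  rw [prob_map, prob_map]
  exact h _

/-- A randomised test distinguishes no better than the best set, which is `{a | q a < p a}`: the
acceptance probabilities lie in `[0, 1]`, so replacing them by the indicator of this set can only
increase the difference. -/
theorem Close.bind_le {p q : PMF α} {ε : ℝ} (h : Close p q ε) (f : α → PMF β) (E : Set β) :
    prob (p.bind f) E - prob (q.bind f) E ≤ ε := by
  have h1 : prob (p.bind f) E - prob (q.bind f) E ≤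
      prob p {a | q a < p a} - prob q {a | q a < p a} := by
    have hs : ∀ (p' : PMF α) (S : Set α), Summable (S.indicator fun a => (p' a).toReal) :=
      fun p' S => (summable_toReal p').indicator S
    rw [prob_bind, prob_bind, prob_eq_tsum, prob_eq_tsum,
      ← (summable_mul_prob p f E).tsum_sub (summable_mul_prob q f E), ← (hs p _).tsum_sub (hs q _)]
    refine ((summable_mul_prob p f E).sub (summable_mul_prob q f E)).tsum_le_tsum (fun a => ?_)
      ((hs p _).sub (hs q _))
    rw [← sub_mul]
    by_cases ha : q a < p a
    · rw [Set.indicator_of_mem (by exact ha), Set.indicator_of_mem (by exact ha)]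
      refine mul_le_of_le_one_right (sub_nonneg.2 ?_) (prob_le_one _ _)
      exact ENNReal.toReal_mono (p.apply_ne_top a) ha.le
    · rw [Set.indicator_of_notMem (by exact ha), Set.indicator_of_notMem (by exact ha), sub_zero]
      refine mul_nonpos_of_nonpos_of_nonneg (sub_nonpos.2 ?_) (prob_nonneg _ _)
      exact ENNReal.toReal_mono (q.apply_ne_top a) (not_lt.1 ha)
  exact h1.trans ((le_abs_self _).trans (h _))

theorem Close.bind_left {p q : PMF α} {ε : ℝ} (h : Close p q ε) (f : α → PMF β) :
    Close (p.bind f) (q.bind f) ε := fun E =>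
  abs_sub_le_iff.2 ⟨h.bind_le f E, h.symm.bind_le f E⟩

theorem Close.bind_right (p : PMF α) {f g : α → PMF β} {ε : ℝ} (h : ∀ a, Close (f a) (g a) ε) :
    Close (p.bind f) (p.bind g) ε := by
  have key : ∀ f g : α → PMF β, (∀ a, Close (f a) (g a) ε) → ∀ E,
      prob (p.bind f) E - prob (p.bind g) E ≤ ε := by
    intro f g h E
    rw [prob_bind, prob_bind, ← (summable_mul_prob p f E).tsum_sub (summable_mul_prob p g E)]
    refine (((summable_mul_prob p f E).sub (summable_mul_prob p g E)).tsum_le_tsum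
      (g := fun a => (p a).toReal * ε) (fun a => ?_) ((summable_toReal p).mul_right ε)).trans_eq ?_
    · rw [← mul_sub]
      exact mul_le_mul_of_nonneg_left ((le_abs_self _).trans (h a E)) ENNReal.toReal_nonneg
    · rw [tsum_mul_right, tsum_toReal, one_mul]
  exact fun E => abs_sub_le_iff.2 ⟨key f g h E, key g f (fun a => (h a).symm) E⟩

theorem Close.mono {p q : PMF α} {ε δ : ℝ} (h : Close p q ε) (h' : ε ≤ δ) : Close p q δ :=
  fun E => (h E).trans h'

/-! ### Independent samples -/

theorem iid_succ (p : PMF α) (k : ℕ) :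
    iid p (k + 1) = p.bind fun a => (iid p k).map fun v => (Fin.cons a v : Fin (k + 1) → α) := rfl

/-- Hybrid argument: the samples are exchanged one after the other, at cost `ε` each. -/
theorem Close.iid {p q : PMF α} {ε : ℝ} (h : Close p q ε) (k : ℕ) :
    Close (iid p k) (iid q k) (k * ε) := by
  induction k with
  | zero => exact (Close.refl (PMF.pure Fin.elim0)).mono (by simp)
  | succ k ih =>
    rw [iid_succ, iid_succ]
    refine ((Close.bind_right p fun a => ih.map fun v => (Fin.cons a v : Fin (k + 1) → α)).trans
      (h.bind_left _)).mono (by push_cast; linarith)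

theorem map_iid (p : PMF α) (s : α → β) (k : ℕ) :
    (iid p k).map (fun v i => s (v i)) = iid (p.map s) k := by
  induction k with
  | zero =>
    rw [iid, iid, PMF.pure_map]
    congr 1
    exact Subsingleton.elim _ _
  | succ k ih =>
    rw [iid_succ, iid_succ, PMF.map_bind, PMF.bind_map]
    congr 1
    funext a
    rw [Function.comp_apply, ← ih, PMF.map_comp, PMF.map_comp]
    congr 1
    funext v i
    cases i using Fin.cases <;> rfl

theorem iid_apply (p : PMF α) (k : ℕ) (v : Fin k → α) : iid p k v = ∏ i, p (v i) := by
  induction k with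
  | zero =>
    rw [iid, Subsingleton.elim v Fin.elim0]
    simp
  | succ k ih =>
    classical
    rw [iid_succ, PMF.bind_apply, Fin.prod_univ_succ, tsum_eq_single (v 0)]
    · rw [PMF.map_apply, tsum_eq_single (Fin.tail v), ← ih]
      · rw [if_pos (Fin.cons_self_tail v).symm]
        rfl
      · intro w hw
        rw [if_neg]
        intro h
        exact hw (by rw [h, Fin.tail_cons])
    · intro a ha
      rw [PMF.map_apply, ENNReal.tsum_eq_zero.2, mul_zero]
      intro w
      rw [if_neg]
      rintro rfl
      exact ha rfl

theorem iid_uniform [Fintype α] [Nonempty α] (k : ℕ) :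
    iid (PMF.uniformOfFintype α) k = PMF.uniformOfFintype (Fin k → α) := by
  ext v
  rw [iid_apply]
  simp [PMF.uniformOfFintype_apply, ENNReal.inv_pow]

theorem prob_iid_forall (p : PMF α) (E : Set α) (k : ℕ) :
    prob (iid p k) {v | ∀ i, v i ∈ E} = prob p E ^ k := by
  classical
  induction k with
  | zero =>
    rw [iid, prob_pure, if_pos, pow_zero]
    intro i
    exact i.elim0
  | succ k ih =>
    rw [iid_succ, prob_bind, pow_succ', ← ih]
    rw [prob_eq_tsum p E, ← tsum_mul_right]
    refine tsum_congr fun a => ?_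
    rw [prob_map]
    by_cases ha : a ∈ E
    · rw [Set.indicator_of_mem ha]
      congr 2
      ext v
      simp [Fin.forall_fin_succ, ha]
    · rw [Set.indicator_of_notMem ha, zero_mul]
      convert mul_zero _
      convert prob_empty (iid p k)
      ext v
      simp [Fin.forall_fin_succ, ha]

theorem mem_support_iid {p : PMF α} {k : ℕ} {v : Fin k → α} (h : v ∈ (iid p k).support) (i) :
    v i ∈ p.support := by
  rw [PMF.mem_support_iff, iid_apply, Finset.prod_ne_zero_iff] at h
  exact (p.mem_support_iff _).2 (h i (Finset.mem_univ i))

end Prob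

/-! ### Coins -/

/-- A list of `N` independent fair coins. -/
def fairCoins (N : ℕ) : PMF (List ℕ) :=
  (PMF.uniformOfFintype (Fin N → Bool)).map fun r => List.ofFn fun i => (r i).toNat

theorem PPT.run_eq (S : PPT) (x : List ℕ) :
    S.run x = (fairCoins (S.coins.eval (size x))).map fun r => S.machine (pack [x, r]) := by
  rw [PPT.run, fairCoins, PMF.map_comp]
  rfl

theorem fairCoins_zero : fairCoins 0 = PMF.pure [] := by
  rw [fairCoins, ← iid_uniform, iid, PMF.pure_map]
  rfl

theorem fairCoins_succ (N : ℕ) : fairCoins (N + 1) =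
    (PMF.uniformOfFintype Bool).bind fun b => (fairCoins N).map (b.toNat :: ·) := by
  rw [fairCoins, ← iid_uniform, iid_succ, PMF.map_bind]
  congr 1
  funext b
  rw [PMF.map_comp, iid_uniform, fairCoins, PMF.map_comp]
  congr 1
  funext v
  simp [List.ofFn_succ]

theorem fairCoins_add (a b : ℕ) :
    fairCoins (a + b) = (fairCoins a).bind fun u => (fairCoins b).map (u ++ ·) := by
  induction a with
  | zero =>
    rw [fairCoins_zero, PMF.pure_bind, zero_add]
    exact (PMF.map_id _).symm
  | succ a ih =>
    rw [Nat.succ_add_eq_add_succ, Nat.add_succ, fairCoins_succ, fairCoins_succ, PMF.bind_bind]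
    congr 1
    funext c
    rw [ih, PMF.map_bind, PMF.bind_map]
    congr 1
    funext u
    rw [PMF.map_comp, Function.comp_apply]
    rfl

theorem length_of_mem_support_fairCoins {N : ℕ} {r : List ℕ} (h : r ∈ (fairCoins N).support) :
    r.length = N := by
  rw [fairCoins, PMF.mem_support_map_iff] at h
  obtain ⟨v, -, rfl⟩ := h
  simp

theorem le_one_of_mem_support_fairCoins {N : ℕ} {r : List ℕ} (h : r ∈ (fairCoins N).support) :
    ∀ a ∈ r, a ≤ 1 := by
  rw [fairCoins, PMF.mem_support_map_iff] at h
  obtain ⟨v, -, rfl⟩ := h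
  intro a ha
  obtain ⟨i, rfl⟩ := (List.mem_ofFn' _ _).1 ha
  exact Bool.toNat_le _

/-- Surplus coins do no harm. A `PPT` has its number of coins fixed by a polynomial in the input
length, which is usually more than a combined algorithm needs. -/
theorem fairCoins_take {a b : ℕ} (h : a ≤ b) : (fairCoins b).map (List.take a) = fairCoins a := by
  obtain ⟨c, rfl⟩ := Nat.exists_eq_add_of_le h
  rw [fairCoins_add, PMF.map_bind]
  have : ∀ u ∈ (fairCoins a).support,
      ((fairCoins c).map (u ++ ·)).map (List.take a) = PMF.pure u := by
    intro u hu
    rw [PMF.map_comp, ← length_of_mem_support_fairCoins hu]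
    convert PMF.map_const (fairCoins c) u using 2
    funext v
    simp
  rw [bind_congr_support _ this, PMF.bind_pure]

/-- Disjoint blocks of coins are independent, so running a sampler on consecutive blocks yields
independent samples. -/
theorem fairCoins_blocks {α : Type} (s : List ℕ → α) (k B : ℕ) :
    (fairCoins (k * B)).map (fun r (i : Fin k) => s ((r.drop (i * B)).take B)) =
      iid ((fairCoins B).map s) k := by
  induction k with
  | zero =>
    rw [Nat.zero_mul, fairCoins_zero, iid, PMF.pure_map]
    congr 1
    exact Subsingleton.elim _ _
  | succ k ih =>
    rw [Nat.succ_mul, add_comm (k * B), fairCoins_add, iid_succ, ← ih, PMF.map_bind, PMF.bind_map]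
    refine bind_congr_support _ fun u hu => ?_
    rw [Function.comp_apply, PMF.map_comp, PMF.map_comp]
    congr 1
    funext v
    funext i
    have hl := length_of_mem_support_fairCoins hu
    subst hl
    cases i using Fin.cases with
    | zero => simp
    | succ i => simp [Nat.succ_mul, add_comm (_ * _) u.length, ← List.drop_drop]

/-! ### The probability that no row isolates an element -/

section BadRows

variable {α : Type} {m c : ℕ}

/-- No element of `S` is alone in its cell. -/
def Crowded (g : Fin m → Fin c) (S : Finset (Fin m)) : Prop :=
  ∀ x ∈ S, ∃ y ∈ S, g y = g x ∧ y ≠ x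

/-- Every occupied cell contains at least two elements of `S`. -/
theorem Crowded.two_mul_card_image_le {g : Fin m → Fin c} {S : Finset (Fin m)}
    (h : Crowded g S) : 2 * (S.image g).card ≤ S.card := by
  refine Finset.mul_card_image_le_card (f := g) S 2 fun j hj => ?_
  obtain ⟨x, hx, rfl⟩ := Finset.mem_image.1 hj
  obtain ⟨y, hy, hxy, hne⟩ := h x hx
  exact Finset.one_lt_card.2 ⟨y, by simp [hy, hxy], x, by simp [hx], hne⟩

theorem exists_superset_of_crowded {g : Fin m → Fin c} {S : Finset (Fin m)}
    (h : Crowded g S) (hS : S.card ≤ c) :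
    ∃ J : Finset (Fin c), J.card = S.card / 2 ∧ ∀ x ∈ S, g x ∈ J := by
  have := h.two_mul_card_image_le
  obtain ⟨J, hJ, hc⟩ := Finset.exists_superset_card_eq (s := S.image g) (n := S.card / 2)
    (by omega) (by rw [Fintype.card_fin]; omega)
  exact ⟨J, hc, fun x hx => hJ (Finset.mem_image_of_mem g hx)⟩

/-- Put `j = ⌊s/2⌋` and `d = s - j`. From `c.choose j ≤ c^j / j!`, `j^j / j! ≤ e^j ≤ 3^j` and `j / c
≤ 1/4` the left factor is at most `3^j / 4^d`. Squaring it avoids half-integral exponents; for odd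
`s` the additional factor `1/16` is below `3/4`. -/
theorem choose_mul_pow_le {c s T : ℕ} (hc : c = 2 * T) (hs : s ≤ T) (hs0 : 0 < s) :
    (((c.choose (s / 2) : ℕ) : ℝ) * ((s / 2 : ℕ) : ℝ) ^ s * (1 / (c : ℝ)) ^ s) ^ 2 ≤
      (3 / 4) ^ s := by
  obtain ⟨j, hj⟩ : ∃ j, j = s / 2 := ⟨_, rfl⟩
  rw [← hj]
  have hc0 : (0 : ℝ) < c := by
    have : 0 < c := by omega
    exact_mod_cast this
  have h1 : ((c.choose j : ℕ) : ℝ) ≤ (c : ℝ) ^ j / (Nat.factorial j : ℝ) :=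
    Nat.choose_le_pow_div j c
  have h2 : (j : ℝ) ^ j / (Nat.factorial j : ℝ) ≤ 3 ^ j := by
    refine (Real.pow_div_factorial_le_exp (j : ℝ) (by positivity) j).trans ?_
    rw [← mul_one (j : ℝ), Real.exp_nat_mul]
    exact pow_le_pow_left₀ (Real.exp_pos _).le (by
      have := Real.exp_one_lt_d9
      linarith) _
  have h3 : (j : ℝ) / c ≤ 1 / 4 := by
    rw [div_le_div_iff₀ hc0 (by norm_num)]
    have : j * 4 ≤ 1 * c := by omega
    exact_mod_cast this
  obtain ⟨d, hd⟩ : ∃ d, s = j + d := ⟨s - j, by omega⟩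
  have h4 : ((c.choose j : ℕ) : ℝ) * (j : ℝ) ^ s * (1 / (c : ℝ)) ^ s ≤ 3 ^ j * (1 / 4) ^ d := by
    calc ((c.choose j : ℕ) : ℝ) * (j : ℝ) ^ s * (1 / (c : ℝ)) ^ s
        ≤ (c : ℝ) ^ j / (Nat.factorial j : ℝ) * (j : ℝ) ^ s * (1 / (c : ℝ)) ^ s := by gcongr
      _ = ((j : ℝ) ^ j / (Nat.factorial j : ℝ)) * ((j : ℝ) / c) ^ d := by
        have : (Nat.factorial j : ℝ) ≠ 0 := by positivity
        rw [hd, pow_add, pow_add, div_pow, div_pow, div_pow]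
        field_simp
        simp
      _ ≤ 3 ^ j * (1 / 4) ^ d := by gcongr
  refine (pow_le_pow_left₀ (by positivity) h4 2).trans ?_
  have hs2 : s = 2 * j ∨ s = 2 * j + 1 := by omega
  have h5 : ((3 : ℝ) ^ j * (1 / 4) ^ j) ^ 2 = (3 / 4) ^ (2 * j) := by
    rw [← mul_pow, ← pow_mul, mul_comm j 2]
    norm_num
  rcases hs2 with h | h
  · obtain rfl : d = j := by omega
    rw [h5, ← h]
  · obtain rfl : d = j + 1 := by omega
    rw [h, pow_succ (1 / 4 : ℝ), ← mul_assoc, mul_pow, h5, pow_succ (3 / 4 : ℝ)]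
    gcongr
    norm_num

/-- Union bound over the set `J` of `⌊s/2⌋` cells that contains the image of `S` and over all maps
from `S` to `J`. Each such map occurs with probability `c^(-s)` by independence. -/
theorem prob_crowded_sq_le (p : PMF α) (g : α → Fin m → Fin c) {T : ℕ} (hc : c = 2 * T)
    (hp : ∀ X : Finset (Fin m), X.card ≤ T → ∀ y : Fin m → Fin c,
      prob p {a | ∀ x ∈ X, g a x = y x} = (1 / (c : ℝ)) ^ X.card)
    {S : Finset (Fin m)} (hS : S.card ≤ T) (hS0 : S.Nonempty) :
    prob p {a | Crowded (g a) S} ^ 2 ≤ (3 / 4) ^ S.card := by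
  classical
  have hs := Finset.card_pos.2 hS0
  refine le_trans (pow_le_pow_left₀ (prob_nonneg _ _) ?_ 2) (choose_mul_pow_le hc hS hs)
  -- A fixed value outside `S`, so that maps from `S` to `J` correspond to functions on all of `Fin
  -- m` and are counted once.
  have z : Fin c := ⟨0, by omega⟩
  let Y : Finset (Fin c) → Finset (Fin m → Fin c) := fun J =>
    Fintype.piFinset fun x => if x ∈ S then J else {z}
  have hY : ∀ J, (Y J).card = J.card ^ S.card := by
    intro J
    rw [Fintype.card_piFinset, ← Finset.prod_subset (Finset.subset_univ S)]
    · rw [Finset.prod_congr rfl (g := fun _ => J.card) fun x hx => by rw [if_pos hx],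
        Finset.prod_const]
    · intro x _ hx
      rw [if_neg hx, Finset.card_singleton]
  have hsub : {a | Crowded (g a) S} ⊆
      ⋃ J ∈ Finset.powersetCard (S.card / 2) (Finset.univ : Finset (Fin c)),
        ⋃ y ∈ Y J, {a | ∀ x ∈ S, g a x = y x} := by
    intro a ha
    obtain ⟨J, hJ, hJ'⟩ := exists_superset_of_crowded ha (by omega)
    simp only [Set.mem_iUnion]
    refine ⟨J, Finset.mem_powersetCard.2 ⟨Finset.subset_univ _, hJ⟩,
      fun x => if x ∈ S then g a x else z, Fintype.mem_piFinset.2 fun x => ?_, fun x hx => ?_⟩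
    · split
      · exact hJ' x ‹_›
      · exact Finset.mem_singleton_self z
    · simp only [if_pos hx]
  refine (prob_mono p hsub).trans ((prob_biUnion_le p _ _).trans ?_)
  refine (Finset.sum_le_sum (g := fun _ => ((S.card / 2 : ℕ) : ℝ) ^ S.card *
    (1 / (c : ℝ)) ^ S.card) fun J hJ => (prob_biUnion_le p _ _).trans_eq ?_).trans_eq ?_
  · rw [Finset.sum_congr rfl fun y _ => hp S hS y, Finset.sum_const, hY,
      (Finset.mem_powersetCard.1 hJ).2, nsmul_eq_mul, Nat.cast_pow]
  · rw [Finset.sum_const, Finset.card_powersetCard, Finset.card_univ, Fintype.card_fin,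
      nsmul_eq_mul, mul_assoc]

/-- The bound for `k` independent functions. -/
theorem prob_not_isolating_le (p : PMF α) (g : α → Fin m → Fin c) {T : ℕ} (hc : c = 2 * T)
    (hp : ∀ X : Finset (Fin m), X.card ≤ T → ∀ y : Fin m → Fin c,
      prob p {a | ∀ x ∈ X, g a x = y x} = (1 / (c : ℝ)) ^ X.card) (k : ℕ) :
    prob (iid p k) {v | ¬ Isolating (fun i => g (v i)) T} ≤ 2 * m * (3 / 4) ^ (k / 2) := by
  classical
  set ρ : ℝ := (3 / 4) ^ (k / 2) with hρ
  have hρ0 : 0 < ρ := by positivity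
  -- If `mρ > 1`, the claimed bound exceeds 1.
  rcases lt_or_ge 1 (m * ρ) with h1 | h1
  · exact (prob_le_one _ _).trans (by linarith)
  have hsub : {v : Fin k → α | ¬ Isolating (fun i => g (v i)) T} ⊆
      ⋃ S ∈ (Finset.univ.powerset.erase ∅).filter fun S : Finset (Fin m) => S.card ≤ T,
        {v | ∀ i, v i ∈ {a | Crowded (g a) S}} := by
    intro v hv
    simp only [Isolating, Set.mem_ofPred_eq, not_forall, not_exists, not_and] at hv
    obtain ⟨S, hS, hT, h⟩ := hv
    simp only [Set.mem_iUnion]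
    refine ⟨S, by simp [hT, hS.ne_empty], fun i x hx => ?_⟩
    obtain ⟨y, hy, hxy, hne⟩ := h i x hx
    exact ⟨y, hy, hxy, hne⟩
  refine (prob_mono _ hsub).trans ((prob_biUnion_le _ _ _).trans ?_)
  have h2 : ∀ S ∈ (Finset.univ.powerset.erase ∅).filter fun S : Finset (Fin m) => S.card ≤ T,
      prob (iid p k) {v | ∀ i, v i ∈ {a | Crowded (g a) S}} ≤ ρ ^ S.card := by
    intro S hS
    rw [Finset.mem_filter, Finset.mem_erase] at hS
    rw [prob_iid_forall]
    -- The single-row bound is for the square of the probability, so the rows are used in `k / 2`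
    -- pairs.
    calc prob p {a | Crowded (g a) S} ^ k
        ≤ prob p {a | Crowded (g a) S} ^ (2 * (k / 2)) :=
          pow_le_pow_of_le_one (prob_nonneg _ _) (prob_le_one _ _) (by omega)
      _ = (prob p {a | Crowded (g a) S} ^ 2) ^ (k / 2) := pow_mul _ _ _
      _ ≤ ((3 / 4) ^ S.card) ^ (k / 2) := by
          gcongr
          exact prob_crowded_sq_le p g hc hp hS.2 (Finset.nonempty_iff_ne_empty.2 hS.1.1)
      _ = ρ ^ S.card := by rw [hρ, ← pow_mul, ← pow_mul, mul_comm]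
  refine (Finset.sum_le_sum h2).trans ((Finset.sum_le_sum_of_subset_of_nonneg
    (Finset.filter_subset _ _) fun _ _ _ => by positivity).trans ?_)
  -- The union bound over all subsets sums to a binomial expansion; removing the empty set subtracts
  -- 1.
  have h3 : ∑ S ∈ (Finset.univ : Finset (Fin m)).powerset, ρ ^ S.card = (1 + ρ) ^ m := by
    have := Finset.prod_one_add (f := fun _ : Fin m => ρ) Finset.univ
    simp only [Finset.prod_const, Finset.card_univ, Fintype.card_fin] at this
    exact this.symm
  have h4 := Finset.add_sum_erase (Finset.univ : Finset (Fin m)).powerset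
    (fun S => ρ ^ S.card) (Finset.empty_mem_powerset _)
  rw [h3, Finset.card_empty, pow_zero] at h4
  have h5 : (1 + ρ) ^ m ≤ Real.exp (m * ρ) := by
    rw [Real.exp_nat_mul]
    exact pow_le_pow_left₀ (by positivity) (by linarith [Real.add_one_le_exp ρ]) _
  -- With `mρ ≤ 1` this gives `(1 + ρ)^m - 1 ≤ exp (mρ) - 1 ≤ 2mρ`.
  have h6 := Real.abs_exp_sub_one_le (x := m * ρ) (by
    rw [abs_of_nonneg (by positivity)]
    exact h1)
  rw [abs_of_nonneg (a := m * ρ) (by positivity)] at h6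
  have h7 := le_abs_self (Real.exp (m * ρ) - 1)
  linarith

end BadRows

/-! ### Negligible functions -/

theorem Negligible.mono {f g : ℕ → ℝ} (hg : Negligible g) (h : ∀ κ, 0 < κ → f κ ≤ g κ) :
    Negligible f := fun c => by
  obtain ⟨N, hN⟩ := hg c
  exact ⟨N, fun κ hκ => (h κ (by omega)).trans_lt (hN κ hκ)⟩

theorem Negligible.nat_mul {f : ℕ → ℝ} (hf : Negligible f) : Negligible fun κ => κ * f κ :=
  fun c => by
  obtain ⟨N, hN⟩ := hf (c + 1)
  refine ⟨N, fun κ hκ => ?_⟩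
  have hκ' : (0 : ℝ) < κ := by exact_mod_cast (by omega : 0 < κ)
  refine (mul_lt_mul_of_pos_left (hN κ hκ) hκ').trans_eq ?_
  rw [pow_succ]
  field_simp

theorem Negligible.pow_mul {f : ℕ → ℝ} (hf : Negligible f) (d : ℕ) :
    Negligible fun κ => (κ : ℝ) ^ d * f κ := by
  induction d with
  | zero => simpa using hf
  | succ d ih => exact ih.nat_mul.mono fun κ _ => by rw [pow_succ]; linarith

theorem Negligible.add {f g : ℕ → ℝ} (hf : Negligible f) (hg : Negligible g) :
    Negligible fun κ => f κ + g κ := fun c => by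
  obtain ⟨N, hN⟩ := hf (c + 1)
  obtain ⟨M, hM⟩ := hg (c + 1)
  -- For `κ ≥ 2` the additional factor `1/κ` from the exponent `c + 1` absorbs the two summands.
  refine ⟨max (max N M) 2, fun κ hκ => ?_⟩
  have h2 : (2 : ℝ) ≤ κ := by exact_mod_cast (by omega : 2 ≤ κ)
  refine (add_lt_add (hN κ (by omega)) (hM κ (by omega))).trans_le ?_
  have hp : (0 : ℝ) < (κ : ℝ) ^ c := by positivity
  rw [pow_succ, ← add_div, div_le_div_iff₀ (by positivity) hp]
  nlinarith

theorem Negligible.const_mul {f : ℕ → ℝ} (hf : Negligible f) (hf0 : ∀ κ, 0 ≤ f κ) (a : ℝ) :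
    Negligible fun κ => a * f κ := fun c => by
  obtain ⟨N, hN⟩ := hf.nat_mul c
  obtain ⟨M, hM⟩ := exists_nat_ge a
  refine ⟨max N M, fun κ hκ => lt_of_le_of_lt ?_ (hN κ (by omega))⟩
  have : (M : ℝ) ≤ κ := by exact_mod_cast (by omega : M ≤ κ)
  exact mul_le_mul_of_nonneg_right (hM.trans this) (hf0 κ)

theorem polynomial_eval_le (p : Polynomial ℕ) :
    ∃ a d : ℕ, ∀ κ, 0 < κ → p.eval κ ≤ a * κ ^ d := by
  refine ⟨∑ i ∈ p.support, p.coeff i, p.natDegree, fun κ hκ => ?_⟩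
  rw [Polynomial.eval_eq_sum, Polynomial.sum, Finset.sum_mul]
  exact Finset.sum_le_sum fun i hi => Nat.mul_le_mul_left _
    (Nat.pow_le_pow_right hκ (Polynomial.le_natDegree_of_mem_supp i hi))

theorem Negligible.polynomial_mul {f : ℕ → ℝ} (hf : Negligible f) (hf0 : ∀ κ, 0 ≤ f κ)
    (p : Polynomial ℕ) : Negligible fun κ => ((p.eval κ : ℕ) : ℝ) * f κ := by
  obtain ⟨a, d, h⟩ := polynomial_eval_le p
  refine ((hf.pow_mul d).const_mul (fun κ => mul_nonneg (by positivity) (hf0 κ)) a).mono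
    fun κ hκ => ?_
  rw [← mul_assoc]
  refine mul_le_mul_of_nonneg_right ?_ (hf0 κ)
  exact_mod_cast h κ hκ

theorem negligible_pow {ρ : ℝ} (h0 : 0 ≤ ρ) (h1 : ρ < 1) : Negligible fun κ => ρ ^ κ := by
  intro c
  have := tendsto_pow_const_mul_const_pow_of_abs_lt_one c (r := ρ) (by rwa [abs_of_nonneg h0])
  obtain ⟨N, hN⟩ := Filter.eventually_atTop.1 (this.eventually_lt_const (zero_lt_one))
  refine ⟨N, fun κ hκ => ?_⟩
  have hκ' : (0 : ℝ) < κ := by exact_mod_cast (by omega : 0 < κ)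
  rw [lt_div_iff₀ (by positivity), mul_comm]
  exact hN κ hκ.le

/-- Since `κ ≤ 2 * (κ / 2) + 1`, the function is at most `√ρ ^ κ / √ρ`. -/
theorem negligible_pow_half {ρ : ℝ} (h0 : 0 < ρ) (h1 : ρ < 1) :
    Negligible fun κ => ρ ^ (κ / 2) := by
  have h2 : Real.sqrt ρ < 1 := by
    rw [Real.sqrt_lt' one_pos]
    simpa using h1
  refine ((negligible_pow (Real.sqrt_nonneg ρ) h2).const_mul
    (fun κ => by positivity) (Real.sqrt ρ)⁻¹).mono fun κ _ => ?_
  have hs : 0 < Real.sqrt ρ := Real.sqrt_pos.2 h0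
  rw [inv_mul_eq_div, le_div_iff₀ hs]
  nth_rw 1 [← Real.sq_sqrt h0.le]
  rw [← pow_mul, ← pow_succ]
  exact pow_le_pow_of_le_one hs.le h2.le (by omega)

/-! ### Sampling of uniform matrices -/

@[fun_prop]
theorem Poly.take {α γ : Type} [Enc α] [Enc γ] [Inhabited α] {l : γ → List α} {n : γ → ℕ}
    (hl : Poly l) (hn : Poly n) : Poly fun c => (l c).take (n c) := by
  have : Poly fun c => RobustPPH.tab ((l c).length - ((l c).length - n c)) fun i =>
      (l c).getD i default := by fun_prop
  refine this.congr fun c => ?_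
  rw [tab_eq_ofFn]
  refine List.ext_getElem (by simp; omega) fun i h1 h2 => ?_
  simp only [List.length_take] at h2
  have : i < (l c).length := by omega
  simp [this]

/-- The residue modulo `q` of the number with the given binary digits. -/
def residue (q : ℕ) (b : List ℕ) : ℕ := b.foldl (fun a x => (2 * a + x) % q) 0

theorem residue_lt {q : ℕ} (hq : 0 < q) (b : List ℕ) : residue q b < q := by
  rcases List.eq_nil_or_concat b with rfl | ⟨b, x, rfl⟩
  · exact hq
  · rw [residue, List.concat_eq_append, List.foldl_append]
    exact Nat.mod_lt _ hq

theorem residue_eq (q : ℕ) (b : List ℕ) :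
    residue q b = b.foldl (fun a x => 2 * a + x) 0 % q := by
  have : ∀ a, b.foldl (fun a x => (2 * a + x) % q) (a % q) =
      b.foldl (fun a x => 2 * a + x) a % q := by
    induction b with
    | nil => intro a; rfl
    | cons x b ih =>
      intro a
      rw [List.foldl_cons, List.foldl_cons, ← ih]
      congr 1
      simp [Nat.add_mod, Nat.mul_mod]
  simpa [residue] using this 0

theorem Poly.residue {γ : Type} [Enc γ] {q : γ → ℕ} {b : γ → List ℕ} (hq : Poly q) (hb : Poly b)
    (h0 : ∀ e, 0 < q e) : Poly fun e => residue (q e) (b e) := by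
  unfold RobustPPH.residue
  refine foldl (f := fun e a x => (2 * a + x) % q e) hb (const 0) (by fun_prop)
    (S := fun e => q e + 1) (.add hq.nat_le (.const 1)) fun e l _ => ?_
  rw [bits_nat]
  have := residue_lt (h0 e) l
  rw [RobustPPH.residue] at this
  omega

/-- Horner evaluation of `B` coins started at `a` is uniform on the interval of length `2^B`
starting at `a * 2^B`. The first coin chooses a half of the interval, which is why `a` is general in
the induction. -/
theorem prob_fairCoins_foldl (B : ℕ) (E : Set ℕ) [DecidablePred (· ∈ E)] (a : ℕ) :
    prob ((fairCoins B).map fun b => b.foldl (fun a x => 2 * a + x) a) E =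
      (Nat.count (fun v => a * 2 ^ B + v ∈ E) (2 ^ B) : ℕ) / 2 ^ B := by
  induction B generalizing a with
  | zero =>
    rw [fairCoins_zero, PMF.pure_map, prob_pure]
    have h1 : Nat.count (fun v => a * 2 ^ 0 + v ∈ E) (2 ^ 0) = if a ∈ E then 1 else 0 := by
      rw [pow_zero, ← Nat.zero_add 1, Nat.count_succ, Nat.count_zero]
      simp
    rw [h1]
    by_cases h : a ∈ E <;> simp [h]
  | succ B ih =>
    rw [fairCoins_succ, PMF.map_bind, prob_bind, tsum_fintype, Fintype.sum_bool]
    simp only [PMF.map_comp, Function.comp_def, List.foldl_cons, ih]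
    have h1 : ((PMF.uniformOfFintype Bool) true).toReal = 1 / 2 := by
      simp [PMF.uniformOfFintype_apply]
    have h2 : ((PMF.uniformOfFintype Bool) false).toReal = 1 / 2 := by
      simp [PMF.uniformOfFintype_apply]
    have h3 : 2 ^ (B + 1) = 2 ^ B + 2 ^ B := by ring
    rw [h1, h2, h3, Nat.count_add]
    have h4 : ∀ v, a * (2 ^ B + 2 ^ B) + v = (2 * a + false.toNat) * 2 ^ B + v := by
      intro v; simp; ring
    have h5 : ∀ v, a * (2 ^ B + 2 ^ B) + (2 ^ B + v) = (2 * a + true.toNat) * 2 ^ B + v := by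
      intro v; simp; ring
    simp only [h5]
    simp only [h4]
    push_cast
    field_simp
    ring

theorem count_mod_add (P : ℕ → Prop) [DecidablePred P] (q d s : ℕ) :
    Nat.count (fun v => P (v % q)) (q * d + s) =
      d * Nat.count P q + Nat.count (fun v => P (v % q)) s := by
  have hq : Nat.count (fun v => P (v % q)) q = Nat.count P q := by
    rw [Nat.count_eq_card_filter_range, Nat.count_eq_card_filter_range]
    congr 1
    refine Finset.filter_congr fun x hx => ?_
    rw [Nat.mod_eq_of_lt (Finset.mem_range.1 hx)]
  induction d with
  | zero => simp
  | succ d ih =>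
    rw [show q * (d + 1) + s = q + (q * d + s) by ring, Nat.count_add, hq]
    simp only [Nat.add_mod_left]
    rw [ih]
    ring

theorem prob_uniform_val (q : ℕ) [NeZero q] (E : Set ℕ) [DecidablePred (· ∈ E)] :
    prob ((PMF.uniformOfFintype (ZMod q)).map ZMod.val) E = (Nat.count (· ∈ E) q : ℕ) / q := by
  classical
  rw [prob_map, prob, PMF.toOuterMeasure_uniformOfFintype_apply, ENNReal.toReal_div,
    ENNReal.toReal_natCast, ENNReal.toReal_natCast, ZMod.card, Nat.count_eq_card_filter_range,
    Fintype.card_subtype]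
  congr 2
  refine Finset.card_bij (fun a _ => a.val) ?_ ?_ ?_
  · intro a ha
    simp only [Finset.mem_filter, Finset.mem_univ, true_and] at ha
    exact Finset.mem_filter.2 ⟨Finset.mem_range.2 (ZMod.val_lt a), ha⟩
  · exact fun a _ b _ h => ZMod.val_injective q h
  · intro b hb
    rw [Finset.mem_filter, Finset.mem_range] at hb
    have : ((b : ZMod q)).val = b := ZMod.val_cast_of_lt hb.1
    refine ⟨(b : ZMod q), ?_, this⟩
    simp only [Finset.mem_filter, Finset.mem_univ, true_and, Set.mem_preimage, this]
    exact hb.2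

/-- Write `2^B = q * d + s` with `s < q`. The `d` full periods hit every residue equally often, so
only the last `s` numbers cause a bias. -/
theorem close_residue (q B : ℕ) [NeZero q] :
    Close ((fairCoins B).map (residue q)) ((PMF.uniformOfFintype (ZMod q)).map ZMod.val)
      (q / 2 ^ B) := by
  classical
  intro E
  have hq : 0 < q := NeZero.pos q
  have h1 : (fairCoins B).map (residue q) =
      ((fairCoins B).map fun b => b.foldl (fun a x => 2 * a + x) 0).map (· % q) := by
    rw [PMF.map_comp]
    exact map_congr_support _ fun b _ => residue_eq q b
  rw [h1, prob_map, prob_fairCoins_foldl, prob_uniform_val]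
  simp only [zero_mul, zero_add, Set.mem_preimage]
  obtain ⟨d, hd⟩ : ∃ d, d = 2 ^ B / q := ⟨_, rfl⟩
  obtain ⟨s, hs⟩ : ∃ s, s = 2 ^ B % q := ⟨_, rfl⟩
  have hN : 2 ^ B = q * d + s := by rw [hd, hs, Nat.div_add_mod]
  have hsq : s < q := hs ▸ Nat.mod_lt _ hq
  have hc := count_mod_add (· ∈ E) q d s
  rw [← hN] at hc
  rw [hc]
  obtain ⟨e, he⟩ : ∃ e, e = Nat.count (· ∈ E) q := ⟨_, rfl⟩
  obtain ⟨u, hu⟩ : ∃ u, u = Nat.count (fun v => v % q ∈ E) s := ⟨_, rfl⟩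
  rw [← he, ← hu]
  have heq : e ≤ q := he ▸ Nat.count_le _
  have hus : u ≤ s := hu ▸ Nat.count_le _
  have hNR : (2 : ℝ) ^ B = q * d + s := by exact_mod_cast hN
  have hqR : (0 : ℝ) < q := by exact_mod_cast hq
  have hNpos : (0 : ℝ) < 2 ^ B := by positivity
  have heR : (e : ℝ) ≤ q := by exact_mod_cast heq
  have huR : (u : ℝ) ≤ s := by exact_mod_cast hus
  have hsR : (s : ℝ) ≤ q := by exact_mod_cast hsq.le
  have hu0 : (0 : ℝ) ≤ u := Nat.cast_nonneg u
  have he0 : (0 : ℝ) ≤ e := Nat.cast_nonneg e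
  have hs0 : (0 : ℝ) ≤ s := Nat.cast_nonneg s
  rw [div_sub_div _ _ hNpos.ne' hqR.ne', abs_div, abs_of_pos (mul_pos hNpos hqR),
    div_le_div_iff₀ (mul_pos hNpos hqR) hNpos]
  push_cast
  -- The terms with `d` cancel and `u * q - s * e` remains, a difference of two products that lie
  -- between 0 and `q * q`.
  have h2 : |((d : ℝ) * e + u) * q - 2 ^ B * e| ≤ q * q := by
    rw [hNR, abs_le]
    constructor <;> nlinarith
  nlinarith

/-- A random `n × m` matrix of residues from `n m B` coins. -/
def sampleMat (n m q B : ℕ) (r : List ℕ) : List (List ℕ) :=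
  tab n fun a => tab m fun x =>
    residue q ((((r.drop (a * (m * B))).take (m * B)).drop (x * B)).take B)

theorem Poly.sampleMat {γ : Type} [Enc γ] {n m q B : γ → ℕ} {r : γ → List ℕ} (hn : Poly n)
    (hm : Poly m) (hq : Poly q) (hB : Poly B) (hr : Poly r) (h0 : ∀ e, 0 < q e) :
    Poly fun e => sampleMat (n e) (m e) (q e) (B e) (r e) := by
  unfold RobustPPH.sampleMat
  refine Poly.tab hn (Poly.tab (f := fun p : γ × ℕ => fun x => RobustPPH.residue (q p.1)
    ((((r p.1).drop (p.2 * (m p.1 * B p.1))).take (m p.1 * B p.1)).drop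
      (x * B p.1) |>.take (B p.1))) (by fun_prop) ?_)
  exact Poly.residue (by fun_prop) (by fun_prop) fun e => h0 _

/-- A uniform matrix is an independent family of independent uniform entries, and the coins are cut
into blocks twice, for rows and for entries. The error of one residue is thus multiplied by `m` and
by `n`. -/
theorem close_sampleMat (n m q B : ℕ) [NeZero q] :
    Close ((fairCoins (n * (m * B))).map (sampleMat n m q B))
      ((PMF.uniformOfFintype (Matrix (Fin n) (Fin m) (ZMod q))).map matList)
      (n * (m * (q / 2 ^ B))) := by
  have h1 : (fairCoins (n * (m * B))).map (sampleMat n m q B) =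
      (iid (iid ((fairCoins B).map (residue q)) m) n).map
        fun M => List.ofFn fun a => List.ofFn (M a) := by
    rw [← fairCoins_blocks (residue q) m B, ← fairCoins_blocks, PMF.map_comp]
    refine map_congr_support _ fun r _ => ?_
    simp only [sampleMat, tab_eq_ofFn]
    rfl
  have h2 : (PMF.uniformOfFintype (Matrix (Fin n) (Fin m) (ZMod q))).map matList =
      (iid (iid ((PMF.uniformOfFintype (ZMod q)).map ZMod.val) m) n).map
        fun M => List.ofFn fun a => List.ofFn (M a) := by
    rw [← map_iid, ← map_iid, iid_uniform, iid_uniform, PMF.map_comp]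
    rfl
  rw [h1, h2]
  exact (((close_residue q B).iid m).iid n).map _

/-! ### Efficiency of the hash family -/

theorem PolyBdd.of_bits {T : ℕ → ℕ} (h : PolyBdd bits T) : PolyBdd (fun κ : ℕ => κ) T :=
  PolyBdd.trans ((PolyBdd.self.add (.const 1)).mono fun κ => (bits_nat κ).le) h

/-- The keys of the functions, from the coins `u`. -/
def sampleFuns (S : PPT) (κ : ℕ) (u : List ℕ) : List Raw :=
  tab κ fun i => ⟨S.machine (pack [[κ],
    (u.drop (i * S.coins.eval (κ + 1))).take (S.coins.eval (κ + 1))])⟩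

@[fun_prop]
theorem Poly.sampleFuns {γ : Type} [Enc γ] (S : PPT) {κ : γ → ℕ} {u : γ → List ℕ} (hκ : Poly κ)
    (hu : Poly u) : Poly fun e => sampleFuns S (κ e) (u e) := by
  have hc : Poly fun e => S.coins.eval (κ e + 1) := Poly.polynomial_eval (by fun_prop) _
  have h1 : Poly fun p : γ × ℕ => (κ p.1, Raw.mk (((u p.1).drop (p.2 * S.coins.eval (κ p.1 + 1))).take
      (S.coins.eval (κ p.1 + 1)))) := by
    have : Poly fun p : γ × ℕ => S.coins.eval (κ p.1 + 1) := hc.comp fst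
    fun_prop
  exact Poly.tab hκ ((Poly.of_polyTime S.polyTime).comp (Poly.toRaw h1))

theorem map_sampleFuns (S : PPT) (κ : ℕ) :
    (fairCoins (κ * S.coins.eval (κ + 1))).map (sampleFuns S κ) =
      (iid (S.run (Code.nat.enc κ)) κ).map fun v => List.ofFn fun i => Raw.mk (v i) := by
  -- In unary with terminator the security parameter takes `κ + 1` symbols; this is the argument of
  -- `S.coins` throughout.
  have h : size (Code.nat.enc κ) = κ + 1 := bits_nat κ
  rw [PPT.run_eq, h, ← fairCoins_blocks, PMF.map_comp]
  refine map_congr_support _ fun u _ => ?_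
  rw [sampleFuns, tab_eq_ofFn]
  rfl

/-- Keys from coins. -/
def sampleKey (S : PPT) (ℓ : ℕ → ℕ) (κ : ℕ) (r : List ℕ) : List Raw × List (List ℕ) :=
  (sampleFuns S κ (r.take (κ * S.coins.eval (κ + 1))),
    sampleMat κ (2 * ℓ κ) (modulus ℓ κ) κ
      ((r.drop (κ * S.coins.eval (κ + 1))).take (κ * (2 * ℓ κ * κ))))

variable {ℓ t : ℕ → ℕ}

theorem sampleKey_poly (S : PPT) (hℓ : Poly ℓ) :
    Poly fun p : ℕ × Raw => sampleKey S ℓ p.1 p.2.list := by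
  have hq := modulus_poly hℓ
  have hc : Poly fun κ : ℕ => S.coins.eval (κ + 1) := Poly.polynomial_eval (by fun_prop) _
  have hc' : Poly fun p : ℕ × Raw => S.coins.eval (p.1 + 1) := hc.comp Poly.fst
  refine Poly.prodMk (by fun_prop) (Poly.sampleMat (by fun_prop) (by fun_prop) (by fun_prop)
    (by fun_prop) (by fun_prop) fun e => NeZero.pos _)

theorem map_sampleKey (S : PPT) (κ N : ℕ)
    (hN : κ * S.coins.eval (κ + 1) + κ * (2 * ℓ κ * κ) ≤ N) :
    (fairCoins N).map (sampleKey S ℓ κ) =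
      ((iid (S.run (Code.nat.enc κ)) κ).map fun v => List.ofFn fun i => Raw.mk (v i)).bind fun x =>
        ((fairCoins (κ * (2 * ℓ κ * κ))).map (sampleMat κ (2 * ℓ κ) (modulus ℓ κ) κ)).map
          fun y => (x, y) := by
  have h1 : (fairCoins N).map (sampleKey S ℓ κ) = ((fairCoins N).map
      (List.take (κ * S.coins.eval (κ + 1) + κ * (2 * ℓ κ * κ)))).map (sampleKey S ℓ κ) := by
    rw [PMF.map_comp]
    refine map_congr_support _ fun r _ => ?_
    simp [sampleKey, List.take_take, List.drop_take]
  rw [h1, fairCoins_take hN, fairCoins_add, PMF.map_bind, ← map_sampleFuns, PMF.bind_map]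
  refine bind_congr_support _ fun u hu => ?_
  rw [Function.comp_apply, PMF.map_comp, PMF.map_comp]
  refine map_congr_support _ fun v hv => ?_
  have hu' := length_of_mem_support_fairCoins hu
  have hv' := length_of_mem_support_fairCoins hv
  simp only [Function.comp_apply, sampleKey]
  rw [List.take_left' hu', List.drop_left' hu', List.take_of_length_le hv'.le]

variable {R : FunctionFamily (fun κ => 2 * ℓ κ) fun κ => 2 * (2 * t κ)}

/-- The key distribution of the hash family. -/
def sisKeyDist (R : FunctionFamily (fun κ => 2 * ℓ κ) fun κ => 2 * (2 * t κ)) (κ : ℕ) :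
    PMF (SisKey ℓ κ) :=
  (iid (R.keyDist κ) κ).bind fun r =>
    (PMF.uniformOfFintype (Matrix (Fin κ) (Fin (2 * ℓ κ)) (ZMod (modulus ℓ κ)))).map
      fun A => (r, A)

theorem map_keyList_sisKeyDist (κ : ℕ) : (sisKeyDist R κ).map keyList =
    ((iid (R.keyDist κ) κ).map fun v => List.ofFn fun i => Raw.mk (v i)).bind fun x =>
      ((PMF.uniformOfFintype (Matrix (Fin κ) (Fin (2 * ℓ κ)) (ZMod (modulus ℓ κ)))).map
        matList).map fun y => (x, y) := by
  rw [sisKeyDist, PMF.map_bind, PMF.bind_map]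
  congr 1
  funext r
  rw [Function.comp_apply, PMF.map_comp, PMF.map_comp]
  rfl

/-- The serialisation of keys. -/
abbrev sisKeyCode (ℓ : ℕ → ℕ) (κ : ℕ) : Code (SisKey ℓ κ) :=
  (Code.list.vec κ).prod ((Code.zmod (modulus ℓ κ)).mat κ (2 * ℓ κ))

/-- The total error of the matrix when each of its `κ * 2ℓ` entries is made from `κ` coins; all
factors but `2^(-κ)` are polynomial. -/
theorem negligible_residue (hℓ : Poly ℓ) :
    Negligible fun κ => (κ : ℝ) * ((2 * ℓ κ : ℕ) * ((modulus ℓ κ : ℝ) / 2 ^ κ)) := by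
  have hq := modulus_poly hℓ
  have : Poly fun κ => κ * (2 * ℓ κ * modulus ℓ κ) := by fun_prop
  obtain ⟨p, hp⟩ := this.nat_le.of_bits
  refine ((negligible_pow (ρ := 1 / 2) (by norm_num) (by norm_num)).polynomial_mul
    (fun κ => by positivity) p).mono fun κ _ => ?_
  have h1 : ((κ * (2 * ℓ κ * modulus ℓ κ) : ℕ) : ℝ) ≤ (p.eval κ : ℕ) := by exact_mod_cast hp κ
  refine le_trans (le_of_eq ?_) (mul_le_mul_of_nonneg_right h1 (by positivity))
  push_cast
  rw [div_pow, one_pow]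
  ring

theorem bits_keyList_le (hℓ : Poly ℓ) {b : ℕ → ℕ} (hb : PolyBdd (fun κ : ℕ => κ) b) :
    ∃ p : Polynomial ℕ, ∀ κ, ∀ h : SisKey ℓ κ, (∀ i, size (h.1 i) ≤ b κ) →
      bits (keyList h) ≤ p.eval κ := by
  have hq := (modulus_poly hℓ).nat_le.of_bits
  have hl := hℓ.nat_le.of_bits
  have h1 : PolyBdd (fun κ : ℕ => κ) fun κ => 2 * (κ * (2 * b κ + 1) +
      κ * (2 * ((2 * ℓ κ) * (2 * (modulus ℓ κ + 1) + 1)) + 1)) + 2 :=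
    .add (.mul (.const 2) (.add (.mul .self (.add (.mul (.const 2) hb) (.const 1)))
      (.mul .self (.add (.mul (.const 2) (.mul (.mul (.const 2) hl)
        (.add (.mul (.const 2) (hq.add (.const 1))) (.const 1)))) (.const 1))))) (.const 2)
  obtain ⟨p, hp⟩ := h1
  refine ⟨p, fun κ h hh => le_trans ?_ (hp κ)⟩
  have h2 : bits (keyList h).1 ≤ κ * (2 * b κ + 1) := by
    refine (bits_list_le (M := b κ) fun a ha => ?_).trans_eq (by simp [keyList])
    obtain ⟨i, rfl⟩ := (List.mem_ofFn' _ _).1 ha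
    exact hh i
  have h3 : bits (keyList h).2 ≤
      κ * (2 * ((2 * ℓ κ) * (2 * (modulus ℓ κ + 1) + 1)) + 1) := by
    refine (bits_list_le (M := (2 * ℓ κ) * (2 * (modulus ℓ κ + 1) + 1))
      fun w hw => ?_).trans_eq (by simp [keyList, matList])
    obtain ⟨i, rfl⟩ := (List.mem_ofFn' _ _).1 hw
    refine (bits_list_le (M := modulus ℓ κ + 1) fun a ha => ?_).trans_eq (by simp)
    obtain ⟨j, rfl⟩ := (List.mem_ofFn' _ _).1 ha
    rw [bits_nat]
    exact Nat.succ_le_succ (ZMod.val_lt _).le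
  have := bits_pair_le (keyList h)
  dsimp only
  omega

theorem samplable_key (hℓ : Poly ℓ) (hR : R.IsEfficient) :
    Samplable (sisKeyCode ℓ) (sisKeyDist R) := by
  obtain ⟨⟨b, hb⟩, S, ε, hε, hS⟩ := hR.sample
  refine ⟨?_, ?_⟩
  · obtain ⟨p, hp⟩ := bits_keyList_le hℓ (b := fun κ => b.eval κ) ⟨b, fun κ => le_rfl⟩
    refine ⟨p, fun κ h hh => ?_⟩
    rw [enc_keyList]
    refine hp κ h fun i => hb κ _ ?_
    rw [sisKeyDist, PMF.mem_support_bind_iff] at hh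
    obtain ⟨r, hr, hh⟩ := hh
    rw [PMF.mem_support_map_iff] at hh
    obtain ⟨A, -, rfl⟩ := hh
    exact mem_support_iid hr i
  · obtain ⟨F, hF, hFS⟩ := sampleKey_poly S hℓ
    have hc : Poly fun κ : ℕ => S.coins.eval (κ + 1) := Poly.polynomial_eval (by fun_prop) _
    have hN : Poly fun κ : ℕ => κ * S.coins.eval (κ + 1) + κ * (2 * ℓ κ * κ) := by fun_prop
    obtain ⟨P, hP⟩ := hN.nat_le
    refine ⟨⟨F, hF, P⟩, fun κ => (κ : ℝ) * ((2 * ℓ κ : ℕ) * ((modulus ℓ κ : ℝ) / 2 ^ κ)) + κ * ε κ,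
      (negligible_residue hℓ).add hε.nat_mul, fun κ => ?_⟩
    have h1 : PPT.run ⟨F, hF, P⟩ (Code.nat.enc κ) =
        ((fairCoins (P.eval (size (Code.nat.enc κ)))).map (sampleKey S ℓ κ)).map Enc.enc := by
      rw [PPT.run_eq, PMF.map_comp]
      exact map_congr_support _ fun r _ => hFS (κ, ⟨r⟩)
    have h2 : (sisKeyDist R κ).map (sisKeyCode ℓ κ).enc =
        ((sisKeyDist R κ).map keyList).map Enc.enc := by
      rw [PMF.map_comp]
      exact map_congr_support _ fun h _ => enc_keyList h
    intro E
    rw [h1, h2, map_sampleKey S κ (P.eval (size (Code.nat.enc κ))) (hP κ), map_keyList_sisKeyDist]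
    have h3 : Close (S.run (Code.nat.enc κ)) (R.keyDist κ) (ε κ) := fun E => by
      have := hS κ E
      rwa [show (R.keyDist κ).map (Code.list).enc = R.keyDist κ from PMF.map_id _] at this
    -- First the matrix is exchanged for a uniform one, with the sampled function keys kept; then
    -- the function keys are exchanged.
    exact ((Close.bind_right _ fun x =>
      (close_sampleMat κ (2 * ℓ κ) (modulus ℓ κ) κ).map fun y => (x, y)).trans
        (((h3.iid κ).map _).bind_left _)).map _ E

theorem isEfficient_sisHammingPPH (hℓ : Poly ℓ) (ht : Poly t) (hR : R.IsEfficient) :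
    (sisHammingPPH ℓ t R).IsEfficient := by
  obtain ⟨ρ, hρ, hρR⟩ := hR.exists_poly
  refine ⟨samplable_key hℓ hR, ?_, ?_⟩
  · obtain ⟨F, hF, h⟩ := hashList_poly hℓ ht hρ
    have h1 : ∀ κ (k : SisKey ℓ κ) (x : Fin (ℓ κ) → Bool),
        F ((Code.nat.prod ((sisKeyCode ℓ κ).prod (Code.bool.vec (ℓ κ)))).enc (κ, k, x)) =
          ((((Code.zmod (modulus ℓ κ)).vec κ).vec (2 * (2 * t κ))).vec κ).enc
            ((sisHammingPPH ℓ t R).hash κ k x) := by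
      intro κ k x
      refine Eq.trans (Eq.trans (congrArg F ?_) (h (κ, (keyList k, List.ofFn x))))
        ((congrArg Enc.enc (hashList_eq hρR κ k x)).trans (enc_sketchList _).symm)
      change pack [_, pack [_, _]] = pack [_, pack [_, _]]
      rw [enc_keyList, enc_boolVec]
      rfl
    exact ⟨F, hF, h1⟩
  · obtain ⟨F, hF, h⟩ := evalList_poly hℓ ht hρ
    have h1 : ∀ κ (k : SisKey ℓ κ) (y₀ y₁ : SisImg ℓ t κ),
        F ((Code.nat.prod ((sisKeyCode ℓ κ).prod
          (((((Code.zmod (modulus ℓ κ)).vec κ).vec (2 * (2 * t κ))).vec κ).prod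
          ((((Code.zmod (modulus ℓ κ)).vec κ).vec (2 * (2 * t κ))).vec κ)))).enc (κ, k, y₀, y₁)) =
          Code.bool.enc ((sisHammingPPH ℓ t R).eval κ k y₀ y₁) := by
      intro κ k y₀ y₁
      refine Eq.trans (Eq.trans (congrArg F ?_)
        (h (κ, (keyList k, (sketchList y₀, sketchList y₁))))) (congrArg Enc.enc (evalList_eq hρR κ k y₀ y₁))
      change pack [_, pack [_, pack [_, _]]] = pack [_, pack [_, pack [_, _]]]
      rw [enc_keyList, enc_sketchList, enc_sketchList]
      rfl
    exact ⟨F, hF, h1⟩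

/-! ### Compression -/

section Compression

variable {ℓ t : ℕ → ℕ} {κ : ℕ}

theorem two_le_modulus (hκ : 0 < κ) (hℓ : 0 < ℓ κ) : 2 ≤ modulus ℓ κ := by
  refine le_max_of_le_right (Nat.le_sqrt.2 ?_)
  nlinarith

theorem modulus_sq_le (hκ : 0 < κ) : modulus ℓ κ ^ 2 ≤ κ * (2 * ℓ κ + 3) := by
  have h : 1 ≤ Nat.sqrt (κ * (2 * ℓ κ + 3)) := Nat.le_sqrt.2 (by nlinarith)
  rw [modulus, max_eq_right h]
  exact Nat.sqrt_le' _

/-- The domain has `2^ℓ` elements and there are `q^(4tκ²)` hash values, so the denominator `ℓ`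
cancels. -/
theorem compressingAt_iff (R : FunctionFamily (fun κ => 2 * ℓ κ) fun κ => 2 * (2 * t κ))
    (hℓ : 0 < ℓ κ) (x : ℝ) : (sisHammingPPH ℓ t R).CompressingAt κ (x / (ℓ κ : ℝ)) ↔
      4 * (t κ : ℝ) * (κ : ℝ) ^ 2 * Real.logb 2 (modulus ℓ κ) ≤ x := by
  have hℓR : (ℓ κ : ℝ) ≠ 0 := by positivity
  have h1 : Nat.card ((sisHammingPPH ℓ t R).Dom κ) = 2 ^ ℓ κ := by
    change Nat.card (Fin (ℓ κ) → Bool) = _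
    simp
  have h2 : Nat.card ((sisHammingPPH ℓ t R).Img κ) = modulus ℓ κ ^ (κ * (2 * (2 * t κ)) * κ) := by
    change Nat.card (Fin κ → Fin (2 * (2 * t κ)) → Fin κ → ZMod (modulus ℓ κ)) = _
    simp only [Nat.card_eq_fintype_card, Fintype.card_pi, Finset.prod_const, Finset.card_univ,
      Fintype.card_fin, ZMod.card, ← pow_mul]
  have h3 : Finite ((sisHammingPPH ℓ t R).Dom κ) := inferInstanceAs (Finite (Fin (ℓ κ) → Bool))
  have h4 : Finite ((sisHammingPPH ℓ t R).Img κ) :=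
    inferInstanceAs (Finite (Fin κ → Fin (2 * (2 * t κ)) → Fin κ → ZMod (modulus ℓ κ)))
  rw [HashScheme.CompressingAt, h1, h2]
  simp only [h3, h4, true_and, Nat.cast_pow, Real.logb_pow, Nat.cast_ofNat]
  rw [Real.logb_self_eq_one (by norm_num), mul_one, div_mul_cancel₀ _ hℓR]
  push_cast
  ring_nf

theorem compression (R : FunctionFamily (fun κ => 2 * ℓ κ) fun κ => 2 * (2 * t κ))
    (hκ : 0 < κ) (ht : 0 < t κ) (hℓ : 0 < ℓ κ) :
    0 < 4 * (t κ : ℝ) * (κ : ℝ) ^ 2 * Real.logb 2 (modulus ℓ κ) / (ℓ κ : ℝ) ∧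
      (sisHammingPPH ℓ t R).CompressingAt κ
        (4 * (t κ : ℝ) * (κ : ℝ) ^ 2 * Real.logb 2 (modulus ℓ κ) / (ℓ κ : ℝ)) ∧
      (sisHammingPPH ℓ t R).CompressingAt κ
        (2 * (t κ : ℝ) * (κ : ℝ) ^ 2 * Real.logb 2 ((κ : ℝ) * (2 * (ℓ κ : ℝ) + 3)) / (ℓ κ : ℝ)) ∧
      (κ ≤ 2 * ℓ κ + 3 → (sisHammingPPH ℓ t R).CompressingAt κ
        (4 * ((t κ : ℝ) * (κ : ℝ) ^ 2 * Real.logb 2 (2 * (ℓ κ : ℝ) + 3) / (ℓ κ : ℝ)))) := by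
  have hq : (2 : ℝ) ≤ modulus ℓ κ := by exact_mod_cast two_le_modulus hκ hℓ
  have hκR : (0 : ℝ) < κ := by exact_mod_cast hκ
  -- The modulus is a rounded-down square root; this turns the factor 4 of the exact count into 2.
  have h1 : 2 * Real.logb 2 (modulus ℓ κ) ≤ Real.logb 2 ((κ : ℝ) * (2 * (ℓ κ : ℝ) + 3)) := by
    rw [← Nat.cast_ofNat, ← Real.logb_pow]
    refine Real.logb_le_logb_of_le (by norm_num) (by positivity) ?_
    exact_mod_cast modulus_sq_le hκ
  have h2 : 0 < Real.logb 2 (modulus ℓ κ) := Real.logb_pos (by norm_num) (by linarith)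
  have h3 : (0 : ℝ) ≤ 2 * (t κ : ℝ) * (κ : ℝ) ^ 2 := by positivity
  refine ⟨by positivity, (compressingAt_iff R hℓ _).2 le_rfl, (compressingAt_iff R hℓ _).2 ?_,
    fun hle => ?_⟩
  · have := mul_le_mul_of_nonneg_left h1 h3
    linarith
  · rw [← mul_div_assoc, compressingAt_iff R hℓ]
    have h4 : Real.logb 2 ((κ : ℝ) * (2 * (ℓ κ : ℝ) + 3)) ≤
        2 * Real.logb 2 (2 * (ℓ κ : ℝ) + 3) := by
      rw [Real.logb_mul hκR.ne' (by positivity)]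
      have h5 : (κ : ℝ) ≤ 2 * (ℓ κ : ℝ) + 3 := by exact_mod_cast hle
      have h6 := Real.logb_le_logb_of_le (b := 2) (by norm_num) hκR h5
      linarith
    have := mul_le_mul_of_nonneg_left (h1.trans h4) h3
    linarith

end Compression

/-! ### Extraction of short vectors -/

/-- The nonnegative part of `cellVec` that comes from one of the two sets. -/
def cellPart (d₀ : ℕ) (rt : List (List ℕ)) (peeled mem : List ℕ) (i j x d y : ℕ) : ℕ :=
  (bif Nat.beq (at1 peeled y) 0 && Nat.beq (at2 rt i y) j then at1 mem y else 0) +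
    (bif Nat.beq y x && Nat.beq d d₀ then 1 else 0)

/-- The two nonnegative parts of `cellVec`. -/
def cellParts (m : ℕ) (rt : List (List ℕ)) (peeled mem₀ mem₁ : List ℕ) (i j x d : ℕ) :
    List ℕ × List ℕ :=
  (tab m fun y => cellPart 2 rt peeled mem₀ i j x d y,
    tab m fun y => cellPart 1 rt peeled mem₁ i j x d y)

/-- The difference of the two vectors is a nonzero vector in the kernel. -/
def isKernelPair (n m q : ℕ) (A : List (List ℕ)) (s : List ℕ × List ℕ) : Bool :=
  ((List.range n).all fun a => Nat.beq ((tab m fun y => at2 A a y * at1 s.1 y).sum % q)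
    ((tab m fun y => at2 A a y * at1 s.2 y).sum % q)) &&
  (List.range m).any fun y => !Nat.beq (at1 s.1 y) (at1 s.2 y)

/-- The code of a difference. -/
def subCode (a b : ℕ) : ℕ := bif Nat.ble b a then 2 * (a - b) else 2 * (b - a) - 1

/-- All candidates for short vectors. -/
def candidates (ℓ t : ℕ → ℕ) (ρ : ℕ × (Raw × ℕ) → ℕ)
    (p : ℕ × ((List Raw × List (List ℕ)) × (List Bool × List Bool))) : List (List ℕ × List ℕ) :=
  (List.range (2 * ℓ p.1 + 1)).flatMap fun N => (List.range p.1).flatMap fun i =>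
    (List.range (2 * (2 * t p.1))).flatMap fun j => (List.range (2 * ℓ p.1)).flatMap fun x =>
      (List.range 3).map fun d => cellParts (2 * ℓ p.1) (keyTable ρ p.1 (2 * ℓ p.1) p.2.1.1)
        (peelState ℓ t ρ N p.1 p.2.1 (hashList ℓ t ρ (p.1, (p.2.1, p.2.2.1)),
          hashList ℓ t ρ (p.1, (p.2.1, p.2.2.2)))).2
        (membList (ℓ p.1) p.2.2.1) (membList (ℓ p.1) p.2.2.2) i j x d

/-- The code of a short kernel vector, if there is one among the candidates. -/
def extractList (ℓ t : ℕ → ℕ) (ρ : ℕ × (Raw × ℕ) → ℕ)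
    (p : ℕ × ((List Raw × List (List ℕ)) × (List Bool × List Bool))) : List ℕ :=
  tab (2 * ℓ p.1) fun y => subCode
    (at1 (((candidates ℓ t ρ p).filter fun s => isKernelPair p.1 (2 * ℓ p.1) (modulus ℓ p.1) p.2.1.2 s).headD
      ([], [])).1 y)
    (at1 (((candidates ℓ t ρ p).filter fun s => isKernelPair p.1 (2 * ℓ p.1) (modulus ℓ p.1) p.2.1.2 s).headD
      ([], [])).2 y)

section

variable {γ : Type} [Enc γ] {ℓ t : ℕ → ℕ} {ρ : ℕ × (Raw × ℕ) → ℕ}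

@[fun_prop]
theorem Poly.cellParts {m i j x d : γ → ℕ} {rt : γ → List (List ℕ)}
    {peeled mem₀ mem₁ : γ → List ℕ} (hm : Poly m) (hrt : Poly rt) (hp : Poly peeled)
    (h₀ : Poly mem₀) (h₁ : Poly mem₁) (hi : Poly i) (hj : Poly j) (hx : Poly x) (hd : Poly d) :
    Poly fun e => cellParts (m e) (rt e) (peeled e) (mem₀ e) (mem₁ e) (i e) (j e) (x e) (d e) := by
  unfold RobustPPH.cellParts cellPart; fun_prop

@[fun_prop]
theorem Poly.isKernelPair {n m q : γ → ℕ} {A : γ → List (List ℕ)} {s : γ → List ℕ × List ℕ}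
    (hn : Poly n) (hm : Poly m) (hq : Poly q) (hA : Poly A) (hs : Poly s) :
    Poly fun e => isKernelPair (n e) (m e) (q e) (A e) (s e) := by
  unfold RobustPPH.isKernelPair; fun_prop

theorem candidates_poly (hℓ : Poly ℓ) (ht : Poly t) (hρ : Poly ρ) :
    Poly (candidates ℓ t ρ) := by
  have hh := hashList_poly hℓ ht hρ
  unfold candidates
  fun_prop

theorem extractList_poly (hℓ : Poly ℓ) (ht : Poly t) (hρ : Poly ρ) :
    Poly (extractList ℓ t ρ) := by
  have hc := candidates_poly hℓ ht hρ
  have hq := modulus_poly hℓ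
  unfold extractList subCode
  fun_prop

end

/-- The SIS game reads integers in the code with nonnegative `n` at `2n` and `-n` at `2n - 1`. -/
theorem subCode_eq (a b : ℕ) : subCode a b = Equiv.intEquivNat ((a : ℤ) - b) := by
  have h1 : ∀ n : ℕ, Equiv.intEquivNat (n : ℤ) = 2 * n := fun n => rfl
  have h2 : ∀ n : ℕ, Equiv.intEquivNat (Int.negSucc n) = 2 * n + 1 := fun n => rfl
  rw [subCode]
  by_cases h : b ≤ a
  · rw [Nat.ble_eq_true_of_le h, cond_true, ← Nat.cast_sub h, h1]
  · have hb : Nat.ble b a = false := by rwa [Bool.eq_false_iff, ne_eq, Nat.ble_eq]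
    rw [hb, cond_false, show (a : ℤ) - b = Int.negSucc (b - a - 1) by omega, h2]
    omega

/-! ### Candidate vectors and their norms -/

section

variable {k n m q c : ℕ}

/-- Lists hold natural numbers only, so a signed vector is kept as a difference of two. The
coefficient -1 is coded by 2; since `cellVec` subtracts the coefficient, this code adds 1 to the
positive part, and code 1 adds 1 to the negative part. -/
theorem cellParts_eq (r : Fin k → Fin m → Fin c) (X₀ X₁ Z : Finset (Fin m)) (i : Fin k)
    (j : Fin c) (x : Fin m) (d : ℕ) :
    ∃ P P' : Fin m → ℕ, cellParts m (tableList r) (setList Z) (setList X₀) (setList X₁) i j x d =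
        (List.ofFn P, List.ofFn P') ∧
      ∀ y, (P y : ℤ) - P' y = cellVec r (restrictOff (signedDiff X₀ X₁) Z) i j x
        (if d = 1 then 1 else if d = 2 then -1 else 0) y := by
  refine ⟨fun y => cellPart 2 (tableList r) (setList Z) (setList X₀) i j x d y,
    fun y => cellPart 1 (tableList r) (setList Z) (setList X₁) i j x d y,
    by rw [cellParts, tab_eq_ofFn, tab_eq_ofFn], fun y => ?_⟩
  have hrt : Nat.beq (at2 (tableList r) i y) j = decide (r i y = j) := by
    rw [tableList, at2_ofFn (fun i y => (r i y).val), Bool.eq_iff_iff, Nat.beq_eq,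
      decide_eq_true_eq, Fin.ext_iff]
  have hyx : Nat.beq y x = decide (y = x) := by
    rw [Bool.eq_iff_iff, Nat.beq_eq, decide_eq_true_eq, Fin.ext_iff]
  have hmem : ∀ X : Finset (Fin m), at1 (setList X) y = if y ∈ X then 1 else 0 := fun X =>
    at1_ofFn _ y
  have hd : ∀ d₀, Nat.beq d d₀ = decide (d = d₀) := fun d₀ => by
    rw [Bool.eq_iff_iff, Nat.beq_eq, decide_eq_true_eq]
  have hZ : Nat.beq (at1 (setList Z) y) 0 = decide (y ∉ Z) := by
    rw [hmem, Bool.eq_iff_iff, Nat.beq_eq, decide_eq_true_eq]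
    split <;> simp_all
  simp only [cellPart, cellVec, restrictOff, signedDiff]
  rw [hrt, hyx, hd, hd, hZ, hmem, hmem]
  by_cases h2 : y = x
  · subst h2
    by_cases h1 : r i y = j <;> by_cases h3 : y ∈ Z <;> by_cases h4 : d = 2 <;>
      simp [h1, h3, h4]
    all_goals by_cases h6 : d = 1 <;> (try simp [h6]) <;> ring1
  · by_cases h1 : r i y = j <;> by_cases h3 : y ∈ Z <;> simp [h1, h2, h3]

theorem isKernelPair_iff [NeZero q] (A : Matrix (Fin n) (Fin m) (ZMod q)) (P P' : Fin m → ℕ) :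
    isKernelPair n m q (matList A) (List.ofFn P, List.ofFn P') = true ↔
      A.mulVec (fun y => (((P y : ℤ) - P' y : ℤ) : ZMod q)) = 0 ∧
        (fun y => (P y : ℤ) - P' y) ≠ 0 := by
  have hsum : ∀ (Q : Fin m → ℕ) (a : Fin n),
      (((tab m fun y => at2 (matList A) a y * at1 (List.ofFn Q) y).sum : ℕ) : ZMod q) =
        ∑ y, A a y * Q y := by
    intro Q a
    rw [tab_eq_ofFn, List.sum_ofFn, Nat.cast_sum]
    refine Finset.sum_congr rfl fun y _ => ?_
    rw [matList, at2_ofFn (fun a y => (A a y).val), at1_ofFn Q, Nat.cast_mul,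
      ZMod.natCast_zmod_val]
  have h1 : ((List.range n).all fun a => Nat.beq
      ((tab m fun y => at2 (matList A) a y * at1 (List.ofFn P) y).sum % q)
      ((tab m fun y => at2 (matList A) a y * at1 (List.ofFn P') y).sum % q)) = true ↔
      A.mulVec (fun y => (((P y : ℤ) - P' y : ℤ) : ZMod q)) = 0 := by
    have h2 : ∀ a : Fin n, (tab m fun y => at2 (matList A) a y * at1 (List.ofFn P) y).sum % q =
        (tab m fun y => at2 (matList A) a y * at1 (List.ofFn P') y).sum % q ↔
        A.mulVec (fun y => (((P y : ℤ) - P' y : ℤ) : ZMod q)) a = 0 := by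
      intro a
      rw [← ZMod.natCast_eq_natCast_iff', hsum, hsum, ← sub_eq_zero, ← Finset.sum_sub_distrib]
      simp only [Matrix.mulVec, dotProduct, ← mul_sub]
      push_cast
      rfl
    simp only [List.all_eq_true, List.mem_range, Nat.beq_eq]
    constructor
    · intro h
      funext a
      exact (h2 a).1 (h a a.2)
    · intro h a ha
      exact (h2 ⟨a, ha⟩).2 (congrFun h _)
  rw [isKernelPair, Bool.and_eq_true]
  dsimp only
  rw [h1]
  refine and_congr_right fun _ => ?_
  simp only [List.any_eq_true, List.mem_range, Bool.not_eq_true', ← Bool.not_eq_true, Nat.beq_eq,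
    ne_eq, funext_iff, not_forall, Pi.zero_apply]
  constructor
  · rintro ⟨y, hy, h⟩
    refine ⟨⟨y, hy⟩, fun h' => h ?_⟩
    rw [at1_ofFn P ⟨y, hy⟩, at1_ofFn P' ⟨y, hy⟩]
    omega
  · rintro ⟨y, h⟩
    refine ⟨y, y.2, fun h' => h ?_⟩
    rw [at1_ofFn P y, at1_ofFn P' y] at h'
    omega

theorem abs_cellVec_le (r : Fin k → Fin m → Fin c) (X₀ X₁ Z : Finset (Fin m)) (i : Fin k)
    (j : Fin c) (x : Fin m) {d : ℤ} (hd : d = 0 ∨ d = 1 ∨ d = -1) (y : Fin m) :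
    |cellVec r (restrictOff (signedDiff X₀ X₁) Z) i j x d y| ≤ if y = x then 2 else 1 := by
  have h := signedDiff_cases X₀ X₁ y
  rw [cellVec, restrictOff, abs_le]
  split <;> split <;> (try split) <;> constructor <;> omega

/-- Only coordinate `x` can reach absolute value 2, contributing 4 instead of 1. This is the origin
of `m + 3`. -/
theorem sum_cellVec_sq_le (r : Fin k → Fin m → Fin c) (X₀ X₁ Z : Finset (Fin m)) (i : Fin k)
    (j : Fin c) (x : Fin m) {d : ℤ} (hd : d = 0 ∨ d = 1 ∨ d = -1) :
    ∑ y, ((cellVec r (restrictOff (signedDiff X₀ X₁) Z) i j x d y : ℤ) : ℝ) ^ 2 ≤ m + 3 := by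
  have h : ∀ y, ((cellVec r (restrictOff (signedDiff X₀ X₁) Z) i j x d y : ℤ) : ℝ) ^ 2 ≤
      1 + if y = x then 3 else 0 := by
    intro y
    have h1 := abs_cellVec_le r X₀ X₁ Z i j x hd y
    have h2 : (cellVec r (restrictOff (signedDiff X₀ X₁) Z) i j x d y) ^ 2 ≤
        1 + if y = x then 3 else 0 := by
      rw [← sq_abs]
      refine (pow_le_pow_left₀ (abs_nonneg _) h1 2).trans ?_
      split <;> norm_num
    have h3 := (Int.cast_le (R := ℝ)).2 h2
    push_cast at h3
    exact h3
  refine (Finset.sum_le_sum fun y _ => h y).trans_eq ?_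
  rw [Finset.sum_add_distrib, Finset.sum_ite_eq']
  simp

end

variable {ℓ t : ℕ → ℕ} {R : FunctionFamily (fun κ => 2 * ℓ κ) fun κ => 2 * (2 * t κ)}

/-- The search runs through all rounds, cells, elements and coefficients, so a collision anywhere
guarantees a hit. The hit that is output need not be that collision: every candidate satisfies the
norm bounds, and the test checks the rest. -/
theorem extractList_spec {ρ : ℕ × (Raw × ℕ) → ℕ}
    (hρ : ∀ κ r (x : Fin (2 * ℓ κ)), ρ (κ, (⟨r⟩, x)) = R.eval κ r x) {κ : ℕ} (h : SisKey ℓ κ)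
    (x₀ x₁ : Fin (ℓ κ) → Bool) {N : ℕ} (hN : N ≤ 2 * ℓ κ)
    (hc : ¬ NoCollision (fun i => R.eval κ (h.1 i)) h.2
      (restrictOff (signedDiff (bitsToSet x₀) (bitsToSet x₁))
        (peeledSet (fun i => R.eval κ (h.1 i)) h.2
          (signedDiff (bitsToSet x₀) (bitsToSet x₁)) N))) :
    ∃ s : Fin (2 * ℓ κ) → ℤ,
      extractList ℓ t ρ (κ, (keyList h, (List.ofFn x₀, List.ofFn x₁))) =
        (List.ofFn fun y => Equiv.intEquivNat (s y)) ∧ s ≠ 0 ∧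
      h.2.mulVec (fun i => (s i : ZMod (modulus ℓ κ))) = 0 ∧
      Real.sqrt (∑ i, (s i : ℝ) ^ 2) ≤ Real.sqrt (2 * (ℓ κ : ℝ) + 3) ∧
      ∀ i, |(s i : ℝ)| ≤ 2 := by
  set r : Fin κ → Fin (2 * ℓ κ) → Fin (2 * (2 * t κ)) := fun i => R.eval κ (h.1 i) with hr
  set D := signedDiff (bitsToSet x₀) (bitsToSet x₁) with hD
  set L := candidates ℓ t ρ (κ, (keyList h, (List.ofFn x₀, List.ofFn x₁))) with hL
  have hmem : ∀ s, s ∈ L ↔ ∃ N ≤ 2 * ℓ κ, ∃ i : Fin κ, ∃ j : Fin (2 * (2 * t κ)),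
      ∃ x : Fin (2 * ℓ κ), ∃ d < 3, s = cellParts (2 * ℓ κ) (tableList r)
        (setList (peeledSet r h.2 D N)) (setList (bitsToSet x₀)) (setList (bitsToSet x₁)) i j x d := by
    intro s
    have hp : ∀ N, (peelState ℓ t ρ N κ (keyList h)
        (hashList ℓ t ρ (κ, (keyList h, List.ofFn x₀)),
          hashList ℓ t ρ (κ, (keyList h, List.ofFn x₁)))).2 = setList (peeledSet r h.2 D N) := by
      intro N
      have h3 := congrArg Prod.snd (peelState_eq hρ κ N h
        (sketchEncode r h.2 (bitsToSet x₀)) (sketchEncode r h.2 (bitsToSet x₁)))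
      rw [hashList_eq hρ, hashList_eq hρ]
      refine h3.trans ?_
      dsimp only
      rw [peeledSet, hD, ← sketchEncode_sub]
    rw [hL, candidates]
    simp only [hp, membList_eq]
    simp only [keyList, keyTable_eq (m := fun κ => 2 * ℓ κ) hρ, List.mem_flatMap, List.mem_map,
      List.mem_range, Nat.lt_succ_iff]
    constructor
    · rintro ⟨N, hN, i, hi, j, hj, x, hx, d, hd, rfl⟩
      exact ⟨N, hN, ⟨i, hi⟩, ⟨j, hj⟩, ⟨x, hx⟩, d, by omega, rfl⟩
    · rintro ⟨N, hN, i, j, x, d, hd, rfl⟩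
      exact ⟨N, hN, i, i.2, j, j.2, x, x.2, d, by omega, rfl⟩
  -- The assumed collision itself is a candidate that passes the test.
  have hne : (L.filter fun s => isKernelPair κ (2 * ℓ κ) (modulus ℓ κ) (matList h.2) s) ≠ [] := by
    simp only [NoCollision, not_forall] at hc
    obtain ⟨i, j, x, d, hd, hc, hc0⟩ := hc
    obtain ⟨d', hd', rfl⟩ : ∃ d' < 3, d = if d' = 1 then 1 else if d' = 2 then -1 else 0 := by
      rcases hd with rfl | rfl | rfl
      · exact ⟨0, by norm_num, rfl⟩
      · exact ⟨1, by norm_num, rfl⟩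
      · exact ⟨2, by norm_num, rfl⟩
    obtain ⟨P, P', h1, h2⟩ := cellParts_eq r (bitsToSet x₀) (bitsToSet x₁) (peeledSet r h.2 D N)
      i j x d'
    refine List.ne_nil_of_mem (List.mem_filter.2 ⟨(hmem _).2 ⟨N, hN, i, j, x, d', hd', rfl⟩, ?_⟩)
    rw [h1, isKernelPair_iff]
    simp only [h2]
    exact ⟨hc, hc0⟩
  obtain ⟨s, l, hl⟩ := List.exists_cons_of_ne_nil hne
  have hs : s ∈ L.filter fun s => isKernelPair κ (2 * ℓ κ) (modulus ℓ κ) (matList h.2) s := by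
    rw [hl]
    exact List.mem_cons_self
  rw [List.mem_filter, hmem] at hs
  obtain ⟨⟨M, hM, i, j, x, d, hd, hs⟩, hker⟩ := hs
  obtain ⟨P, P', h1, h2⟩ := cellParts_eq r (bitsToSet x₀) (bitsToSet x₁) (peeledSet r h.2 D M)
    i j x d
  rw [hs, h1, isKernelPair_iff] at hker
  have hd0 : ∀ d : ℕ, (if d = 1 then (1 : ℤ) else if d = 2 then -1 else 0) = 0 ∨
      (if d = 1 then (1 : ℤ) else if d = 2 then -1 else 0) = 1 ∨
      (if d = 1 then (1 : ℤ) else if d = 2 then -1 else 0) = -1 := by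
    intro d
    split <;> [skip; split] <;> simp
  refine ⟨fun y => (P y : ℤ) - P' y, ?_, hker.2, hker.1, ?_, fun y => ?_⟩
  · rw [extractList, ← hL]
    simp only [keyList, tab_eq_ofFn]
    rw [hl, List.headD_cons, hs, h1]
    congr 1
    funext y
    rw [at1_ofFn P y, at1_ofFn P' y, subCode_eq]
  · simp only [h2]
    refine Real.sqrt_le_sqrt ((sum_cellVec_sq_le r _ _ _ i j x (hd0 d)).trans_eq ?_)
    push_cast
    ring
  · dsimp only
    rw [h2, ← Int.cast_abs]
    have h3 : |cellVec r (restrictOff D (peeledSet r h.2 D M)) i j x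
        (if d = 1 then 1 else if d = 2 then -1 else 0) y| ≤ 2 :=
      (abs_cellVec_le r _ _ _ i j x (hd0 d) y).trans (by split <;> norm_num)
    exact_mod_cast h3

/-! ### The reduction to SIS -/

theorem size_le_of_le_one {l : List ℕ} (h : ∀ a ∈ l, a ≤ 1) : size l ≤ 2 * l.length := by
  induction l with
  | nil => simp [size_nil]
  | cons a l ih =>
    have h1 := ih fun b hb => h b (List.mem_cons_of_mem _ hb)
    have h2 := h a List.mem_cons_self
    rw [size_cons, List.length_cons]
    omega

/-- The adversary's input for a key made from the coins `u`. -/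
def adversaryInput (S : PPT) (e : ℕ × (ℕ × List (List ℕ))) (u : List ℕ) :
    ℕ × (List Raw × List (List ℕ)) := (e.1, (sampleFuns S e.1 u, e.2.2))

@[fun_prop]
theorem Poly.adversaryInput {γ : Type} [Enc γ] (S : PPT) {e : γ → ℕ × (ℕ × List (List ℕ))}
    {u : γ → List ℕ} (he : Poly e) (hu : Poly u) : Poly fun c => adversaryInput S (e c) (u c) := by
  unfold RobustPPH.adversaryInput; fun_prop

/-- The adversary's output, from its input and its coins, among more coins. -/
def adversaryOutput (𝒜 : PPT) (p : ℕ × (List Raw × List (List ℕ))) (r : List ℕ) : Raw :=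
  ⟨𝒜.machine (pack [Enc.enc p, r.take (𝒜.coins.eval (bits p))])⟩

@[fun_prop]
theorem Poly.adversaryOutput {γ : Type} [Enc γ] (𝒜 : PPT)
    {p : γ → ℕ × (List Raw × List (List ℕ))} {r : γ → List ℕ} (hp : Poly p) (hr : Poly r) :
    Poly fun c => adversaryOutput 𝒜 (p c) (r c) := by
  have h1 : Poly fun c => bits (p c) := Poly.bits_poly.comp hp
  have h2 : Poly fun c => 𝒜.coins.eval (bits (p c)) := Poly.polynomial_eval h1 _
  have h3 : Poly fun c => (Raw.mk (Enc.enc (p c)),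
      Raw.mk ((r c).take (𝒜.coins.eval (bits (p c))))) := by fun_prop
  exact (Poly.of_polyTime 𝒜.polyTime).comp (Poly.toRaw h3)

theorem map_adversaryOutput (𝒜 : PPT) (p : ℕ × (List Raw × List (List ℕ))) {N : ℕ}
    (hN : 𝒜.coins.eval (bits p) ≤ N) :
    (fairCoins N).map (adversaryOutput 𝒜 p) = (𝒜.run (Enc.enc p)).map Raw.mk := by
  rw [PPT.run_eq, PMF.map_comp, show size (Enc.enc p) = bits p from rfl, ← fairCoins_take hN,
    PMF.map_comp]
  rfl

/-- The output of the reduction with postprocessing `G`. -/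
def reductionOutput (S 𝒜 : PPT) (G : List ℕ → List ℕ)
    (p : (ℕ × (ℕ × List (List ℕ))) × Raw) : Raw :=
  ⟨G (Enc.enc (p.1.1, ((adversaryInput S p.1
    (p.2.list.take (p.1.1 * S.coins.eval (p.1.1 + 1)))).2, adversaryOutput 𝒜
      (adversaryInput S p.1 (p.2.list.take (p.1.1 * S.coins.eval (p.1.1 + 1))))
      (p.2.list.drop (p.1.1 * S.coins.eval (p.1.1 + 1))))))⟩

theorem reductionOutput_poly (S 𝒜 : PPT) {G : List ℕ → List ℕ} (hG : PolyTime G) :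
    Poly (reductionOutput S 𝒜 G) := by
  have hc : Poly fun κ : ℕ => S.coins.eval (κ + 1) := Poly.polynomial_eval (by fun_prop) _
  have hc' : Poly fun p : (ℕ × (ℕ × List (List ℕ))) × Raw => S.coins.eval (p.1.1 + 1) :=
    hc.comp (Poly.fst.comp Poly.fst)
  exact (Poly.of_polyTime hG).comp (Poly.toRaw (by fun_prop))

/-- The adversary's demand for coins depends on the length of the keys sampled for it. Coins are
single bits, so their list is short and a polynomial in the length of the SIS instance covers every
outcome. -/
theorem exists_coins_reduction (S 𝒜 : PPT) : ∃ P : Polynomial ℕ,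
    ∀ e : ℕ × (ℕ × List (List ℕ)), ∀ u ∈ (fairCoins (e.1 * S.coins.eval (e.1 + 1))).support,
      e.1 * S.coins.eval (e.1 + 1) + 𝒜.coins.eval (bits (adversaryInput S e u)) ≤
        P.eval (bits e) := by
  have hc : Poly fun κ : ℕ => S.coins.eval (κ + 1) := Poly.polynomial_eval (by fun_prop) _
  have hc' : Poly fun e : ℕ × (ℕ × List (List ℕ)) => e.1 * S.coins.eval (e.1 + 1) := by
    have : Poly fun e : ℕ × (ℕ × List (List ℕ)) => S.coins.eval (e.1 + 1) := hc.comp Poly.fst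
    fun_prop
  have hi : Poly fun p : (ℕ × (ℕ × List (List ℕ))) × Raw => adversaryInput S p.1 p.2.list := by
    fun_prop
  obtain ⟨p, hp⟩ := hi.bits_le
  have h1 := hc'.nat_le
  have h2 : PolyBdd bits fun e : ℕ × (ℕ × List (List ℕ)) => e.1 * S.coins.eval (e.1 + 1) +
      𝒜.coins.eval (p.eval (2 * (bits e + 2 * (e.1 * S.coins.eval (e.1 + 1))) + 2)) :=
    h1.add ((((PolyBdd.const 2).mul (PolyBdd.self.add ((PolyBdd.const 2).mul h1))).add
      (.const 2)).eval p |>.eval 𝒜.coins)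
  obtain ⟨P, hP⟩ := h2
  refine ⟨P, fun e u hu => le_trans (Nat.add_le_add_left (polynomial_eval_mono _ ?_) _) (hP e)⟩
  refine (hp (e, ⟨u⟩)).trans (polynomial_eval_mono _ ((bits_pair_le _).trans ?_))
  have h3 : bits (Raw.mk u) ≤ 2 * (e.1 * S.coins.eval (e.1 + 1)) := by
    refine (size_le_of_le_one (le_one_of_mem_support_fairCoins hu)).trans_eq ?_
    rw [length_of_mem_support_fairCoins hu]
  dsimp only
  omega

/-- The reduction simulates the adversary on keys with sampled functions. -/
theorem exists_reduction (S 𝒜 : PPT) {G : List ℕ → List ℕ} (hG : PolyTime G) :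
    ∃ ℬ : PPT, ∀ e : ℕ × (ℕ × List (List ℕ)), ℬ.run (Enc.enc e) =
      (iid (S.run (Code.nat.enc e.1)) e.1).bind fun v =>
        (𝒜.run (Enc.enc (e.1, (List.ofFn fun i => Raw.mk (v i), e.2.2)))).map fun out =>
          G (Enc.enc (e.1, ((List.ofFn fun i => Raw.mk (v i), e.2.2), Raw.mk out))) := by
  obtain ⟨F, hF, h⟩ := reductionOutput_poly S 𝒜 hG
  obtain ⟨P, hP⟩ := exists_coins_reduction S 𝒜
  refine ⟨⟨F, hF, P⟩, fun e => ?_⟩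
  have h1 : PPT.run ⟨F, hF, P⟩ (Enc.enc e) = (fairCoins (P.eval (bits e))).map fun r =>
      (reductionOutput S 𝒜 G (e, ⟨r⟩)).list := by
    rw [PPT.run_eq]
    exact map_congr_support _ fun r _ => h (e, ⟨r⟩)
  -- Any outcome will do: it shows that the available coins exceed those for the function keys, and
  -- `d` of them are left for the adversary.
  obtain ⟨u₀, hu₀⟩ := (fairCoins (e.1 * S.coins.eval (e.1 + 1))).support_nonempty
  obtain ⟨d, hd⟩ := Nat.exists_eq_add_of_le ((Nat.le_add_right _ _).trans (hP e u₀ hu₀))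
  have h2 : ((iid (S.run (Code.nat.enc e.1)) e.1).map fun v => List.ofFn fun i => Raw.mk (v i)) =
      (fairCoins (e.1 * S.coins.eval (e.1 + 1))).map (sampleFuns S e.1) :=
    (map_sampleFuns S e.1).symm
  have h3 := congrArg (fun p => PMF.bind p fun rs =>
    (𝒜.run (Enc.enc (e.1, (rs, e.2.2)))).map fun out =>
      G (Enc.enc (e.1, ((rs, e.2.2), Raw.mk out)))) h2
  simp only [PMF.bind_map] at h3
  refine Eq.trans ?_ h3.symm
  rw [h1, hd, fairCoins_add, PMF.map_bind]
  refine bind_congr_support _ fun u hu => ?_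
  have hu' := length_of_mem_support_fairCoins hu
  have hb := hP e u hu
  have h4 := map_adversaryOutput 𝒜 (adversaryInput S e u) (N := d) (by omega)
  have h5 := congrArg (PMF.map fun out : Raw =>
    G (Enc.enc (e.1, ((sampleFuns S e.1 u, e.2.2), out)))) h4
  rw [PMF.map_comp, PMF.map_comp] at h5
  refine Eq.trans ?_ h5
  rw [PMF.map_comp]
  refine map_congr_support _ fun v _ => ?_
  simp only [Function.comp_apply, reductionOutput]
  rw [List.take_left' hu', List.drop_left' hu']
  rfl

/-! ### Robustness from the hardness of SIS -/

section Robust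

variable {ℓ t : ℕ → ℕ} {R : FunctionFamily (fun κ => 2 * ℓ κ) fun κ => 2 * (2 * t κ)}

/-- The winning condition of the SIS game. -/
def sisWin (ℓ : ℕ → ℕ) (κ : ℕ) :
    Set (Matrix (Fin κ) (Fin (2 * ℓ κ)) (ZMod (modulus ℓ κ)) × List ℕ) :=
  {w | ∃ s : Fin (2 * ℓ κ) → ℤ, w.2 = (Code.int.vec (2 * ℓ κ)).enc s ∧ s ≠ 0 ∧
    w.1.mulVec (fun i => (s i : ZMod (modulus ℓ κ))) = 0 ∧
    Real.sqrt (∑ i, (s i : ℝ) ^ 2) ≤ Real.sqrt (2 * (ℓ κ : ℝ) + 3) ∧ ∀ i, |(s i : ℝ)| ≤ 2}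

/-- The winning condition of the adversary against the hash family. -/
def hashWin (R : FunctionFamily (fun κ => 2 * ℓ κ) fun κ => 2 * (2 * t κ)) (κ : ℕ) :
    Set (SisKey ℓ κ × List ℕ) :=
  {w | ∃ x₀ x₁, w.2 = ((Code.bool.vec (ℓ κ)).prod (Code.bool.vec (ℓ κ))).enc (x₀, x₁) ∧
    (sisHammingPPH ℓ t R).eval κ w.1 ((sisHammingPPH ℓ t R).hash κ w.1 x₀)
      ((sisHammingPPH ℓ t R).hash κ w.1 x₁) ≠ HAM (t κ) x₀ x₁}

/-- With isolating functions, evaluation can be wrong only after a collision in some round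
(`eval_hash_eq`), and the extractor turns a collision into a SIS solution. -/
theorem mem_sisWin_of_mem_hashWin {ρ : ℕ × (Raw × ℕ) → ℕ}
    (hρ : ∀ κ r (x : Fin (2 * ℓ κ)), ρ (κ, (⟨r⟩, x)) = R.eval κ r x) {G : List ℕ → List ℕ}
    (hG : ∀ p, G (Enc.enc p) = Enc.enc (extractList ℓ t ρ p)) {κ : ℕ} (hκ : 0 < κ)
    (w : SisKey ℓ κ × List ℕ) (hw : w ∈ hashWin R κ)
    (hr : Isolating (fun i => R.eval κ (w.1.1 i)) (2 * t κ)) :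
    (w.1.2, G (Enc.enc (κ, (keyList w.1, Raw.mk w.2)))) ∈ sisWin ℓ κ := by
  obtain ⟨h, out⟩ := w
  obtain ⟨x₀, x₁, hout, hne⟩ := hw
  dsimp only at hout hne hr ⊢
  by_contra hcon
  refine hne (eval_hash_eq hκ h x₀ x₁ hr fun N hN => ?_)
  by_contra hc
  obtain ⟨s, hs, h1⟩ := extractList_spec hρ h x₀ x₁ hN hc
  refine hcon ⟨s, ?_, h1⟩
  have h2 : Enc.enc (κ, (keyList h, Raw.mk out)) =
      Enc.enc (κ, (keyList h, (List.ofFn x₀, List.ofFn x₁))) := by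
    have h3 : out = Enc.enc (List.ofFn x₀, List.ofFn x₁) := by
      rw [hout]
      change pack [_, _] = pack [_, _]
      rw [enc_boolVec, enc_boolVec]
    rw [enc_pair, enc_pair (κ, _), enc_pair (keyList h, Raw.mk out),
      enc_pair (keyList h, (List.ofFn x₀, List.ofFn x₁))]
    simp only [enc_raw, h3]
  dsimp only
  rw [h2, hG, hs, enc_ofFn]
  rfl

/-- The game against the hash family. -/
def hashGame (R : FunctionFamily (fun κ => 2 * ℓ κ) fun κ => 2 * (2 * t κ)) (𝒜 : PPT) (κ : ℕ) :
    PMF (SisKey ℓ κ × List ℕ) :=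
  (sisKeyDist R κ).bind fun h => (𝒜.run (Enc.enc (κ, keyList h))).map fun out => (h, out)

/-- The key is drawn before the adversary runs, so events about the functions alone have their
original probability, whatever the adversary does. -/
theorem prob_hashGame_fst (𝒜 : PPT) (κ : ℕ) (E : Set (Fin κ → List ℕ)) :
    prob (hashGame R 𝒜 κ) {w | w.1.1 ∈ E} = prob (iid (R.keyDist κ) κ) E := by
  have h1 : (hashGame R 𝒜 κ).map (fun w => w.1.1) = iid (R.keyDist κ) κ := by
    rw [hashGame, PMF.map_bind]
    have hc : ∀ (p : PMF (List ℕ)) (a : Fin κ → List ℕ), (p.map fun _ => a) = PMF.pure a :=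
      fun p a => p.map_const a
    simp only [PMF.map_comp, Function.comp_def]
    rw [sisKeyDist, PMF.bind_bind]
    simp only [PMF.bind_map, Function.comp_def, hc, PMF.bind_const, PMF.bind_pure]
  rw [← h1, prob_map]
  rfl

/-- A win happens on functions that are not isolating or yields a SIS solution. The reduction's game
differs from the second event only in its function keys, which come from the sampler; hence the
three negligible summands. -/
theorem directAccessRobust_sisHammingPPH (hℓ : Poly ℓ) (ht : Poly t) (hR : R.IsEfficient)
    (hind : R.IsWiseIndependent fun κ => 2 * t κ)
    (hSIS : SISHard (fun κ => κ) (fun κ => 2 * ℓ κ) (modulus ℓ)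
      (fun κ => Real.sqrt (2 * (ℓ κ : ℝ) + 3)) fun _ => 2) (𝒜 : PPT) :
    Negligible fun κ => prob (hashGame R 𝒜 κ) (hashWin R κ) := by
  obtain ⟨ρ, hρ, hρR⟩ := hR.exists_poly
  obtain ⟨-, S, ε, hε, hS⟩ := hR.sample
  obtain ⟨G, hG, hGe⟩ := extractList_poly hℓ ht hρ
  obtain ⟨ℬ, hℬ⟩ := exists_reduction S 𝒜 hG
  have hsis : Negligible fun κ => prob
      ((PMF.uniformOfFintype (Matrix (Fin κ) (Fin (2 * ℓ κ)) (ZMod (modulus ℓ κ)))).bind fun A =>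
        (ℬ.run (Enc.enc (κ, (modulus ℓ κ, matList A)))).map fun out => (A, out)) (sisWin ℓ κ) := by
    refine (hSIS ℬ).mono fun κ _ => le_of_eq ?_
    refine congrArg₂ prob (congrArg _ (funext fun A => ?_)) rfl
    have henc : (Code.nat.prod (Code.nat.prod
        ((Code.zmod (modulus ℓ κ)).mat κ (2 * ℓ κ)))).enc (κ, modulus ℓ κ, A) =
        Enc.enc (κ, (modulus ℓ κ, matList A)) := by
      change pack [_, pack [_, _]] = pack [_, pack [_, _]]
      rw [enc_matList]
      rfl
    rw [← henc]
  have hbad : Negligible fun κ => 2 * ((2 * ℓ κ : ℕ) : ℝ) * (3 / 4) ^ (κ / 2) := by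
    have h1 : Poly fun κ => 2 * (2 * ℓ κ) := by fun_prop
    obtain ⟨p, hp⟩ := h1.nat_le.of_bits
    refine ((negligible_pow_half (ρ := 3 / 4) (by norm_num) (by norm_num)).polynomial_mul
      (fun κ => by positivity) p).mono fun κ _ => mul_le_mul_of_nonneg_right ?_ (by positivity)
    exact_mod_cast hp κ
  refine (hbad.add (hsis.add hε.nat_mul)).mono fun κ hκ => ?_
  have h3 : Close (S.run (Code.nat.enc κ)) (R.keyDist κ) (ε κ) := fun E => by
    have := hS κ E
    rwa [show (R.keyDist κ).map (Code.list).enc = R.keyDist κ from PMF.map_id _] at this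
  have hsub : hashWin R κ ⊆ {w | w.1.1 ∈ {v | ¬ Isolating (fun i => R.eval κ (v i)) (2 * t κ)}} ∪
      (fun w => (w.1.2, G (Enc.enc (κ, (keyList w.1, Raw.mk w.2))))) ⁻¹' sisWin ℓ κ := by
    intro w hw
    by_cases hr : Isolating (fun i => R.eval κ (w.1.1 i)) (2 * t κ)
    · exact .inr (mem_sisWin_of_mem_hashWin hρR hGe hκ w hw hr)
    · exact .inl hr
  refine (prob_mono _ hsub).trans ((prob_union_le _ _ _).trans (add_le_add ?_ ?_))
  · rw [prob_hashGame_fst]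
    exact prob_not_isolating_le (R.keyDist κ) (R.eval κ) rfl (hind κ) κ
  · rw [← prob_map]
    -- The matrix and the function keys are independent, so the matrix may be drawn first, as in the
    -- SIS game.
    have h4 : (hashGame R 𝒜 κ).map
        (fun w => (w.1.2, G (Enc.enc (κ, (keyList w.1, Raw.mk w.2))))) =
        (PMF.uniformOfFintype (Matrix (Fin κ) (Fin (2 * ℓ κ)) (ZMod (modulus ℓ κ)))).bind fun A =>
          (iid (R.keyDist κ) κ).bind fun v => (𝒜.run (Enc.enc (κ, keyList (v, A)))).map
            fun out => (A, G (Enc.enc (κ, (keyList (v, A), Raw.mk out)))) := by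
      rw [hashGame, sisKeyDist, PMF.map_bind, PMF.bind_bind, PMF.bind_comm]
      simp only [PMF.bind_map, PMF.map_comp, Function.comp_def]
    have h5 : ∀ A : Matrix (Fin κ) (Fin (2 * ℓ κ)) (ZMod (modulus ℓ κ)),
        (ℬ.run (Enc.enc (κ, (modulus ℓ κ, matList A)))).map (fun out => (A, out)) =
        (iid (S.run (Code.nat.enc κ)) κ).bind fun v => (𝒜.run (Enc.enc (κ, keyList (v, A)))).map
            fun out => (A, G (Enc.enc (κ, (keyList (v, A), Raw.mk out)))) := by
      intro A
      rw [hℬ, PMF.map_bind]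
      simp only [PMF.map_comp, Function.comp_def]
      rfl
    simp only [h5]
    rw [h4]
    -- For each fixed matrix, ideal function keys are exchanged for sampled ones at cost `κ * ε κ`.
    have h6 := Close.bind_right
      (PMF.uniformOfFintype (Matrix (Fin κ) (Fin (2 * ℓ κ)) (ZMod (modulus ℓ κ)))) fun A =>
        (h3.iid κ).bind_left fun v => (𝒜.run (Enc.enc (κ, keyList (v, A)))).map
          fun out => (A, G (Enc.enc (κ, (keyList (v, A), Raw.mk out))))
    have h7 := (abs_le.1 (h6 (sisWin ℓ κ))).1
    linarith

end Robust

end RobustPPH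

end

theorem mainTheorem5 (ℓ t : ℕ → ℕ)
    (hℓ : RobustPPH.EfficientParam ℓ) (ht : RobustPPH.EfficientParam t)
    (ht_pos : ∀ κ, 0 < t κ) (ht_le : ∀ κ, t κ ≤ ℓ κ)
    (R : RobustPPH.FunctionFamily (fun κ => 2 * ℓ κ) (fun κ => 2 * (2 * t κ)))
    (hR_eff : R.IsEfficient) (hR_ind : R.IsWiseIndependent fun κ => 2 * t κ)
    (hSIS : RobustPPH.SISHard (fun κ => κ) (fun κ => 2 * ℓ κ) (RobustPPH.modulus ℓ)
      (fun κ => Real.sqrt (2 * (ℓ κ : ℝ) + 3)) (fun _ => 2)) :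
    (RobustPPH.sisHammingPPH ℓ t R).IsEfficient ∧
    (RobustPPH.sisHammingPPH ℓ t R).DirectAccessRobust
      (fun κ (x y : Fin (ℓ κ) → Bool) => RobustPPH.HAM (t κ) x y) ∧
    ∀ κ : ℕ, 0 < κ →
      0 < 4 * (t κ : ℝ) * (κ : ℝ) ^ 2 * Real.logb 2 (RobustPPH.modulus ℓ κ) / (ℓ κ : ℝ) ∧
      (RobustPPH.sisHammingPPH ℓ t R).CompressingAt κ
        (4 * (t κ : ℝ) * (κ : ℝ) ^ 2 * Real.logb 2 (RobustPPH.modulus ℓ κ) / (ℓ κ : ℝ)) ∧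
      (RobustPPH.sisHammingPPH ℓ t R).CompressingAt κ
        (2 * (t κ : ℝ) * (κ : ℝ) ^ 2 * Real.logb 2 ((κ : ℝ) * (2 * (ℓ κ : ℝ) + 3)) / (ℓ κ : ℝ)) ∧
      (κ ≤ 2 * ℓ κ + 3 →
        (RobustPPH.sisHammingPPH ℓ t R).CompressingAt κ
          (4 * ((t κ : ℝ) * (κ : ℝ) ^ 2 * Real.logb 2 (2 * (ℓ κ : ℝ) + 3) / (ℓ κ : ℝ)))) := by
  refine ⟨RobustPPH.isEfficient_sisHammingPPH hℓ.poly ht.poly hR_eff, fun 𝒜 => ?_, fun κ hκ =>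
    RobustPPH.compression R hκ (ht_pos κ) ((ht_pos κ).trans_le (ht_le κ))⟩
  -- The two games differ only in how the key passed to the adversary is written; both
  -- serialisations give the same list.
  refine (RobustPPH.directAccessRobust_sisHammingPPH hℓ.poly ht.poly hR_eff hR_ind hSIS 𝒜).mono
    fun κ _ => le_of_eq (congrArg₂ RobustPPH.prob (congrArg _ (funext fun h => ?_)) rfl)
  exact congrArg (fun x => PMF.map (fun out => (h, out)) (𝒜.run x))
    (congrArg (fun k => RobustPPH.pack [RobustPPH.Code.nat.enc κ, k]) (RobustPPH.enc_keyList h))
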